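/- For coprime integers $a$ and $q\ge 1$ let $\operatorname{inv}_q(a)$ be the least positive integer $x$ with $ax\equiv 1 \pmod q$. Let $\alpha=v/w$ be a rational number in $(0,1]$ in lowest terms, with $w\ge 1$, and put $$F(\alpha)=\frac{1}{\alpha w^2}\sum_{1\le r<w}(1-\{\alpha r\})\,\zeta(2,r/w),\qquad \zeta(2,x)=\sum_{m\ge 0}\frac{1}{(m+x)^2},$$ where $\{\cdot\}$ is the fractional part. For real $U\ge 1$ consider the quadruples $(p,q,n,k)$ of positive integers with $$\gcd(p,q)=1,\quad p\ge 2,\quad q\ge 1,\quad 2\le nq+kp\le U^2,\quad 1\le k<n,\quad \operatorname{inv}_p(q)\le \alpha p .$$ Let $R_{i,\alpha}(U)$, $i=1,\dots,5$, be the number of those that satisfy in addition, respectively, 1. $p\le q\le U$; 2. $p\le q$ and $U<q$; 3. $q<p\le U$; 4. $q<p$, $U<p$ and $n\le U$; 5. $q<p$, $U<p$ and $U<n$. Then, with $\gamma$ the Euler–Mascheroni constant and with implied constants that are absolute (independent of $\alpha$ and $U$), 1. $R_{1,\alpha}(U)=\dfrac{\alpha\log 2}{2\zeta(2)}U^4\log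 U+O(U^4)$; 2. $R_{2,\alpha}(U)=\dfrac{\alpha\log 2}{2\zeta(2)}U^4\log U+O(U^4)$; 3. $\dfrac{R_{3,\alpha}(U)}{U^4}=\dfrac{\alpha(\log U)^2}{4\zeta(2)}+\dfrac{\alpha\log U}{2\zeta(2)}\Bigl(\gamma-\dfrac{\zeta'(2)}{\zeta(2)}+F(\alpha)-\log 2\Bigr)+O\bigl(1+(\log w)^2\bigr)$; 4. $R_{4,\alpha}(U)=\dfrac{\alpha U^4(\log U)^2}{4\zeta(2)}+\dfrac{\alpha U^4\log U}{2\zeta(2)}(\gamma-\log 2)+O(U^4)$; 5. if $w<U$, then $R_{5,\alpha}(U)=\dfrac{\alpha U^4(\log U)^2}{2\zeta(2)}+\dfrac{\alpha U^4\log U}{2\zeta(2)}\Bigl(2\gamma-\dfrac{\zeta'(2)}{\zeta(2)}+F(\alpha)-3\Bigr)+O(U^4)$. The asymptotic formulas 1–4 hold for all $U\ge 1$ and all such $\alpha$. -/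

import Mathlib

namespace GapSystem

/-- `inv a q` is the least positive integer `x` in the residue class `(a mod q)⁻¹`, that is, with
`a * x ≡ 1 (mod q)`; it is meant for coprime `a`, `q`. -/
noncomputable def inv (a q : ℕ) : ℕ :=
  sInf {x : ℕ | 0 < x ∧ a * x ≡ 1 [MOD q]}

theorem inv_spec {a q : ℕ} (hq : 0 < q) (h : Nat.Coprime a q) :
    0 < inv a q ∧ a * inv a q ≡ 1 [MOD q] := by
  have hne : {x : ℕ | 0 < x ∧ a * x ≡ 1 [MOD q]}.Nonempty := by
    haveI : NeZero q := ⟨hq.ne'⟩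
    refine ⟨((a : ZMod q)⁻¹).val + q, by omega, ?_⟩
    rw [← ZMod.natCast_eq_natCast_iff]
    simp [ZMod.coe_mul_inv_eq_one a h]
  exact Nat.sInf_mem hne

/-- The system of conditions, with parameter `α` and upper bound `Q`, on positive integers
`(p, q, n, k)`. -/
def IsSolution (α : ℚ) (Q : ℝ) (p q n k : ℕ) : Prop :=
  Nat.Coprime p q ∧ 2 ≤ p ∧ 1 ≤ q ∧
  2 ≤ n * q + k * p ∧ ((n * q + k * p : ℕ) : ℝ) ≤ Q ∧
  1 ≤ k ∧ k < n ∧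
  (inv q p : ℝ) ≤ (α : ℝ) * p

/-- The number of solutions `(p, q, n, k)` of the system with upper bound `U ^ 2` that satisfy in
addition the size constraint `c p q n`. -/
noncomputable def count (α : ℚ) (U : ℝ) (c : ℕ → ℕ → ℕ → Prop) : ℕ :=
  Set.ncard {x : ℕ × ℕ × ℕ × ℕ |
    IsSolution α (U ^ 2) x.1 x.2.1 x.2.2.1 x.2.2.2 ∧ c x.1 x.2.1 x.2.2.1}

/-- The sets whose cardinalities are taken in `count` are finite. -/
theorem finite_solutions (α : ℚ) (U : ℝ) (c : ℕ → ℕ → ℕ → Prop) :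
    {x : ℕ × ℕ × ℕ × ℕ |
      IsSolution α (U ^ 2) x.1 x.2.1 x.2.2.1 x.2.2.2 ∧ c x.1 x.2.1 x.2.2.1}.Finite := by
  apply (Set.finite_Iic ((⌊U ^ 2⌋₊, ⌊U ^ 2⌋₊, ⌊U ^ 2⌋₊, ⌊U ^ 2⌋₊) : ℕ × ℕ × ℕ × ℕ)).subset
  rintro ⟨p, q, n, k⟩ ⟨⟨-, hp, hq, -, hQ, hk, hkn, -⟩, -⟩
  simp only at hp hq hQ hk hkn
  have hB : n * q + k * p ≤ ⌊U ^ 2⌋₊ := Nat.le_floor hQ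
  have h1 : n ≤ n * q := Nat.le_mul_of_pos_right n hq
  have h2 : q ≤ n * q := Nat.le_mul_of_pos_left q (by omega)
  have h3 : p ≤ k * p := Nat.le_mul_of_pos_left p hk
  simp only [Set.mem_Iic, Prod.mk_le_mk]
  omega

/-- Solutions with `p ≤ q ≤ U`. -/
noncomputable def R1 (α : ℚ) (U : ℝ) : ℕ :=
  count α U fun p q _ => p ≤ q ∧ (q : ℝ) ≤ U

/-- Solutions with `p ≤ q` and `U < q`. -/
noncomputable def R2 (α : ℚ) (U : ℝ) : ℕ :=
  count α U fun p q _ => p ≤ q ∧ U < (q : ℝ)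

/-- Solutions with `q < p ≤ U`. -/
noncomputable def R3 (α : ℚ) (U : ℝ) : ℕ :=
  count α U fun p q _ => q < p ∧ (p : ℝ) ≤ U

/-- Solutions with `q < p`, `U < p` and `n ≤ U`. -/
noncomputable def R4 (α : ℚ) (U : ℝ) : ℕ :=
  count α U fun p q n => q < p ∧ U < (p : ℝ) ∧ (n : ℝ) ≤ U

/-- Solutions with `q < p`, `U < p` and `U < n`. -/
noncomputable def R5 (α : ℚ) (U : ℝ) : ℕ :=
  count α U fun p q n => q < p ∧ U < (p : ℝ) ∧ U < (n : ℝ)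

/-- For `α = v / w` in lowest terms,
`F α = (1 / (α w ^ 2)) * ∑_{1 ≤ r < w} (1 - {α r}) ζ(2, r / w)`, with the Hurwitz zeta function. -/
noncomputable def F (α : ℚ) : ℝ :=
  1 / ((α : ℝ) * (α.den : ℝ) ^ 2) *
    ∑ r ∈ Finset.Ioo 0 α.den,
      (1 - Int.fract ((α : ℝ) * r)) *
        (HurwitzZeta.hurwitzZeta (((r : ℝ) / (α.den : ℝ) : ℝ) : UnitAddCircle) 2).re

/-- The real number `ζ(2)`. -/
noncomputable def zetaTwo : ℝ := (riemannZeta 2).re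

/-- The real number `ζ'(2)`. -/
noncomputable def zetaTwoDeriv : ℝ := (deriv riemannZeta 2).re

end GapSystem

/-!
Fix coprime `p` and `q`. The condition on the inverse of `q` modulo `p` says that `q x ≡ 1 (mod p)`
for some `1 ≤ x ≤ α p`. By the identity `q x = 1 + p y` it also says, up to a boundary term that
disappears once `p` is at least the denominator of `α`, that `p y ≡ -1 (mod q)` for some
`0 ≤ y < α q` (`ite_admissible_eq_inv`, `ite_admissible_eq_of_den_le`). So one can always choose the
smaller of `p` and `q` as the modulus `m`. As the other variable `u` runs through an interval, the
condition selects the proportion `N(m) / m` of the `u`, where `N(m)` is the number of `0 ≤ y < α m`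
coprime to `m`, with an error `O(m ^ (9 / 10))` for every interval (`exists_equidistribution`). This
follows by completion from a power saving for Kloosterman sums. Kloosterman's bound with exponent
`3 / 4` suffices, and it has an elementary proof for all moduli: the fourth moment over all
frequencies counts solutions of `x₁ + x₂ = x₃ + x₄`, `1 / x₁ + 1 / x₂ = 1 / x₃ + 1 / x₄`
(`card_quadruples_le`), and the sum is constant on the orbits `(t h, t⁻¹ k)`
(`norm_kloosterman_pow_four_le`).

After this replacement the five counts become sums of `N(m) / m ^ 2 * κ(m / X)`:

* for `p`, `q ≤ U` the number of `(n, k)` is the area `U ^ 4 / (2 q (p + q))` of a triangle up to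
  lower order terms (`abs_triangleCount_sub_le`). Summing over the larger of `p`, `q` leaves
  `κ = 1` if `p < q`, and `κ(t) = -log t` together with `κ = 1` if `q < p`. The small `p`, for which
  the change of modulus is not exact, cost `O(1 + (log w) ^ 2)`, where `w` is the denominator;
* if the larger of `p`, `q` exceeds `U` and `n ≤ U`, then `k < n` are fixed first. The sum over the
  two other variables has `κ(t) = t (1 - t)`, with `X = U ^ 2 / (n + k)`, and a sum over pairs
  `(n, k)` of `1 / (n (n + k))` or `1 / (k (n + k))` remains (`exists_abs_quadruple_sum_sub_le`);
* if `p` and `n` both exceed `U`, then `q` and `k` are fixed first. The pairs `(n, p)` again fill a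
  triangle, the sum over `k` produces a harmonic sum, and `κ(t) = (1 - t) ^ 2`.

Finally `N = μ * ⌈α ·⌉` as a Dirichlet convolution, so each of these sums is the average over `d`,
with weights `μ(d) / d ^ 2`, of an elementary sum of `⌈α m⌉ / m ^ 2 * κ(m d / X)`
(`abs_sum_moebius_convolution_sub_le`). The series `∑ μ(d) / d ^ 2` and `∑ μ(d) log d / d ^ 2`
contribute `1 / ζ(2)` and `ζ'(2) / ζ(2) ^ 2`. The rounding `⌈α m⌉ - α m` is periodic modulo the
denominator of `α`, and the series of its values over `m ^ 2` is `α F(α)` (`ceilSeries_eq`).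
-/

namespace GapSystem

open Finset

section

open ZMod

/-! ### Kloosterman sums and their fourth moment -/

theorem sum_gcd_le (m : ℕ) (hm : 0 < m) :
    ∑ b ∈ range m, Nat.gcd b m ≤ m * #m.divisors := by
  calc ∑ b ∈ range m, Nat.gcd b m
      ≤ ∑ b ∈ range m, ∑ d ∈ m.divisors, if d ∣ b then d else 0 := by
        refine sum_le_sum fun b _ => ?_
        have h1 : Nat.gcd b m ∈ m.divisors := by
          simpa [Nat.gcd_dvd_right] using hm.ne'
        refine le_trans ?_ (single_le_sum (f := fun d => if d ∣ b then d else 0)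
          (fun _ _ => Nat.zero_le _) h1)
        simp [Nat.gcd_dvd_left]
    _ = ∑ d ∈ m.divisors, ∑ b ∈ range m, if d ∣ b then d else 0 := sum_comm
    _ ≤ ∑ d ∈ m.divisors, m := by
        refine sum_le_sum fun d hd => ?_
        have hdm := Nat.dvd_of_mem_divisors hd
        have hd0 : 0 < d := Nat.pos_of_mem_divisors hd
        obtain ⟨e, rfl⟩ := hdm
        rw [← sum_filter, sum_const, smul_eq_mul]
        have : #{a ∈ range (d * e) | d ∣ a} ≤ #(range e) := by
          refine card_le_card_of_injOn (fun a => a / d) ?_ ?_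
          · intro a ha
            simp only [coe_filter, mem_range, Set.mem_ofPred_eq] at ha
            simpa using Nat.div_lt_of_lt_mul ha.1
          · intro a ha b hb hab
            simp only [coe_filter, mem_range, Set.mem_ofPred_eq] at ha hb
            exact (Nat.div_left_inj ha.2 hb.2).1 hab
        rw [card_range] at this
        nlinarith
    _ = m * #m.divisors := by rw [sum_const, smul_eq_mul, mul_comm]

theorem le_card_divisors_mul_totient (m : ℕ) : m ≤ #m.divisors * m.totient := by
  conv_lhs => rw [← Nat.sum_totient m]
  refine sum_le_card_nsmul _ _ _ fun d hd => ?_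
  exact Nat.le_of_dvd (Nat.totient_pos.2 (Nat.pos_of_ne_zero (by
    rintro rfl; simp at hd))) (Nat.totient_dvd_of_dvd (Nat.dvd_of_mem_divisors hd))

theorem sum_zmod_eq_sum_range {M : Type*} [AddCommMonoid M] (m : ℕ) [NeZero m] (f : ℕ → M) :
    ∑ x : ZMod m, f x.val = ∑ i ∈ range m, f i := by
  refine sum_nbij' (fun x => x.val) (fun i => (i : ZMod m)) ?_ ?_ ?_ ?_ ?_
  · intro x _; simpa using x.val_lt
  · simp
  · simp
  · intro i hi; exact ZMod.val_cast_of_lt (by simpa using hi)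
  · simp

/-- A linear congruence modulo `m` with leading coefficient `n` has at most `gcd n m` solutions. -/
theorem card_mul_eq_le (m n : ℕ) [NeZero m] (r : ZMod m) :
    #{z : ZMod m | (n : ZMod m) * z = r} ≤ Nat.gcd n m := by
  classical
  rcases (Finset.filter (fun z : ZMod m => (n : ZMod m) * z = r) univ).eq_empty_or_nonempty
    with h | ⟨z₀, hz₀⟩
  · rw [h]; simp
  have hpos : 0 < Nat.gcd n m := Nat.gcd_pos_of_pos_right _ (NeZero.pos m)
  refine le_trans ?_ (IsAddCyclic.card_nsmul_eq_zero_le (α := ZMod m) hpos)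
  refine card_le_card_of_injOn (fun z => z - z₀) ?_ (fun a _ b _ h => by simpa using h)
  intro z hz
  simp only [mem_filter, mem_univ, true_and, coe_filter, Set.mem_ofPred_eq] at hz hz₀ ⊢
  have h1 : addOrderOf (z - z₀) ∣ n := by
    rw [addOrderOf_dvd_iff_nsmul_eq_zero, nsmul_eq_mul, mul_sub, hz, hz₀, sub_self]
  have h2 : addOrderOf (z - z₀) ∣ m := by
    rw [addOrderOf_dvd_iff_nsmul_eq_zero, nsmul_eq_mul]; simp
  exact addOrderOf_dvd_iff_nsmul_eq_zero.1 (Nat.dvd_gcd h1 h2)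

/-- The Kloosterman sum `∑ e((h x + k x⁻¹) / m)` over the units `x` modulo `m`. -/
noncomputable def kloosterman {m : ℕ} [NeZero m] (h k : ZMod m) : ℂ :=
  ∑ x : (ZMod m)ˣ, stdAddChar (h * (x : ZMod m) + k * ((x⁻¹ : (ZMod m)ˣ) : ZMod m))

/-- The quadruples of units counted by the fourth moment of Kloosterman sums. -/
noncomputable def quadruples (m : ℕ) [NeZero m] :
    Finset ((ZMod m)ˣ × (ZMod m)ˣ × (ZMod m)ˣ × (ZMod m)ˣ) :=
  {v | (v.1 + v.2.1 - v.2.2.1 - v.2.2.2 : ZMod m) = 0 ∧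
    ((v.1⁻¹ : (ZMod m)ˣ) + (v.2.1⁻¹ : (ZMod m)ˣ) - (v.2.2.1⁻¹ : (ZMod m)ˣ)
      - (v.2.2.2⁻¹ : (ZMod m)ˣ) : ZMod m) = 0}

theorem sum_norm_kloosterman_pow_four (m : ℕ) [NeZero m] :
    ∑ h : ZMod m, ∑ k : ZMod m, ‖kloosterman h k‖ ^ 4 = (m : ℝ) ^ 2 * #(quadruples m) := by
  have key : ∀ h k : ZMod m, ((‖kloosterman h k‖ ^ 4 : ℝ) : ℂ) =
      ∑ v : (ZMod m)ˣ × (ZMod m)ˣ × (ZMod m)ˣ × (ZMod m)ˣ,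
        stdAddChar (h * (v.1 + v.2.1 - v.2.2.1 - v.2.2.2 : ZMod m)) *
        stdAddChar (k * ((v.1⁻¹ : (ZMod m)ˣ) + (v.2.1⁻¹ : (ZMod m)ˣ) - (v.2.2.1⁻¹ : (ZMod m)ˣ)
      - (v.2.2.2⁻¹ : (ZMod m)ˣ) : ZMod m)) := by
    intro h k
    have h1 : ((‖kloosterman h k‖ ^ 4 : ℝ) : ℂ) = kloosterman h k * (kloosterman h k *
        ((starRingEnd ℂ) (kloosterman h k) * (starRingEnd ℂ) (kloosterman h k))) := by
      have := Complex.mul_conj' (kloosterman h k)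
      push_cast
      calc (‖kloosterman h k‖ : ℂ) ^ 4 = ((‖kloosterman h k‖ : ℂ) ^ 2) ^ 2 := by ring
        _ = _ := by rw [← this]; ring
    have prod4 : ∀ f g : (ZMod m)ˣ → ℂ, (∑ x, f x) * ((∑ x, f x) * ((∑ x, g x) * ∑ x, g x)) =
        ∑ v : (ZMod m)ˣ × (ZMod m)ˣ × (ZMod m)ˣ × (ZMod m)ˣ,
          f v.1 * (f v.2.1 * (g v.2.2.1 * g v.2.2.2)) := by
      intro f g
      simp only [Fintype.sum_prod_type, ← mul_sum, ← sum_mul]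
    rw [h1]
    simp only [kloosterman, map_sum, ← AddChar.map_neg_eq_conj]
    rw [prod4]
    refine sum_congr rfl fun v _ => ?_
    simp only [← AddChar.map_add_eq_mul]
    congr 1
    ring
  have h2 : ((∑ h : ZMod m, ∑ k : ZMod m, ‖kloosterman h k‖ ^ 4 : ℝ) : ℂ)
      = (((m : ℝ) ^ 2 * #(quadruples m) : ℝ) : ℂ) := by
    have prim := isPrimitive_stdAddChar m
    have swap : ∑ h : ZMod m, ∑ k : ZMod m, ((‖kloosterman h k‖ ^ 4 : ℝ) : ℂ) =
      ∑ v : (ZMod m)ˣ × (ZMod m)ˣ × (ZMod m)ˣ × (ZMod m)ˣ,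
        (∑ h : ZMod m, stdAddChar (h * (v.1 + v.2.1 - v.2.2.1 - v.2.2.2 : ZMod m))) *
        ∑ k : ZMod m, stdAddChar (k * ((v.1⁻¹ : (ZMod m)ˣ) + (v.2.1⁻¹ : (ZMod m)ˣ) -
          (v.2.2.1⁻¹ : (ZMod m)ˣ) - (v.2.2.2⁻¹ : (ZMod m)ˣ) : ZMod m)) := by
      simp only [key, sum_mul_sum]
      exact (sum_congr rfl fun h _ => sum_comm).trans sum_comm
    push_cast at swap ⊢
    rw [swap]
    simp only [AddChar.sum_mulShift _ prim, ZMod.card]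
    rw [quadruples, card_filter]
    push_cast
    rw [mul_sum]
    refine sum_congr rfl fun v _ => ?_
    split_ifs <;> simp_all [sq]
  exact_mod_cast h2

/-- Writing `x₁ = x₃ + b`, `x₂ = x₃ + d`, a counted quadruple satisfies
`b d (2 x₃ + b + d) = 0`, which is linear in `x₃`. -/
theorem card_quadruples_le (m : ℕ) [NeZero m] :
    #(quadruples m) ≤ 2 * (m * #m.divisors) ^ 2 := by
  classical
  let T : Finset (ZMod m × ZMod m × ZMod m) :=
    {t | ((2 * t.1.val * t.2.1.val : ℕ) : ZMod m) * t.2.2 = - (t.1 * t.2.1 * (t.1 + t.2.1))}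
  have h1 : #(quadruples m) ≤ #T := by
    refine card_le_card_of_injOn
      (fun v => ((v.1 - v.2.2.1 : ZMod m), (v.2.1 - v.2.2.1 : ZMod m), (v.2.2.1 : ZMod m))) ?_ ?_
    · intro v hv
      obtain ⟨x, y, z, t⟩ := v
      simp only [quadruples, coe_filter, mem_univ, true_and, Set.mem_ofPred_eq] at hv
      simp only [T, coe_filter, mem_univ, true_and, Set.mem_ofPred_eq]
      push_cast
      simp only [natCast_val, cast_id', id_eq]
      obtain ⟨ha, hb⟩ := hv
      have ht : (t : ZMod m) = x + y - z := by linear_combination -ha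
      have hx := x.mul_inv
      have hy := y.mul_inv
      have hz := z.mul_inv
      have hT := t.mul_inv
      generalize ((x⁻¹ : (ZMod m)ˣ) : ZMod m) = x' at *
      generalize ((y⁻¹ : (ZMod m)ˣ) : ZMod m) = y' at *
      generalize ((z⁻¹ : (ZMod m)ˣ) : ZMod m) = z' at *
      generalize ((t⁻¹ : (ZMod m)ˣ) : ZMod m) = t' at *
      generalize (t : ZMod m) = t₁ at *
      generalize (x : ZMod m) = x₁ at *
      generalize (y : ZMod m) = y₁ at *
      generalize (z : ZMod m) = z₁ at *
      subst ht
      have e1 : (x₁ + y₁) * (z₁ * (x₁ + y₁ - z₁)) = (x₁ + y₁) * (x₁ * y₁) := by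
        linear_combination (x₁ * y₁ * z₁ * (x₁ + y₁ - z₁)) * hb
          - (y₁ * z₁ * (x₁ + y₁ - z₁)) * hx - (x₁ * z₁ * (x₁ + y₁ - z₁)) * hy
          + (x₁ * y₁ * (x₁ + y₁ - z₁)) * hz + (x₁ * y₁ * z₁) * hT
      linear_combination -e1
    · rintro ⟨x, y, z, t⟩ hv ⟨x', y', z', t'⟩ hv' h
      simp only [quadruples, coe_filter, mem_univ, true_and, Set.mem_ofPred_eq] at hv hv'
      simp only [Prod.mk.injEq] at h
      obtain ⟨ha, hb, hc⟩ := h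
      have hz : z = z' := Units.ext hc
      subst hz
      have hx : x = x' := Units.ext (by linear_combination ha)
      have hy : y = y' := Units.ext (by linear_combination hb)
      subst hx hy
      have ht : t = t' := Units.ext (by linear_combination hv'.1 - hv.1)
      rw [ht]
  have h2 : #T ≤ ∑ b : ZMod m, ∑ d : ZMod m, 2 * (Nat.gcd b.val m * Nat.gcd d.val m) := by
    rw [card_filter, Fintype.sum_prod_type]
    refine sum_le_sum fun b _ => ?_
    rw [Fintype.sum_prod_type]
    refine sum_le_sum fun d _ => ?_
    rw [← card_filter]
    refine (card_mul_eq_le m (2 * b.val * d.val) (-(b * d * (b + d)))).trans ?_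
    have : Nat.gcd (2 * b.val * d.val) m ∣ Nat.gcd 2 m * Nat.gcd b.val m * Nat.gcd d.val m :=
      (Nat.gcd_mul_left_dvd_mul_gcd _ _ _).trans
        (mul_dvd_mul (Nat.gcd_mul_left_dvd_mul_gcd _ _ _) dvd_rfl)
    have hp : 0 < m := NeZero.pos m
    refine (Nat.le_of_dvd (by simp [Nat.gcd_pos_of_pos_right _ hp]) this).trans ?_
    rw [mul_assoc]
    exact Nat.mul_le_mul_right _ (Nat.gcd_le_left _ two_pos)
  refine h1.trans (h2.trans ?_)
  have h3 := sum_gcd_le m (NeZero.pos m)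
  rw [← sum_zmod_eq_sum_range m (fun b => Nat.gcd b m)] at h3
  simp only [← mul_sum, ← sum_mul]
  rw [sq]
  gcongr

/-- The substitution `x ↦ t x` shows that the sum only depends on the orbit of `(h, k)` under
`(h, k) ↦ (t h, t⁻¹ k)`. -/
theorem kloosterman_smul {m : ℕ} [NeZero m] (t : (ZMod m)ˣ) (h k : ZMod m) :
    kloosterman ((t : ZMod m) * h) (((t⁻¹ : (ZMod m)ˣ) : ZMod m) * k) = kloosterman h k := by
  unfold kloosterman
  refine Fintype.sum_bijective (fun x => t * x) (Group.mulLeft_bijective t) _ _ fun x => ?_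
  congr 1
  simp only [mul_inv, Units.val_mul]
  ring

/-- A power saving for Kloosterman sums, from their fourth moment and the orbits of
`kloosterman_smul`. -/
theorem norm_kloosterman_pow_four_le {m : ℕ} [NeZero m] (h k : ZMod m) :
    ‖kloosterman h k‖ ^ 4 ≤ 2 * Nat.gcd h.val m * (m : ℝ) ^ 3 * (#m.divisors : ℝ) ^ 3 := by
  classical
  have h1 : (m.totient : ℝ) * ‖kloosterman h k‖ ^ 4
      ≤ Nat.gcd h.val m * ∑ a : ZMod m, ∑ b : ZMod m, ‖kloosterman a b‖ ^ 4 := by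
    calc (m.totient : ℝ) * ‖kloosterman h k‖ ^ 4
        = ∑ t : (ZMod m)ˣ,
            ‖kloosterman ((t : ZMod m) * h) (((t⁻¹ : (ZMod m)ˣ) : ZMod m) * k)‖ ^ 4 := by
          simp [kloosterman_smul, ZMod.card_units_eq_totient]
      _ ≤ ∑ t : (ZMod m)ˣ, ∑ b : ZMod m, ‖kloosterman ((t : ZMod m) * h) b‖ ^ 4 := by
          refine sum_le_sum fun t _ => ?_
          exact single_le_sum (f := fun b => ‖kloosterman ((t : ZMod m) * h) b‖ ^ 4)
            (fun _ _ => by positivity) (mem_univ _)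
      _ = ∑ a : ZMod m, #{t : (ZMod m)ˣ | (t : ZMod m) * h = a} •
            ∑ b : ZMod m, ‖kloosterman a b‖ ^ 4 := by
          rw [← sum_fiberwise univ (fun t : (ZMod m)ˣ => (t : ZMod m) * h)]
          refine sum_congr rfl fun a _ => ?_
          rw [← sum_const]
          refine sum_congr rfl fun t ht => ?_
          rw [(mem_filter.1 ht).2]
      _ ≤ _ := by
          rw [mul_sum]
          refine sum_le_sum fun a _ => ?_
          rw [nsmul_eq_mul]
          gcongr
          refine le_trans ?_ (card_mul_eq_le m h.val a)
          refine card_le_card_of_injOn (fun t => (t : ZMod m)) ?_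
            (fun _ _ _ _ h => Units.ext h)
          intro t ht
          simp only [coe_filter, mem_univ, true_and, Set.mem_ofPred_eq] at ht ⊢
          rw [← ht]; simp [mul_comm]
  rw [sum_norm_kloosterman_pow_four] at h1
  have h2 : (#(quadruples m) : ℝ) ≤ 2 * (m * #m.divisors) ^ 2 := by
    exact_mod_cast card_quadruples_le m
  have h3 : (m : ℝ) ≤ #m.divisors * m.totient := by exact_mod_cast le_card_divisors_mul_totient m
  have hm : (0 : ℝ) < m := by exact_mod_cast NeZero.pos m
  have h4 : (m : ℝ) * ‖kloosterman h k‖ ^ 4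
      ≤ m * (2 * Nat.gcd h.val m * (m : ℝ) ^ 3 * (#m.divisors : ℝ) ^ 3) := by
    calc (m : ℝ) * ‖kloosterman h k‖ ^ 4
        ≤ (#m.divisors * m.totient) * ‖kloosterman h k‖ ^ 4 := by gcongr
      _ = #m.divisors * (m.totient * ‖kloosterman h k‖ ^ 4) := by ring
      _ ≤ #m.divisors * (Nat.gcd h.val m * ((m : ℝ) ^ 2 * #(quadruples m))) := by gcongr
      _ ≤ #m.divisors * (Nat.gcd h.val m * ((m : ℝ) ^ 2 * (2 * (m * #m.divisors) ^ 2))) := by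
          gcongr
      _ = _ := by ring
  exact le_of_mul_le_mul_left h4 hm

/-! ### The divisor function and sums of greatest common divisors -/

/-- The divisor bound `τ(n) ≪ n ^ ε`. -/
theorem exists_card_divisors_le_rpow {ε : ℝ} (hε : 0 < ε) :
    ∃ C : ℝ, 1 ≤ C ∧ ∀ n : ℕ, n ≠ 0 → (#n.divisors : ℝ) ≤ C * (n : ℝ) ^ ε := by
  have hl : 0 < Real.log 2 := Real.log_pos one_lt_two
  set M : ℝ := max 1 (1 / (ε * Real.log 2)) with hM
  have hM1 : 1 ≤ M := le_max_left _ _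
  have hM2 : 1 ≤ M * (ε * Real.log 2) := by
    rw [← div_le_iff₀ (by positivity)]; exact le_max_right _ _
  set B : ℕ := ⌈(2 : ℝ) ^ (1 / ε)⌉₊ with hB
  have small : ∀ a : ℕ, ((a : ℝ) + 1) ≤ M * (2 : ℝ) ^ (ε * a) := by
    intro a
    have h1 : 1 + (ε * Real.log 2) * a ≤ (2 : ℝ) ^ (ε * a) := by
      rw [Real.rpow_def_of_pos two_pos]
      have := Real.add_one_le_exp (Real.log 2 * (ε * a))
      linarith
    have ha : (0 : ℝ) ≤ a := Nat.cast_nonneg a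
    nlinarith
  have large : ∀ a : ℕ, ((a : ℝ) + 1) ≤ (2 : ℝ) ^ a := by
    intro a
    have := one_add_mul_le_pow (show (-2 : ℝ) ≤ 1 by norm_num) a
    norm_num at this
    linarith
  have factor : ∀ p a : ℕ, p.Prime →
      ((a : ℝ) + 1) ≤ (if p < B then M else 1) * ((p : ℝ) ^ a) ^ ε := by
    intro p a hp
    have hp2 : (2 : ℝ) ≤ p := by exact_mod_cast hp.two_le
    rw [← Real.rpow_natCast, ← Real.rpow_mul (by positivity)]
    split_ifs with h
    · refine (small a).trans ?_
      rw [mul_comm ε]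
      gcongr
    · refine (large a).trans ?_
      have h1 : (2 : ℝ) ^ (1 / ε) ≤ p := (Nat.le_ceil _).trans (by exact_mod_cast not_lt.1 h)
      have h2 : (2 : ℝ) ≤ (p : ℝ) ^ ε := by
        calc (2 : ℝ) = ((2 : ℝ) ^ (1 / ε)) ^ ε := by
              rw [← Real.rpow_mul two_pos.le, one_div_mul_cancel hε.ne', Real.rpow_one]
          _ ≤ _ := by gcongr
      rw [one_mul, mul_comm, Real.rpow_mul (by positivity), Real.rpow_natCast]
      gcongr
  refine ⟨M ^ B, one_le_pow₀ hM1, fun n hn => ?_⟩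
  rw [Nat.card_divisors hn]
  push_cast
  calc ∏ p ∈ n.primeFactors, ((n.factorization p : ℝ) + 1)
      ≤ ∏ p ∈ n.primeFactors, (if p < B then M else 1) * ((p : ℝ) ^ n.factorization p) ^ ε :=
        prod_le_prod (fun _ _ => by positivity)
          fun p hp => factor p _ (Nat.prime_of_mem_primeFactors hp)
    _ = (∏ p ∈ n.primeFactors, if p < B then M else 1) * (n : ℝ) ^ ε := by
        rw [prod_mul_distrib, Real.finsetProd_rpow _ _ (fun _ _ => by positivity)]
        congr 2
        exact_mod_cast Nat.prod_factorization_pow_eq_self hn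
    _ ≤ M ^ B * (n : ℝ) ^ ε := by
        gcongr
        rw [← prod_filter, prod_const]
        refine pow_le_pow_right₀ hM1 ?_
        calc _ ≤ #(range B) := card_le_card fun p hp => by
              simpa using (mem_filter.1 hp).2
          _ = B := card_range B

theorem sum_gcd_div_le (m : ℕ) (hm : 0 < m) :
    ∑ i ∈ Ico 1 m, (Nat.gcd i m : ℝ) / i ≤ #m.divisors * (1 + Real.log m) := by
  have hH : ∑ j ∈ Icc 1 m, (1 : ℝ) / j ≤ 1 + Real.log m := by
    have := harmonic_le_one_add_log m
    rw [harmonic_eq_sum_Icc] at this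
    push_cast at this
    simpa using this
  calc ∑ i ∈ Ico 1 m, (Nat.gcd i m : ℝ) / i
      ≤ ∑ i ∈ Ico 1 m, ∑ d ∈ m.divisors, if d ∣ i then (d : ℝ) / i else 0 := by
        refine sum_le_sum fun i hi => ?_
        have h1 : Nat.gcd i m ∈ m.divisors := by
          simpa [Nat.gcd_dvd_right] using hm.ne'
        refine le_trans ?_ (single_le_sum (f := fun d => if d ∣ i then (d : ℝ) / i else 0)
          (fun _ _ => by positivity) h1)
        simp [Nat.gcd_dvd_left]
    _ = ∑ d ∈ m.divisors, ∑ i ∈ Ico 1 m, if d ∣ i then (d : ℝ) / i else 0 := sum_comm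
    _ ≤ ∑ d ∈ m.divisors, (1 + Real.log m) := by
        refine sum_le_sum fun d hd => ?_
        have hd0 : 0 < d := Nat.pos_of_mem_divisors hd
        rw [← sum_filter]
        refine le_trans ?_ hH
        have inj : Set.InjOn (fun i => i / d) (filter (fun i => d ∣ i) (Ico 1 m)) := by
          intro a ha b hb hab
          simp only [coe_filter, Set.mem_ofPred_eq] at ha hb
          exact (Nat.div_left_inj ha.2 hb.2).1 hab
        calc ∑ i ∈ Ico 1 m with d ∣ i, (d : ℝ) / i
            = ∑ i ∈ Ico 1 m with d ∣ i, (fun j : ℕ => (1 : ℝ) / j) (i / d) := by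
              refine sum_congr rfl fun i hi => ?_
              obtain ⟨e, rfl⟩ := (mem_filter.1 hi).2
              have hd' : (d : ℝ) ≠ 0 := by exact_mod_cast hd0.ne'
              simp only [Nat.mul_div_cancel_left _ hd0]
              push_cast
              rw [div_mul_eq_div_div, div_self hd']
          _ = ∑ j ∈ image (fun i => i / d) (filter (fun i => d ∣ i) (Ico 1 m)), (1 : ℝ) / j := by
              rw [sum_image inj]
          _ ≤ ∑ j ∈ Icc 1 m, (1 : ℝ) / j := by
              refine sum_le_sum_of_subset_of_nonneg ?_ fun _ _ _ => by positivity
              intro j hj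
              obtain ⟨i, hi, rfl⟩ := mem_image.1 hj
              simp only [mem_filter, mem_Ico] at hi
              rw [mem_Icc]
              exact ⟨Nat.div_pos (Nat.le_of_dvd (by omega) hi.2) hd0,
                (Nat.div_le_self _ _).trans (by omega)⟩
    _ = _ := by rw [sum_const, nsmul_eq_mul]

theorem sum_gcd_div_sub_le (m : ℕ) (hm : 0 < m) :
    ∑ i ∈ Ico 1 m, (Nat.gcd i m : ℝ) / ((m : ℝ) - i) ≤ #m.divisors * (1 + Real.log m) := by
  refine le_trans (le_of_eq ?_) (sum_gcd_div_le m hm)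
  refine sum_nbij' (fun i => m - i) (fun i => m - i) ?_ ?_ ?_ ?_ ?_
  · intro i hi; simp only [mem_Ico] at hi ⊢; omega
  · intro i hi; simp only [mem_Ico] at hi ⊢; omega
  · intro i hi; simp only [mem_Ico] at hi; omega
  · intro i hi; simp only [mem_Ico] at hi; omega
  · intro i hi
    simp only [mem_Ico] at hi
    rw [Nat.cast_sub hi.2.le]
    congr 2
    rw [Nat.gcd_comm, Nat.gcd_comm (m - i)]
    exact (Nat.gcd_self_sub_right hi.2.le).symm

/-- An additive character sum over an interval of any length is a geometric sum. -/
theorem norm_sum_stdAddChar_le {m : ℕ} [NeZero m] {i : ℕ} (hi : 0 < i) (him : i < m) (a b : ℕ) :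
    ‖∑ u ∈ Ico a b, stdAddChar ((i : ZMod m) * (u : ZMod m))‖
      ≤ m / 2 * (1 / i + 1 / ((m : ℝ) - i)) := by
  have hm : (0 : ℝ) < m := by exact_mod_cast hi.trans him
  have hi' : (0 : ℝ) < i := by exact_mod_cast hi
  have him' : (i : ℝ) < m := by exact_mod_cast him
  rcases le_total b a with hab | hab
  · rw [Ico_eq_empty_of_le hab, sum_empty, norm_zero]
    have : (0 : ℝ) < m - i := by linarith
    positivity
  set ζ : ℂ := stdAddChar (i : ZMod m) with hζ
  have h1 : ∀ u : ℕ, stdAddChar ((i : ZMod m) * (u : ZMod m)) = ζ ^ u := by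
    intro u
    rw [hζ, ← AddChar.map_nsmul_eq_pow, nsmul_eq_mul, mul_comm]
  set x : ℝ := i / m with hx
  have hx0 : 0 < x := by positivity
  have hx1 : x < 1 := by rw [hx, div_lt_one hm]; exact him'
  have hζe : ζ = Complex.exp (Complex.I * ((2 * Real.pi * x : ℝ) : ℂ)) := by
    rw [hζ]
    have := stdAddChar_coe (N := m) (i : ℤ)
    push_cast at this
    rw [this, hx]
    congr 1
    push_cast
    ring
  have hsin : 2 * x * (1 - x) ≤ Real.sin (Real.pi * x) := by
    rcases le_total x (1 / 2) with h | h
    · have h2 := Real.mul_le_sin (x := Real.pi * x) (by positivity)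
        (by nlinarith [Real.pi_pos])
      rw [show 2 / Real.pi * (Real.pi * x) = 2 * x by field_simp] at h2
      nlinarith
    · have h2 := Real.mul_le_sin (x := Real.pi * (1 - x))
        (mul_nonneg Real.pi_pos.le (by linarith)) (by nlinarith [Real.pi_pos])
      rw [show 2 / Real.pi * (Real.pi * (1 - x)) = 2 * (1 - x) by field_simp,
        show Real.pi * (1 - x) = Real.pi - Real.pi * x by ring, Real.sin_pi_sub] at h2
      nlinarith
  have hpos : 0 < 2 * x * (1 - x) := mul_pos (by linarith) (by linarith)
  have hnorm : 2 * (2 * x * (1 - x)) ≤ ‖ζ - 1‖ := by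
    rw [hζe, Complex.norm_exp_I_mul_ofReal_sub_one, Real.norm_eq_abs, abs_mul, abs_two]
    rw [show 2 * Real.pi * x / 2 = Real.pi * x by ring, abs_of_nonneg (by linarith)]
    linarith
  have hne : ζ ≠ 1 := by
    intro h
    rw [h, sub_self, norm_zero] at hnorm
    linarith
  have hnζ : ‖ζ‖ = 1 := by rw [hζe, mul_comm]; exact Complex.norm_exp_ofReal_mul_I _
  simp only [h1]
  rw [geom_sum_Ico hne hab, norm_div]
  have hnum : ‖ζ ^ b - ζ ^ a‖ ≤ 2 := by
    refine (norm_sub_le _ _).trans ?_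
    rw [norm_pow, norm_pow, hnζ]; norm_num
  calc ‖ζ ^ b - ζ ^ a‖ / ‖ζ - 1‖ ≤ 2 / (2 * (2 * x * (1 - x))) := by gcongr
    _ = _ := by
      have : (m : ℝ) - i ≠ 0 := by linarith
      rw [hx]
      field_simp
      ring

/-! ### Equidistribution of modular inverses -/

/-- The exponent `3 / 4` of the fourth moment method becomes `4 / 5` in order to absorb the divisor
function. -/
theorem exists_norm_kloosterman_le :
    ∃ C : ℝ, 1 ≤ C ∧ ∀ (m : ℕ) [NeZero m] (h k : ZMod m),
      ‖kloosterman h k‖ ≤ Nat.gcd h.val m * (C * (m : ℝ) ^ (4 / 5 : ℝ)) := by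
  obtain ⟨C, hC1, hC⟩ := exists_card_divisors_le_rpow (show (0 : ℝ) < 1 / 40 by norm_num)
  refine ⟨2 * C ^ 3, by nlinarith [one_le_pow₀ hC1 (n := 3)], fun m _ h k => ?_⟩
  have hm : (1 : ℝ) ≤ m := by exact_mod_cast NeZero.pos m
  have hg : (1 : ℝ) ≤ Nat.gcd h.val m := by
    exact_mod_cast Nat.gcd_pos_of_pos_right _ (NeZero.pos m)
  have hC' : 1 ≤ 2 * C ^ 3 := by nlinarith [one_le_pow₀ hC1 (n := 3)]
  refine le_of_pow_le_pow_left₀ four_ne_zero (by positivity)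
    ((norm_kloosterman_pow_four_le h k).trans ?_)
  have h1 : (#m.divisors : ℝ) ^ 3 ≤ (C * (m : ℝ) ^ (1 / 40 : ℝ)) ^ 3 := by
    gcongr
    exact hC m (NeZero.ne m)
  calc 2 * (Nat.gcd h.val m : ℝ) * (m : ℝ) ^ 3 * (#m.divisors : ℝ) ^ 3
      ≤ 2 * (Nat.gcd h.val m : ℝ) * (m : ℝ) ^ 3 * (C * (m : ℝ) ^ (1 / 40 : ℝ)) ^ 3 := by gcongr
    _ = (Nat.gcd h.val m : ℝ) ^ 1 * ((2 * C ^ 3) ^ 1 * (m : ℝ) ^ (3 + 3 / 40 : ℝ)) := by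
        rw [Real.rpow_add (by linarith), mul_pow, ← Real.rpow_natCast ((m : ℝ) ^ (1 / 40 : ℝ)),
          ← Real.rpow_mul (by linarith), ← Real.rpow_natCast (m : ℝ) 3]
        norm_num
        ring
    _ ≤ (Nat.gcd h.val m : ℝ) ^ 4 * ((2 * C ^ 3) ^ 4 * (m : ℝ) ^ (16 / 5 : ℝ)) := by
        gcongr <;> norm_num
    _ = _ := by
        rw [mul_pow _ (2 * C ^ 3 * _), mul_pow (2 * C ^ 3),
          ← Real.rpow_natCast ((m : ℝ) ^ (4 / 5 : ℝ)), ← Real.rpow_mul (by linarith)]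
        norm_num

theorem sum_norm_sum_stdAddChar_le (m : ℕ) [NeZero m] (a b : ℕ) (hab : b ≤ a + m) :
    ∑ k : ZMod m, ‖∑ j ∈ Ico a b, stdAddChar (k * (j : ZMod m))‖ ≤ m * (2 + Real.log m) := by
  have hm0 : 0 < m := NeZero.pos m
  have hm : (1 : ℝ) ≤ m := by exact_mod_cast hm0
  have e := sum_zmod_eq_sum_range m
    (fun k => ‖∑ j ∈ Ico a b, stdAddChar ((k : ZMod m) * (j : ZMod m))‖)
  simp only [natCast_val, cast_id', id_eq] at e
  rw [e, range_eq_Ico, sum_eq_sum_Ico_succ_bot hm0]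
  have h0 : ‖∑ j ∈ Ico a b, stdAddChar (((0 : ℕ) : ZMod m) * (j : ZMod m))‖ ≤ m := by
    simp only [Nat.cast_zero, zero_mul, AddChar.map_zero_eq_one, sum_const, Nat.card_Ico,
      nsmul_eq_mul, mul_one]
    rw [Complex.norm_natCast]
    exact_mod_cast (by omega : b - a ≤ m)
  have hH : ∑ j ∈ Ico 1 m, (1 : ℝ) / j ≤ 1 + Real.log m := by
    have := harmonic_le_one_add_log m
    rw [harmonic_eq_sum_Icc] at this
    push_cast at this
    refine le_trans (sum_le_sum_of_subset_of_nonneg ?_ fun _ _ _ => by positivity)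
      (by simpa using this)
    exact Ico_subset_Icc_self
  have hH' : ∑ j ∈ Ico 1 m, (1 : ℝ) / ((m : ℝ) - j) = ∑ j ∈ Ico 1 m, (1 : ℝ) / j := by
    refine sum_nbij' (fun i => m - i) (fun i => m - i) ?_ ?_ ?_ ?_ ?_
    · intro i hi; simp only [mem_Ico] at hi ⊢; omega
    · intro i hi; simp only [mem_Ico] at hi ⊢; omega
    · intro i hi; simp only [mem_Ico] at hi; omega
    · intro i hi; simp only [mem_Ico] at hi; omega
    · intro i hi
      simp only [mem_Ico] at hi
      rw [Nat.cast_sub hi.2.le]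
  have h1 : ∑ k ∈ Ico (0 + 1) m, ‖∑ j ∈ Ico a b, stdAddChar ((k : ZMod m) * (j : ZMod m))‖
      ≤ ∑ k ∈ Ico 1 m, ((m : ℝ) / 2 * (1 / k + 1 / ((m : ℝ) - k))) := by
    refine sum_le_sum fun k hk => ?_
    rw [mem_Ico] at hk
    exact norm_sum_stdAddChar_le (by omega) hk.2 a b
  rw [← mul_sum, sum_add_distrib, hH'] at h1
  nlinarith

theorem sum_norm_sum_stdAddChar_mul_gcd_le (m : ℕ) [NeZero m] (a b : ℕ) :
    ∑ h ∈ univ.erase (0 : ZMod m),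
      ‖∑ u ∈ Ico a b, stdAddChar (h * (u : ZMod m))‖ * Nat.gcd h.val m
      ≤ m * (#m.divisors * (1 + Real.log m)) := by
  have hm0 : 0 < m := NeZero.pos m
  have e := sum_zmod_eq_sum_range m
    (fun h => if h = 0 then 0 else
      ‖∑ u ∈ Ico a b, stdAddChar ((h : ZMod m) * (u : ZMod m))‖ * (Nat.gcd h m : ℝ))
  simp only [natCast_val, cast_id', id_eq, ZMod.val_eq_zero] at e
  have e1 : ∑ h ∈ univ.erase (0 : ZMod m),
      ‖∑ u ∈ Ico a b, stdAddChar (h * (u : ZMod m))‖ * (Nat.gcd h.val m : ℝ) =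
      ∑ h : ZMod m, if h = 0 then 0 else
        ‖∑ u ∈ Ico a b, stdAddChar (h * (u : ZMod m))‖ * (Nat.gcd h.val m : ℝ) := by
    rw [← add_sum_erase univ _ (mem_univ (0 : ZMod m)), if_pos rfl, zero_add]
    exact sum_congr rfl fun h hh => (if_neg (ne_of_mem_erase hh)).symm
  rw [e1, e, range_eq_Ico, sum_eq_sum_Ico_succ_bot hm0, if_pos rfl, zero_add]
  calc _ ≤ ∑ h ∈ Ico 1 m, ((m : ℝ) / 2 * ((Nat.gcd h m : ℝ) / h
            + (Nat.gcd h m : ℝ) / ((m : ℝ) - h))) := by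
        refine sum_le_sum fun h hh => ?_
        rw [mem_Ico] at hh
        rw [if_neg (by omega)]
        have := norm_sum_stdAddChar_le (m := m) (i := h) (by omega) hh.2 a b
        calc _ ≤ (m / 2 * (1 / h + 1 / ((m : ℝ) - h))) * (Nat.gcd h m : ℝ) := by gcongr
          _ = _ := by ring
    _ ≤ _ := by
        rw [← mul_sum, sum_add_distrib]
        have h1 := sum_gcd_div_le m hm0
        have h2 := sum_gcd_div_sub_le m hm0
        have : (0 : ℝ) ≤ m := by positivity
        nlinarith

/-- Completion: the number of solutions of `u j ≡ ε (mod m)` in a product of two intervals,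
written through additive characters in `u`. -/
theorem natCast_mul_sum_eq (m : ℕ) [NeZero m] (ε : (ZMod m)ˣ) (a b s t : ℕ) :
    (m : ℂ) * ∑ u ∈ Ico a b, ∑ j ∈ Ico s t, (if (u : ZMod m) * (j : ZMod m) = ε then 1 else 0) =
      ∑ h : ZMod m, (∑ u ∈ Ico a b, stdAddChar (-(h * (u : ZMod m)))) *
        ∑ x : (ZMod m)ˣ, stdAddChar (h * (x : ZMod m)) *
          ∑ j ∈ Ico s t, (if (j : ZMod m) = ε * (x⁻¹ : (ZMod m)ˣ) then 1 else 0) := by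
  classical
  have prim := isPrimitive_stdAddChar m
  have pt : ∀ u : ℕ, ∀ j : ℕ, (if (u : ZMod m) * (j : ZMod m) = ε then (1 : ℂ) else 0) =
      ∑ x : (ZMod m)ˣ, (if (x : ZMod m) - u = 0 then 1 else 0) *
        (if (j : ZMod m) = ε * (x⁻¹ : (ZMod m)ˣ) then 1 else 0) := by
    intro u j
    split_ifs with h
    · have hu : IsUnit (u : ZMod m) := isUnit_of_mul_isUnit_left (h ▸ ε.isUnit)
      obtain ⟨x, hx⟩ := hu
      rw [sum_eq_single x]
      · rw [if_pos (by rw [hx, sub_self]), if_pos, one_mul]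
        rw [← h, ← hx, mul_right_comm, Units.mul_inv, one_mul]
      · intro y _ hy
        rw [if_neg, zero_mul]
        intro h'
        exact hy (Units.ext (by rw [hx]; exact sub_eq_zero.1 h'))
      · simp
    · refine (sum_eq_zero fun x _ => ?_).symm
      split_ifs with h1 h2
      · exfalso
        apply h
        rw [h2, ← sub_eq_zero.1 h1, mul_left_comm, Units.mul_inv, mul_one]
      · simp
      · simp
      · simp
  have orth : ∀ (u : ℕ) (x : (ZMod m)ˣ), (m : ℂ) * (if (x : ZMod m) - u = 0 then 1 else 0) =
      ∑ h : ZMod m, stdAddChar (-(h * (u : ZMod m))) * stdAddChar (h * (x : ZMod m)) := by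
    intro u x
    have := AddChar.sum_mulShift ((x : ZMod m) - u) prim
    rw [ZMod.card] at this
    calc _ = ((if (x : ZMod m) - u = 0 then m else 0 : ℕ) : ℂ) := by split_ifs <;> simp
      _ = _ := by
        rw [← this]
        refine sum_congr rfl fun h _ => ?_
        rw [← AddChar.map_add_eq_mul]
        congr 1; ring
  simp only [pt]
  calc _ = ∑ u ∈ Ico a b, ∑ x : (ZMod m)ˣ, ((m : ℂ) * (if (x : ZMod m) - u = 0 then 1 else 0)) *
            ∑ j ∈ Ico s t, (if (j : ZMod m) = ε * (x⁻¹ : (ZMod m)ˣ) then 1 else 0) := by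
        rw [mul_sum]
        refine sum_congr rfl fun u _ => ?_
        rw [sum_comm, mul_sum]
        refine sum_congr rfl fun x _ => ?_
        rw [← mul_sum, mul_assoc]
    _ = ∑ u ∈ Ico a b, ∑ x : (ZMod m)ˣ, ∑ h : ZMod m, stdAddChar (-(h * (u : ZMod m))) *
          (stdAddChar (h * (x : ZMod m)) *
            ∑ j ∈ Ico s t, (if (j : ZMod m) = ε * (x⁻¹ : (ZMod m)ˣ) then 1 else 0)) := by
        refine sum_congr rfl fun u _ => sum_congr rfl fun x _ => ?_
        rw [orth, sum_mul]
        exact sum_congr rfl fun h _ => mul_assoc _ _ _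
    _ = _ := by
        simp only [sum_mul_sum]
        rw [sum_comm]
        conv_lhs => enter [2, x]; rw [sum_comm]
        rw [sum_comm]
        exact sum_congr rfl fun h _ => sum_comm

/-- Completion in `j`: detecting `j ≡ ε x⁻¹` by additive characters turns the sum over `x` into
Kloosterman sums. -/
theorem natCast_mul_sum_stdAddChar_eq (m : ℕ) [NeZero m] (ε : (ZMod m)ˣ) (s t : ℕ) (h : ZMod m) :
    (m : ℂ) * ∑ x : (ZMod m)ˣ, stdAddChar (h * (x : ZMod m)) *
        ∑ j ∈ Ico s t, (if (j : ZMod m) = ε * (x⁻¹ : (ZMod m)ˣ) then 1 else 0) =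
      ∑ k : ZMod m, (∑ j ∈ Ico s t, stdAddChar (k * (j : ZMod m))) * kloosterman h (-(k * ε)) := by
  classical
  have prim := isPrimitive_stdAddChar m
  have orth : ∀ (j : ℕ) (x : (ZMod m)ˣ),
      (m : ℂ) * (if (j : ZMod m) = ε * (x⁻¹ : (ZMod m)ˣ) then 1 else 0) =
      ∑ k : ZMod m, stdAddChar (k * (j : ZMod m)) *
        stdAddChar (-(k * (ε : ZMod m)) * ((x⁻¹ : (ZMod m)ˣ) : ZMod m)) := by
    intro j x
    have := AddChar.sum_mulShift ((j : ZMod m) - ε * ((x⁻¹ : (ZMod m)ˣ) : ZMod m)) prim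
    rw [ZMod.card] at this
    calc _ = ((if (j : ZMod m) - ε * ((x⁻¹ : (ZMod m)ˣ) : ZMod m) = 0 then m else 0 : ℕ) : ℂ) := by
          simp only [sub_eq_zero]; split_ifs <;> simp
      _ = _ := by
        rw [← this]
        refine sum_congr rfl fun h _ => ?_
        rw [← AddChar.map_add_eq_mul]
        congr 1; ring
  calc _ = ∑ x : (ZMod m)ˣ, ∑ j ∈ Ico s t, ∑ k : ZMod m, stdAddChar (k * (j : ZMod m)) *
          (stdAddChar (h * (x : ZMod m)) *
            stdAddChar (-(k * (ε : ZMod m)) * ((x⁻¹ : (ZMod m)ˣ) : ZMod m))) := by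
        rw [mul_sum]
        refine sum_congr rfl fun x _ => ?_
        rw [mul_left_comm, mul_sum, mul_sum]
        refine sum_congr rfl fun j _ => ?_
        rw [orth, mul_sum]
        exact sum_congr rfl fun k _ => mul_left_comm _ _ _
    _ = _ := by
        simp only [kloosterman, AddChar.map_add_eq_mul, sum_mul_sum]
        rw [sum_comm]
        conv_lhs => enter [2, x]; rw [sum_comm]
        rw [sum_comm]

theorem sum_units_sum_eq_card_coprime (m : ℕ) [NeZero m] (ε : (ZMod m)ˣ) (s t : ℕ) :
    ∑ x : (ZMod m)ˣ, ∑ j ∈ Ico s t,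
      (if (j : ZMod m) = ε * (x⁻¹ : (ZMod m)ˣ) then (1 : ℂ) else 0) =
      #{j ∈ Ico s t | j.Coprime m} := by
  classical
  rw [sum_comm, card_filter]
  push_cast
  refine sum_congr rfl fun j _ => ?_
  split_ifs with h
  · obtain ⟨y, hy⟩ := (ZMod.isUnit_iff_coprime j m).2 h
    rw [sum_eq_single (y⁻¹ * ε)]
    · rw [if_pos]
      rw [← hy]; simp
    · intro x _ hx
      rw [if_neg]
      intro h'
      apply hx
      rw [← hy, ← Units.val_mul] at h'
      rw [Units.ext h']; simp
    · simp
  · refine sum_eq_zero fun x _ => if_neg fun h' => h ?_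
    rw [← ZMod.isUnit_iff_coprime, h', ← Units.val_mul]
    exact Units.isUnit _

/-- Equidistribution of modular inverses with a power saving: the number of solutions of
`u j ≡ ε (mod m)`, with `u` in an arbitrary interval and `j` in an interval of length at most `m`,
is the expected one up to `O(m ^ (9 / 10))`. -/
theorem exists_equidistribution :
    ∃ C : ℝ, 0 ≤ C ∧ ∀ (m : ℕ) [NeZero m] (ε : (ZMod m)ˣ) (a b s t : ℕ), a ≤ b → t ≤ s + m →
      |(∑ u ∈ Ico a b, ∑ j ∈ Ico s t,
          (if (u : ZMod m) * (j : ZMod m) = ε then (1 : ℝ) else 0))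
        - ((b : ℝ) - a) / m * #{j ∈ Ico s t | j.Coprime m}| ≤ C * (m : ℝ) ^ (9 / 10 : ℝ) := by
  classical
  obtain ⟨C, hC1, hC⟩ := exists_norm_kloosterman_le
  obtain ⟨C', hC1', hC'⟩ := exists_card_divisors_le_rpow (show (0 : ℝ) < 1 / 40 by norm_num)
  refine ⟨C' * 41 * 42 * C, by positivity, fun m _ ε a b s t hab hst => ?_⟩
  have hm0 : 0 < m := NeZero.pos m
  have hm : (1 : ℝ) ≤ m := by exact_mod_cast hm0
  set E : ℝ := C * (m : ℝ) ^ (4 / 5 : ℝ) with hE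
  have hE0 : 0 ≤ E := by positivity
  set N : ℝ := ∑ u ∈ Ico a b, ∑ j ∈ Ico s t,
          (if (u : ZMod m) * (j : ZMod m) = ε then (1 : ℝ) else 0) with hN
  set W : ZMod m → ℂ := fun h => ∑ x : (ZMod m)ˣ, stdAddChar (h * (x : ZMod m)) *
          ∑ j ∈ Ico s t, (if (j : ZMod m) = ε * (x⁻¹ : (ZMod m)ˣ) then 1 else 0) with hW
  have hL : 0 ≤ Real.log m := Real.log_nonneg hm
  have hWb : ∀ h : ZMod m, ‖W h‖ ≤ Nat.gcd h.val m * (E * (2 + Real.log m)) := by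
    intro h
    have h1 := natCast_mul_sum_stdAddChar_eq m ε s t h
    have h2 : (m : ℝ) * ‖W h‖ ≤ m * (Nat.gcd h.val m * (E * (2 + Real.log m))) := by
      calc (m : ℝ) * ‖W h‖ = ‖(m : ℂ) * W h‖ := by rw [norm_mul, Complex.norm_natCast]
        _ ≤ ∑ k : ZMod m, ‖∑ j ∈ Ico s t, stdAddChar (k * (j : ZMod m))‖ *
              (Nat.gcd h.val m * E) := by
            rw [hW, h1]
            refine (norm_sum_le _ _).trans (sum_le_sum fun k _ => ?_)
            rw [norm_mul]
            gcongr
            exact hC m h _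
        _ ≤ (m * (2 + Real.log m)) * (Nat.gcd h.val m * E) := by
            rw [← sum_mul]
            gcongr
            exact sum_norm_sum_stdAddChar_le m s t hst
        _ = _ := by ring
    exact le_of_mul_le_mul_left h2 (by linarith)
  have main : (m : ℂ) * ((N - ((b : ℝ) - a) / m * #{j ∈ Ico s t | j.Coprime m} : ℝ) : ℂ) =
      ∑ h ∈ univ.erase (0 : ZMod m),
        (∑ u ∈ Ico a b, stdAddChar (-(h * (u : ZMod m)))) * W h := by
    have h1 := natCast_mul_sum_eq m ε a b s t
    rw [← add_sum_erase univ _ (mem_univ (0 : ZMod m))] at h1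
    have h2 := sum_units_sum_eq_card_coprime m ε s t
    simp only [zero_mul, neg_zero, AddChar.map_zero_eq_one, one_mul, sum_const, Nat.card_Ico,
      nsmul_eq_mul, mul_one, h2, Nat.cast_sub hab] at h1
    have hm' : (m : ℂ) ≠ 0 := by exact_mod_cast hm0.ne'
    have hNc : (N : ℂ) = ∑ u ∈ Ico a b, ∑ j ∈ Ico s t,
        (if (u : ZMod m) * (j : ZMod m) = ε then (1 : ℂ) else 0) := by
      simp only [hN, Complex.ofReal_sum, apply_ite Complex.ofReal, Complex.ofReal_one,
        Complex.ofReal_zero]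
    push_cast
    rw [mul_sub, hNc, h1, ← mul_assoc, mul_div_cancel₀ _ hm', add_sub_cancel_left]
  have bound : (m : ℝ) * |N - ((b : ℝ) - a) / m * #{j ∈ Ico s t | j.Coprime m}| ≤
      m * (#m.divisors * (1 + Real.log m)) * (E * (2 + Real.log m)) := by
    calc _ = ‖(m : ℂ) * ((N - ((b : ℝ) - a) / m * #{j ∈ Ico s t | j.Coprime m} : ℝ) : ℂ)‖ := by
          rw [norm_mul, Complex.norm_natCast, Complex.norm_real, Real.norm_eq_abs]
      _ ≤ ∑ h ∈ univ.erase (0 : ZMod m),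
          (‖∑ u ∈ Ico a b, stdAddChar (h * (u : ZMod m))‖ * Nat.gcd h.val m)
            * (E * (2 + Real.log m)) := by
          rw [main]
          refine (norm_sum_le _ _).trans (sum_le_sum fun h _ => ?_)
          rw [norm_mul, mul_assoc]
          have : ‖∑ u ∈ Ico a b, stdAddChar (-(h * (u : ZMod m)))‖ =
              ‖∑ u ∈ Ico a b, stdAddChar (h * (u : ZMod m))‖ := by
            simp only [AddChar.map_neg_eq_conj]
            rw [← map_sum, RCLike.norm_conj]
          rw [this]
          gcongr
          exact hWb h
      _ ≤ _ := by
          rw [← sum_mul]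
          gcongr
          exact sum_norm_sum_stdAddChar_mul_gcd_le m a b
  rw [mul_assoc] at bound
  refine (le_of_mul_le_mul_left bound (by linarith)).trans ?_
  have hlog : Real.log m ≤ 40 * (m : ℝ) ^ (1 / 40 : ℝ) := by
    have := Real.log_le_rpow_div (show (0 : ℝ) ≤ m by linarith) (show (0 : ℝ) < 1 / 40 by norm_num)
    linarith
  have hone : 1 ≤ (m : ℝ) ^ (1 / 40 : ℝ) := Real.one_le_rpow hm (by norm_num)
  calc _ ≤ (C' * (m : ℝ) ^ (1 / 40 : ℝ) * (41 * (m : ℝ) ^ (1 / 40 : ℝ))) *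
        (E * (42 * (m : ℝ) ^ (1 / 40 : ℝ))) := by
        gcongr
        · exact hC' m hm0.ne'
        · linarith
        · linarith
    _ = (C' * 41 * 42 * C) * (m : ℝ) ^ (7 / 8 : ℝ) := by
        have : (m : ℝ) ^ (7 / 8 : ℝ) = (m : ℝ) ^ (1 / 40 : ℝ) * (m : ℝ) ^ (1 / 40 : ℝ) *
            (m : ℝ) ^ (1 / 40 : ℝ) * (m : ℝ) ^ (4 / 5 : ℝ) := by
          rw [← Real.rpow_add (by linarith), ← Real.rpow_add (by linarith),
            ← Real.rpow_add (by linarith)]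
          norm_num
        rw [this, hE]; ring
    _ ≤ _ := by
        exact mul_le_mul_of_nonneg_left (Real.rpow_le_rpow_of_exponent_le hm (by norm_num))
          (by positivity)

end

/-! ### Numbers coprime to the modulus and the Möbius function -/

open ArithmeticFunction in
theorem sum_divisors_moebius (n : ℕ) :
    ∑ d ∈ n.divisors, (moebius d : ℝ) = if n = 1 then 1 else 0 := by
  have h := congrArg (fun f => f n) coe_zeta_mul_moebius
  simp only [coe_zeta_mul_apply, one_apply] at h
  exact_mod_cast h

/-- The number of `0 ≤ y < α q` coprime to `q`. -/
noncomputable def coprimeCount (α : ℝ) (q : ℕ) : ℕ := #{y ∈ range ⌈α * q⌉₊ | y.Coprime q}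

theorem coprimeCount_eq_sum_moebius {α : ℝ} {q : ℕ} (hq : q ≠ 0) :
    (coprimeCount α q : ℝ) =
      ∑ d ∈ q.divisors, (ArithmeticFunction.moebius d : ℝ) * (⌈α * (q / d : ℕ)⌉₊ : ℝ) := by
  have h1 : ∀ y : ℕ, (if y.Coprime q then (1 : ℝ) else 0) =
      ∑ d ∈ q.divisors, if d ∣ y then (ArithmeticFunction.moebius d : ℝ) else 0 := by
    intro y
    have hg : Nat.gcd y q ≠ 0 := (Nat.gcd_pos_of_pos_right _ (Nat.pos_of_ne_zero hq)).ne'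
    rw [← sum_filter]
    have : q.divisors.filter (· ∣ y) = (Nat.gcd y q).divisors := by
      ext d
      simp only [mem_filter, Nat.mem_divisors, Nat.dvd_gcd_iff]
      constructor
      · rintro ⟨⟨h1, -⟩, h2⟩; exact ⟨⟨h2, h1⟩, hg⟩
      · rintro ⟨⟨h1, h2⟩, -⟩; exact ⟨⟨h2, hq⟩, h1⟩
    rw [this, sum_divisors_moebius]
  rw [coprimeCount, card_filter]
  push_cast
  simp only [h1]
  rw [sum_comm]
  refine sum_congr rfl fun d hd => ?_
  obtain ⟨hdq, -⟩ := Nat.mem_divisors.1 hd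
  have hd0 : 0 < d := Nat.pos_of_mem_divisors hd
  obtain ⟨e, rfl⟩ := hdq
  rw [← sum_filter, sum_const, nsmul_eq_mul, mul_comm, Nat.mul_div_cancel_left _ hd0]
  congr 2
  rw [← card_range ⌈α * (e : ℕ)⌉₊]
  have hd' : (0 : ℝ) < d := by exact_mod_cast hd0
  refine card_nbij' (fun y => y / d) (fun z => d * z) ?_ ?_ ?_ ?_
  · intro y hy
    simp only [coe_filter, mem_range, Set.mem_ofPred_eq] at hy
    obtain ⟨z, rfl⟩ := hy.2
    have := hy.1
    rw [Nat.lt_ceil] at this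
    push_cast at this
    simp only [coe_range, Set.mem_Iio, Nat.mul_div_cancel_left _ hd0, Nat.lt_ceil]
    nlinarith
  · intro z hz
    simp only [coe_range, Set.mem_Iio, Nat.lt_ceil] at hz
    simp only [coe_filter, mem_range, Set.mem_ofPred_eq, dvd_mul_right, and_true, Nat.lt_ceil]
    push_cast
    nlinarith
  · intro y hy
    simp only [coe_filter, mem_range, Set.mem_ofPred_eq] at hy
    exact Nat.mul_div_cancel' hy.2
  · intro z _
    exact Nat.mul_div_cancel_left _ hd0

/-- The sum of the series `∑ μ(d) (log d) ^ j / d ^ 2`. -/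
noncomputable def moebiusSeries (j : ℕ) : ℝ :=
  ∑' d : ℕ, (ArithmeticFunction.moebius d : ℝ) / (d : ℝ) ^ 2 * Real.log d ^ j

/-- The sum of the series `∑ d ^ (-3 / 2)`. -/
noncomputable def zetaThreeHalves : ℝ := ∑' d : ℕ, ((d : ℝ) ^ (3 / 2 : ℝ))⁻¹

theorem hasSum_zetaThreeHalves : HasSum (fun d : ℕ => ((d : ℝ) ^ (3 / 2 : ℝ))⁻¹) zetaThreeHalves :=
  (Real.summable_nat_rpow_inv.2 (by norm_num)).hasSum

theorem zetaThreeHalves_nonneg : 0 ≤ zetaThreeHalves :=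
  tsum_nonneg fun _ => by positivity

theorem abs_moebius_div_sq_le (d : ℕ) :
    |(ArithmeticFunction.moebius d : ℝ) / (d : ℝ) ^ 2| ≤ 1 / (d : ℝ) ^ 2 := by
  rw [abs_div, abs_of_nonneg (sq_nonneg (d : ℝ))]
  gcongr
  exact_mod_cast ArithmeticFunction.abs_moebius_le_one

theorem one_div_sq_mul_sqrt {x : ℝ} (hx : 0 < x) :
    1 / x ^ 2 * x ^ (1 / 2 : ℝ) = (x ^ (3 / 2 : ℝ))⁻¹ := by
  rw [← Real.rpow_neg hx.le, one_div, ← Real.rpow_natCast, ← Real.rpow_neg hx.le,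
    ← Real.rpow_add hx]
  norm_num

theorem log_sq_le {x : ℝ} (hx : 1 ≤ x) : Real.log x ^ 2 ≤ 16 * x ^ (1 / 2 : ℝ) := by
  have h1 := Real.log_le_rpow_div (show 0 ≤ x by linarith) (show (0 : ℝ) < 1 / 4 by norm_num)
  have h0 := Real.log_nonneg hx
  calc Real.log x ^ 2 ≤ (x ^ (1 / 4 : ℝ) / (1 / 4)) ^ 2 := by gcongr
    _ = 16 * (x ^ (1 / 4 : ℝ)) ^ 2 := by ring
    _ = _ := by
      rw [← Real.rpow_natCast, ← Real.rpow_mul (by linarith)]; norm_num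

theorem log_le_two_mul_sqrt {x : ℝ} (hx : 1 ≤ x) : Real.log x ≤ 2 * x ^ (1 / 2 : ℝ) := by
  have h1 := Real.log_le_rpow_div (show 0 ≤ x by linarith) (show (0 : ℝ) < 1 / 2 by norm_num)
  linarith

theorem hasSum_moebiusSeries {j : ℕ} (hj : j ≤ 2) :
    HasSum (fun d : ℕ => (ArithmeticFunction.moebius d : ℝ) / (d : ℝ) ^ 2 * Real.log d ^ j)
      (moebiusSeries j) := by
  refine (Summable.of_norm_bounded (g := fun d : ℕ => 16 * ((d : ℝ) ^ (3 / 2 : ℝ))⁻¹)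
    (hasSum_zetaThreeHalves.summable.mul_left 16) fun d => ?_).hasSum
  rcases Nat.eq_zero_or_pos d with rfl | hd
  · simp
  have hd1 : (1 : ℝ) ≤ d := by exact_mod_cast hd
  have hs : 1 ≤ (d : ℝ) ^ (1 / 2 : ℝ) := Real.one_le_rpow hd1 (by norm_num)
  have hlog : |Real.log d ^ j| ≤ 16 * (d : ℝ) ^ (1 / 2 : ℝ) := by
    rw [abs_of_nonneg (pow_nonneg (Real.log_nonneg hd1) _)]
    have h1 := log_le_two_mul_sqrt hd1
    have h2 := log_sq_le hd1
    interval_cases j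
    · simp; linarith
    · simp only [pow_one]; linarith
    · exact h2
  rw [Real.norm_eq_abs, abs_mul]
  calc _ ≤ 1 / (d : ℝ) ^ 2 * (16 * (d : ℝ) ^ (1 / 2 : ℝ)) := by
        gcongr
        exact abs_moebius_div_sq_le d
    _ = _ := by rw [← one_div_sq_mul_sqrt (by linarith)]; ring

theorem zetaTwo_eq : zetaTwo = Real.pi ^ 2 / 6 := by
  rw [zetaTwo, riemannZeta_two]
  norm_cast

theorem zetaTwo_pos : 0 < zetaTwo := by
  rw [zetaTwo_eq]; positivity

theorem term_moebius_two (d : ℕ) :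
    LSeries.term (fun n => (ArithmeticFunction.moebius n : ℂ)) 2 d =
      (((ArithmeticFunction.moebius d : ℝ) / (d : ℝ) ^ 2 * Real.log d ^ 0 : ℝ) : ℂ) := by
  rcases Nat.eq_zero_or_pos d with rfl | hd
  · simp [LSeries.term]
  · rw [LSeries.term, if_neg hd.ne']
    norm_cast
    simp

theorem term_logMul_moebius_two (d : ℕ) :
    LSeries.term (LSeries.logMul fun n => (ArithmeticFunction.moebius n : ℂ)) 2 d =
      (((ArithmeticFunction.moebius d : ℝ) / (d : ℝ) ^ 2 * Real.log d ^ 1 : ℝ) : ℂ) := by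
  rcases Nat.eq_zero_or_pos d with rfl | hd
  · simp [LSeries.term]
  · rw [LSeries.term, if_neg hd.ne', LSeries.logMul, ← Complex.natCast_log]
    push_cast
    rw [pow_one, show (2 : ℂ) = ((2 : ℕ) : ℂ) by norm_num, Complex.cpow_natCast]
    ring

theorem LSeries_moebius_two :
    LSeries (fun n => (ArithmeticFunction.moebius n : ℂ)) 2 = (moebiusSeries 0 : ℂ) := by
  rw [LSeries, moebiusSeries, Complex.ofReal_tsum]
  exact tsum_congr term_moebius_two

theorem LSeries_logMul_moebius_two :
    LSeries (LSeries.logMul fun n => (ArithmeticFunction.moebius n : ℂ)) 2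
      = (moebiusSeries 1 : ℂ) := by
  rw [LSeries, moebiusSeries, Complex.ofReal_tsum]
  exact tsum_congr term_logMul_moebius_two

theorem riemannZeta_two_eq_ofReal : riemannZeta 2 = (zetaTwo : ℂ) := by
  rw [zetaTwo_eq, riemannZeta_two]; push_cast; rfl

open ArithmeticFunction in
theorem zeta_mul_LSeries_moebius {s : ℂ} (hs : 1 < s.re) :
    riemannZeta s * LSeries (fun n => (moebius n : ℂ)) s = 1 := by
  rw [← LSeries_one_eq_riemannZeta hs]
  exact LSeries_one_mul_Lseries_moebius hs

theorem moebiusSeries_zero : moebiusSeries 0 = 1 / zetaTwo := by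
  have h := zeta_mul_LSeries_moebius (s := 2) (by norm_num)
  rw [riemannZeta_two_eq_ofReal, LSeries_moebius_two] at h
  have h' : zetaTwo * moebiusSeries 0 = 1 := by exact_mod_cast h
  rw [eq_div_iff zetaTwo_pos.ne', mul_comm]; exact h'

/-- Differentiate `ζ(s) * ∑ μ(n) n ^ (-s) = 1` at `s = 2`. -/
theorem moebiusSeries_one : moebiusSeries 1 = zetaTwoDeriv / zetaTwo ^ 2 := by
  have h1 : HasDerivAt (LSeries fun n => (ArithmeticFunction.moebius n : ℂ))
      (-(moebiusSeries 1 : ℂ)) 2 := by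
    rw [← LSeries_logMul_moebius_two]
    refine LSeries_hasDerivAt ?_
    rw [ArithmeticFunction.abscissaOfAbsConv_moebius]
    exact_mod_cast (by norm_num : (1 : ℝ) < (2 : ℂ).re)
  have h2 : HasDerivAt riemannZeta (deriv riemannZeta 2) 2 :=
    (differentiableAt_riemannZeta (by norm_num)).hasDerivAt
  have h3 := h2.mul h1
  have h4 : (riemannZeta * LSeries fun n => (ArithmeticFunction.moebius n : ℂ))
      =ᶠ[nhds 2] fun _ => 1 := by
    have : {s : ℂ | 1 < s.re} ∈ nhds (2 : ℂ) :=
      (isOpen_lt continuous_const Complex.continuous_re).mem_nhds (by simp)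
    filter_upwards [this] with s hs
    exact zeta_mul_LSeries_moebius hs
  have h5 := (h4.hasDerivAt_iff.1 h3).unique (hasDerivAt_const 2 (1 : ℂ))
  rw [LSeries_moebius_two, riemannZeta_two_eq_ofReal, moebiusSeries_zero] at h5
  have h6 := congrArg Complex.re h5
  have hz := zetaTwo_pos.ne'
  rw [← Complex.ofReal_neg, ← Complex.ofReal_mul, Complex.add_re, Complex.re_mul_ofReal,
    Complex.ofReal_re, Complex.zero_re] at h6
  change zetaTwoDeriv * (1 / zetaTwo) + zetaTwo * -moebiusSeries 1 = 0 at h6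
  field_simp at h6 ⊢
  linarith

/-! ### Asymptotics under Möbius convolution -/

/-- The sum over `q` of a Dirichlet convolution, regrouped by the divisor `d` and `m = q / d`. -/
theorem sum_sum_divisors_eq (μ : ℕ → ℝ) (c : ℕ → ℝ) (k : ℝ → ℝ) {U : ℝ} (hU : 0 < U) :
    ∑ q ∈ Icc 1 ⌊U⌋₊, (∑ d ∈ q.divisors, μ d * c (q / d)) / (q : ℝ) ^ 2 * k (q / U) =
      ∑ d ∈ Icc 1 ⌊U⌋₊, μ d / (d : ℝ) ^ 2 *
        ∑ m ∈ Icc 1 ⌊U / d⌋₊, c m / (m : ℝ) ^ 2 * k (m / (U / d)) := by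
  simp only [sum_div, sum_mul, mul_sum]
  rw [sum_sigma', sum_sigma']
  refine sum_nbij' (fun x => ⟨x.2, x.1 / x.2⟩) (fun x => ⟨x.1 * x.2, x.1⟩) ?_ ?_ ?_ ?_ ?_
  · rintro ⟨q, d⟩ h
    simp only [mem_sigma, mem_Icc, Nat.mem_divisors] at h ⊢
    obtain ⟨⟨h1, h2⟩, ⟨e, rfl⟩, h4⟩ := h
    have hd : 0 < d := Nat.pos_of_ne_zero (by rintro rfl; simp at h4)
    have he : 0 < e := Nat.pos_of_ne_zero (by rintro rfl; simp at h4)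
    rw [Nat.mul_div_cancel_left _ hd, Nat.floor_div_natCast, Nat.le_div_iff_mul_le hd]
    exact ⟨⟨hd, (Nat.le_mul_of_pos_right _ he).trans h2⟩, he, by rwa [mul_comm]⟩
  · rintro ⟨d, m⟩ h
    simp only [mem_sigma, mem_Icc, Nat.mem_divisors] at h ⊢
    obtain ⟨⟨h1, h2⟩, h3, h4⟩ := h
    rw [Nat.floor_div_natCast, Nat.le_div_iff_mul_le (by omega)] at h4
    have : 0 < d * m := Nat.mul_pos (by omega) (by omega)
    exact ⟨⟨this, by rwa [mul_comm]⟩, dvd_mul_right _ _, this.ne'⟩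
  · rintro ⟨q, d⟩ h
    simp only [mem_sigma, mem_Icc, Nat.mem_divisors] at h ⊢
    rw [Nat.mul_div_cancel' h.2.1]
  · rintro ⟨d, m⟩ h
    simp only [mem_sigma, mem_Icc] at h ⊢
    rw [Nat.mul_div_cancel_left _ (by omega)]
  · rintro ⟨q, d⟩ h
    simp only [mem_sigma, mem_Icc, Nat.mem_divisors] at h ⊢
    obtain ⟨⟨h1, h2⟩, ⟨e, rfl⟩, h4⟩ := h
    have hd : 0 < d := Nat.pos_of_ne_zero (by rintro rfl; simp at h4)
    have he : 0 < e := Nat.pos_of_ne_zero (by rintro rfl; simp at h4)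
    rw [Nat.mul_div_cancel_left _ hd]
    have hd' : (d : ℝ) ≠ 0 := by exact_mod_cast hd.ne'
    have he' : (e : ℝ) ≠ 0 := by exact_mod_cast he.ne'
    push_cast
    rw [show (e : ℝ) / (U / d) = d * e / U by field_simp]
    field_simp

/-- Asymptotics pass through Dirichlet convolution with the Möbius function: if
`∑_{m ≤ x} c(m) / m ^ 2 * k(m / x)` is close to a quadratic polynomial in `log x` for all `x > 0`,
then the corresponding sum over `μ * c` is close to the polynomial in `log U` obtained by replacing
`x` with `U / d` and averaging against `μ(d) / d ^ 2`. -/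
theorem abs_sum_moebius_convolution_sub_le {c : ℕ → ℝ} {k : ℝ → ℝ} {A B E K ρ : ℝ} (hK : 0 ≤ K)
    (hρ : 0 ≤ ρ)
    (hG : ∀ x : ℝ, 0 < x → |(∑ m ∈ Icc 1 ⌊x⌋₊, c m / (m : ℝ) ^ 2 * k (m / x))
      - (A * Real.log x ^ 2 + B * Real.log x + E)| ≤ K * (ρ + (x ^ (1 / 2 : ℝ))⁻¹))
    {U : ℝ} (hU : 0 < U) :
    |(∑ q ∈ Icc 1 ⌊U⌋₊, (∑ d ∈ q.divisors, (ArithmeticFunction.moebius d : ℝ) * c (q / d))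
        / (q : ℝ) ^ 2 * k (q / U))
      - (A * (Real.log U ^ 2 * moebiusSeries 0 - 2 * Real.log U * moebiusSeries 1
          + moebiusSeries 2) + B * (Real.log U * moebiusSeries 0 - moebiusSeries 1)
          + E * moebiusSeries 0)|
      ≤ K * zetaThreeHalves * (ρ + (U ^ (1 / 2 : ℝ))⁻¹) := by
  set G : ℝ → ℝ := fun x => ∑ m ∈ Icc 1 ⌊x⌋₊, c m / (m : ℝ) ^ 2 * k (m / x) with hGdef
  set μ : ℕ → ℝ := fun d => (ArithmeticFunction.moebius d : ℝ) / (d : ℝ) ^ 2 with hμ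
  rw [sum_sum_divisors_eq (fun d => (ArithmeticFunction.moebius d : ℝ)) c k hU]
  have hS : HasSum (fun d : ℕ => μ d * G (U / d))
      (∑ d ∈ Icc 1 ⌊U⌋₊, μ d * G (U / d)) := by
    refine hasSum_sum_of_ne_finset_zero fun d hd => ?_
    rcases Nat.eq_zero_or_pos d with rfl | hd0
    · simp [hμ]
    · have : ⌊U / d⌋₊ = 0 := by
        rw [Nat.floor_div_natCast, Nat.div_eq_zero_iff]
        right
        simp only [mem_Icc, not_and, not_le] at hd
        exact hd hd0
      simp only [hGdef, this]
      simp
  have h0 := hasSum_moebiusSeries (j := 0) (by norm_num)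
  have h1 := hasSum_moebiusSeries (j := 1) (by norm_num)
  have h2 := hasSum_moebiusSeries (j := 2) (by norm_num)
  have hT := (((h0.mul_left (Real.log U ^ 2)).sub (h1.mul_left (2 * Real.log U))).add h2).mul_left A
    |>.add (((h0.mul_left (Real.log U)).sub h1).mul_left B) |>.add (h0.mul_left E)
  have hD := hS.sub hT
  rw [← hD.tsum_eq, ← Real.norm_eq_abs]
  refine tsum_of_norm_bounded (g := fun d : ℕ => K * (ρ + (U ^ (1 / 2 : ℝ))⁻¹) *
    ((d : ℝ) ^ (3 / 2 : ℝ))⁻¹) ?_ ?_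
  · have := hasSum_zetaThreeHalves.mul_left (K * (ρ + (U ^ (1 / 2 : ℝ))⁻¹))
    convert! this using 1
    ring
  intro d
  rcases Nat.eq_zero_or_pos d with rfl | hd0
  · simp [hμ]
  have hd1 : (1 : ℝ) ≤ d := by exact_mod_cast hd0
  have hdpos : (0 : ℝ) < d := by linarith
  have hlog : Real.log (U / d) = Real.log U - Real.log d := Real.log_div hU.ne' hdpos.ne'
  have hg := hG (U / d) (by positivity)
  have hs : 1 ≤ (d : ℝ) ^ (1 / 2 : ℝ) := Real.one_le_rpow hd1 (by norm_num)
  rw [Real.norm_eq_abs]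
  calc _ = |μ d * (G (U / d) - (A * Real.log (U / d) ^ 2 + B * Real.log (U / d) + E))| := by
        congr 1
        rw [hlog]
        simp only [hμ]
        ring
    _ ≤ 1 / (d : ℝ) ^ 2 * (K * (ρ + ((U / d) ^ (1 / 2 : ℝ))⁻¹)) := by
        rw [abs_mul]
        gcongr
        exact abs_moebius_div_sq_le d
    _ ≤ 1 / (d : ℝ) ^ 2 * (K * (ρ * (d : ℝ) ^ (1 / 2 : ℝ) +
          (U ^ (1 / 2 : ℝ))⁻¹ * (d : ℝ) ^ (1 / 2 : ℝ))) := by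
        gcongr
        · nlinarith
        · rw [Real.div_rpow hU.le hdpos.le, inv_div, div_eq_inv_mul]
    _ = K * (ρ + (U ^ (1 / 2 : ℝ))⁻¹) * (1 / (d : ℝ) ^ 2 * (d : ℝ) ^ (1 / 2 : ℝ)) := by ring
    _ = _ := by rw [one_div_sq_mul_sqrt hdpos]

theorem abs_log_polynomial_le {x : ℝ} (hx : 0 < x) (hx1 : x < 1) (A B E : ℝ) :
    |A * Real.log x ^ 2 + B * Real.log x + E| ≤
      (16 * |A| + 2 * |B| + |E|) * (x ^ (1 / 2 : ℝ))⁻¹ := by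
  have h1 : 1 ≤ x⁻¹ := (one_le_inv₀ hx).2 hx1.le
  have hl : Real.log x = - Real.log x⁻¹ := by rw [Real.log_inv]; ring
  have h2 := log_sq_le h1
  have h3 := log_le_two_mul_sqrt h1
  have h4 := Real.log_nonneg h1
  have h5 : 1 ≤ (x⁻¹) ^ (1 / 2 : ℝ) := Real.one_le_rpow h1 (by norm_num)
  rw [← Real.inv_rpow hx.le, hl]
  set L := Real.log x⁻¹
  set s := (x⁻¹) ^ (1 / 2 : ℝ)
  calc _ ≤ |A * (-L) ^ 2| + |B * -L| + |E| := abs_add_three _ _ _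
    _ = |A| * L ^ 2 + |B| * L + |E| := by
        rw [abs_mul, abs_mul, neg_sq, abs_neg, abs_of_nonneg h4, abs_of_nonneg (sq_nonneg L)]
    _ ≤ |A| * (16 * s) + |B| * (2 * s) + |E| * s := by
        gcongr
        exact le_mul_of_one_le_right (abs_nonneg _) h5
    _ = _ := by ring

/-- The bounds needed in `abs_sum_moebius_convolution_sub_le` are automatic for `x < 1`. -/
theorem abs_sum_sub_le_of_one_le {c : ℕ → ℝ} {k : ℝ → ℝ} {A B E K ρ : ℝ} (hK : 0 ≤ K)
    (hρ : 0 ≤ ρ)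
    (hG : ∀ x : ℝ, 1 ≤ x → |(∑ m ∈ Icc 1 ⌊x⌋₊, c m / (m : ℝ) ^ 2 * k (m / x))
      - (A * Real.log x ^ 2 + B * Real.log x + E)| ≤ K * (ρ + (x ^ (1 / 2 : ℝ))⁻¹))
    {x : ℝ} (hx : 0 < x) :
    |(∑ m ∈ Icc 1 ⌊x⌋₊, c m / (m : ℝ) ^ 2 * k (m / x))
      - (A * Real.log x ^ 2 + B * Real.log x + E)|
      ≤ (K + (16 * |A| + 2 * |B| + |E|)) * (ρ + (x ^ (1 / 2 : ℝ))⁻¹) := by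
  have hs : 0 < (x ^ (1 / 2 : ℝ))⁻¹ := by positivity
  rcases lt_or_ge x 1 with h | h
  · rw [Nat.floor_eq_zero.2 h]
    have := abs_log_polynomial_le hx h A B E
    simp only [zero_lt_one, Icc_eq_empty_of_lt, sum_empty, zero_sub, abs_neg]
    exact this.trans (mul_le_mul (by linarith) (by linarith) hs.le (by positivity))
  · refine (hG x h).trans ?_
    gcongr
    have := abs_nonneg A
    have := abs_nonneg B
    have := abs_nonneg E
    linarith

section

local notation "γ" => Real.eulerMascheroniConstant

/-! ### Harmonic sums with a kernel -/

theorem abs_harmonic_sub_le {n : ℕ} (hn : 1 ≤ n) :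
    |(∑ m ∈ Icc 1 n, (1 : ℝ) / m) - (Real.log n + γ)| ≤ 1 / n := by
  have h1 := Real.eulerMascheroniSeq_lt_eulerMascheroniConstant n
  have h2 := Real.eulerMascheroniConstant_lt_eulerMascheroniSeq' n
  have e : ((harmonic n : ℚ) : ℝ) = ∑ m ∈ Icc 1 n, (1 : ℝ) / m := by
    rw [harmonic_eq_sum_Icc]; push_cast; simp
  rw [Real.eulerMascheroniSeq, e] at h1
  rw [Real.eulerMascheroniSeq', if_neg (by omega), e] at h2
  have hn' : (1 : ℝ) ≤ n := by exact_mod_cast hn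
  have h3 : Real.log (n + 1) - Real.log n ≤ 1 / n := by
    rw [← Real.log_div (by linarith) (by linarith)]
    refine (Real.log_le_sub_one_of_pos (by positivity)).trans (le_of_eq ?_)
    field_simp
    ring
  rw [abs_le]
  constructor <;> linarith

theorem natFloor_bounds {x : ℝ} (hx : 1 ≤ x) :
    (1 : ℝ) ≤ ⌊x⌋₊ ∧ (⌊x⌋₊ : ℝ) ≤ x ∧ x < ⌊x⌋₊ + 1 ∧ 1 / (⌊x⌋₊ : ℝ) ≤ 2 / x := by
  have h1 : (1 : ℝ) ≤ ⌊x⌋₊ := by exact_mod_cast Nat.floor_pos.2 hx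
  have h2 := Nat.floor_le (show 0 ≤ x by linarith)
  have h3 := Nat.lt_floor_add_one x
  refine ⟨h1, h2, h3, ?_⟩
  rw [div_le_div_iff₀ (by linarith) (by linarith)]
  linarith

theorem log_sub_log_floor {x : ℝ} (hx : 1 ≤ x) :
    0 ≤ Real.log x - Real.log ⌊x⌋₊ ∧ Real.log x - Real.log ⌊x⌋₊ ≤ 1 / (⌊x⌋₊ : ℝ) := by
  obtain ⟨h1, h2, h3, -⟩ := natFloor_bounds hx
  constructor
  · have := Real.log_le_log (by linarith) h2
    linarith
  · rw [← Real.log_div (by linarith) (by linarith)]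
    refine (Real.log_le_sub_one_of_pos (by positivity)).trans ?_
    rw [div_sub_one (by linarith)]
    gcongr
    linarith

theorem abs_harmonic_floor_sub_le {x : ℝ} (hx : 1 ≤ x) :
    |(∑ m ∈ Icc 1 ⌊x⌋₊, (1 : ℝ) / m) - (Real.log x + γ)| ≤ 2 / x := by
  obtain ⟨h1, h2, h3, h4⟩ := natFloor_bounds hx
  obtain ⟨h5, h6⟩ := log_sub_log_floor hx
  -- the sharper lower bound `log n + γ < H n` keeps the constant `2`
  have hn := Real.eulerMascheroniConstant_lt_eulerMascheroniSeq' ⌊x⌋₊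
  have h := abs_harmonic_sub_le (n := ⌊x⌋₊) (by exact_mod_cast h1)
  have e : ((harmonic ⌊x⌋₊ : ℚ) : ℝ) = ∑ m ∈ Icc 1 ⌊x⌋₊, (1 : ℝ) / m := by
    rw [harmonic_eq_sum_Icc]; push_cast; simp
  rw [Real.eulerMascheroniSeq', if_neg (by
    have : 0 < ⌊x⌋₊ := by exact_mod_cast (by linarith : (0 : ℝ) < ⌊x⌋₊)
    omega), e] at hn
  rw [abs_le] at h ⊢
  constructor <;> linarith

theorem sum_Icc_natCast (n : ℕ) : ∑ m ∈ Icc 1 n, (m : ℝ) = n * (n + 1) / 2 := by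
  induction n with
  | zero => simp
  | succ n ih => rw [sum_Icc_succ_top (by omega), ih]; push_cast; ring

theorem sum_Icc_one_real (n : ℕ) : ∑ _m ∈ Icc 1 n, (1 : ℝ) = n := by simp

theorem sum_zetaThreeHalves_le (s : Finset ℕ) :
    ∑ m ∈ s, ((m : ℝ) ^ (3 / 2 : ℝ))⁻¹ ≤ zetaThreeHalves :=
  sum_le_hasSum s (fun _ _ => by positivity) hasSum_zetaThreeHalves

/-- `∑_{m ≤ n} log m / m = (log n) ^ 2 / 2 + O(1)`, by comparison with the telescoping sum of
`(log m) ^ 2 - (log (m - 1)) ^ 2`. -/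
theorem abs_sum_log_div_sub_le (n : ℕ) :
    |(∑ m ∈ Icc 1 n, Real.log m / m) - Real.log n ^ 2 / 2| ≤ 6 * zetaThreeHalves := by
  have key : ∀ n : ℕ, |(∑ m ∈ Icc 1 n, Real.log m / m) - Real.log n ^ 2 / 2| ≤
      ∑ m ∈ Icc 1 n, 6 * ((m : ℝ) ^ (3 / 2 : ℝ))⁻¹ := by
    intro n
    induction n with
    | zero => simp
    | succ n ih =>
      rcases Nat.eq_zero_or_pos n with rfl | hn
      · simp
      rw [sum_Icc_succ_top (by omega), sum_Icc_succ_top (by omega)]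
      have hn1 : (1 : ℝ) ≤ n := by exact_mod_cast hn
      push_cast
      have d1 : Real.log (n + 1) - Real.log n ≤ 1 / n := by
        rw [← Real.log_div (by linarith) (by linarith)]
        refine (Real.log_le_sub_one_of_pos (by positivity)).trans (le_of_eq ?_)
        field_simp
        ring
      have d2 : 1 / ((n : ℝ) + 1) ≤ Real.log (n + 1) - Real.log n := by
        rw [← Real.log_div (by linarith) (by linarith)]
        have := Real.one_sub_inv_le_log_of_pos (show 0 < ((n : ℝ) + 1) / n by positivity)
        refine le_trans (le_of_eq ?_) this
        field_simp
        ring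
      have hl0 : 0 ≤ Real.log ((n : ℝ) + 1) := Real.log_nonneg (by linarith)
      have hlog := log_le_two_mul_sqrt (show 1 ≤ (n : ℝ) + 1 by linarith)
      set s := ((n : ℝ) + 1) ^ (1 / 2 : ℝ)
      have hs : 1 ≤ s := Real.one_le_rpow (by linarith) (by norm_num)
      have hsq := one_div_sq_mul_sqrt (show 0 < (n : ℝ) + 1 by linarith)
      rw [← hsq]
      set L := Real.log ((n : ℝ) + 1)
      set δ := L - Real.log n with hδ
      have hLn : Real.log n = L - δ := by rw [hδ]; ring
      rw [hLn] at ih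
      have hinv : 1 / (n : ℝ) ≤ 2 * (1 / ((n : ℝ) + 1)) := by
        rw [mul_one_div, div_le_div_iff₀ (by linarith) (by linarith)]
        linarith
      have hprod : 1 / (n : ℝ) - 1 / ((n : ℝ) + 1) ≤ 2 * (1 / ((n : ℝ) + 1) ^ 2) := by
        rw [div_sub_div _ _ (by linarith) (by linarith), mul_one_div,
          div_le_div_iff₀ (by positivity) (by positivity)]
        nlinarith
      set i := 1 / ((n : ℝ) + 1) with hi
      have hi0 : 0 ≤ i := by positivity
      have hi2 : 1 / ((n : ℝ) + 1) ^ 2 = i ^ 2 := by rw [hi, one_div_pow]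
      rw [hi2] at hprod ⊢
      have step : |L / (n + 1) - (L ^ 2 / 2 - (L - δ) ^ 2 / 2)| ≤ 6 * (i ^ 2 * s) := by
        rw [show L / (n + 1) - (L ^ 2 / 2 - (L - δ) ^ 2 / 2) = L * (i - δ) + δ ^ 2 / 2 by
          rw [hi]; ring]
        have hd : |i - δ| ≤ 2 * i ^ 2 := by rw [abs_le]; constructor <;> linarith
        have hδ0 : 0 ≤ δ := by linarith
        calc |L * (i - δ) + δ ^ 2 / 2| ≤ |L * (i - δ)| + |δ ^ 2 / 2| := abs_add_le _ _
          _ = L * |i - δ| + δ ^ 2 / 2 := by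
              rw [abs_mul, abs_of_nonneg hl0, abs_of_nonneg (a := δ ^ 2 / 2) (by positivity)]
          _ ≤ (2 * s) * (2 * i ^ 2) + (2 * i) ^ 2 / 2 := by
              gcongr
              linarith
          _ ≤ _ := by nlinarith [sq_nonneg i]
      calc _ = |((∑ m ∈ Icc 1 n, Real.log m / m) - (L - δ) ^ 2 / 2) +
            (L / (n + 1) - (L ^ 2 / 2 - (L - δ) ^ 2 / 2))| := by congr 1; ring
        _ ≤ _ := (abs_add_le _ _).trans (add_le_add ih step)
  refine (key n).trans ?_
  rw [← mul_sum]
  gcongr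
  exact sum_zetaThreeHalves_le _

theorem log_le_self_of_one_le {x : ℝ} (hx : 1 ≤ x) : Real.log x ≤ x := by
  have := Real.log_le_sub_one_of_pos (show 0 < x by linarith)
  linarith

/-- `∑_{m ≤ x} log (x / m) / m = (log x) ^ 2 / 2 + γ log x + O(1)`. -/
theorem abs_sum_log_kernel_sub_le {x : ℝ} (hx : 1 ≤ x) :
    |(∑ m ∈ Icc 1 ⌊x⌋₊, (1 : ℝ) / m * (-Real.log (m / x)))
      - (1 / 2 * Real.log x ^ 2 + γ * Real.log x)| ≤ 6 * zetaThreeHalves + 4 := by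
  obtain ⟨h1, h2, h3, h4⟩ := natFloor_bounds hx
  obtain ⟨h5, h6⟩ := log_sub_log_floor hx
  have hH := abs_harmonic_floor_sub_le hx
  have hT := abs_sum_log_div_sub_le ⌊x⌋₊
  have e : ∑ m ∈ Icc 1 ⌊x⌋₊, (1 : ℝ) / m * (-Real.log (m / x)) =
      Real.log x * (∑ m ∈ Icc 1 ⌊x⌋₊, (1 : ℝ) / m) - ∑ m ∈ Icc 1 ⌊x⌋₊, Real.log m / m := by
    rw [mul_sum, ← sum_sub_distrib]
    refine sum_congr rfl fun m hm => ?_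
    have : (0 : ℝ) < m := by exact_mod_cast (mem_Icc.1 hm).1
    rw [Real.log_div this.ne' (by linarith)]
    ring
  rw [e]
  have hl0 := Real.log_nonneg hx
  have hln0 : 0 ≤ Real.log ⌊x⌋₊ := Real.log_nonneg h1
  have hlx := log_le_self_of_one_le hx
  set L := Real.log x
  set l := Real.log (⌊x⌋₊ : ℝ)
  set H := ∑ m ∈ Icc 1 ⌊x⌋₊, (1 : ℝ) / m
  set T := ∑ m ∈ Icc 1 ⌊x⌋₊, Real.log m / m
  have b1 : |L * (H - (L + γ))| ≤ 2 := by
    rw [abs_mul, abs_of_nonneg hl0]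
    calc L * |H - (L + γ)| ≤ x * (2 / x) := by gcongr
      _ = 2 := by field_simp
  have b2 : |(L ^ 2 - l ^ 2) / 2| ≤ 2 := by
    rw [show (L ^ 2 - l ^ 2) / 2 = (L - l) * ((L + l) / 2) by ring, abs_mul, abs_of_nonneg h5,
      abs_of_nonneg (by linarith)]
    calc (L - l) * ((L + l) / 2) ≤ (2 / x) * x := by
          apply mul_le_mul (h6.trans h4) (by linarith) (by linarith) (by positivity)
      _ = 2 := by field_simp
  calc |L * H - T - (1 / 2 * L ^ 2 + γ * L)|
      = |L * (H - (L + γ)) + (L ^ 2 - l ^ 2) / 2 - (T - l ^ 2 / 2)| := by congr 1; ring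
    _ ≤ |L * (H - (L + γ)) + (L ^ 2 - l ^ 2) / 2| + |T - l ^ 2 / 2| := abs_sub _ _
    _ ≤ 2 + 2 + 6 * zetaThreeHalves := by
        gcongr
        exact (abs_add_le _ _).trans (by gcongr)
    _ = _ := by ring

theorem abs_sum_one_sub_sq_kernel_sub_le {x : ℝ} (hx : 1 ≤ x) :
    |(∑ m ∈ Icc 1 ⌊x⌋₊, (1 : ℝ) / m * (1 - m / x) ^ 2) - (Real.log x + (γ - 3 / 2))| ≤ 5 / x := by
  obtain ⟨h1, h2, h3, -⟩ := natFloor_bounds hx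
  have hH := abs_harmonic_floor_sub_le hx
  have hx0 : 0 < x := by linarith
  have e : ∑ m ∈ Icc 1 ⌊x⌋₊, (1 : ℝ) / m * (1 - m / x) ^ 2 =
      (∑ m ∈ Icc 1 ⌊x⌋₊, (1 : ℝ) / m) - 2 / x * ⌊x⌋₊
        + 1 / x ^ 2 * (⌊x⌋₊ * (⌊x⌋₊ + 1) / 2) := by
    rw [← sum_Icc_natCast, ← sum_Icc_one_real, mul_sum, mul_sum, ← sum_sub_distrib,
      ← sum_add_distrib]
    refine sum_congr rfl fun m hm => ?_
    have : (0 : ℝ) < m := by exact_mod_cast (mem_Icc.1 hm).1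
    field_simp
    ring
  rw [e]
  set n : ℝ := (⌊x⌋₊ : ℝ)
  set H := ∑ m ∈ Icc 1 ⌊x⌋₊, (1 : ℝ) / m
  have b : |3 / 2 - 2 / x * n + 1 / x ^ 2 * (n * (n + 1) / 2)| ≤ 3 / x := by
    have : 3 / 2 - 2 / x * n + 1 / x ^ 2 * (n * (n + 1) / 2) =
        (3 * x ^ 2 - 4 * x * n + n * (n + 1)) / (2 * x ^ 2) := by field_simp; ring
    rw [this, abs_div, abs_of_pos (show 0 < 2 * x ^ 2 by positivity),
      div_le_div_iff₀ (by positivity) hx0]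
    have : |3 * x ^ 2 - 4 * x * n + n * (n + 1)| ≤ 6 * x := by
      rw [abs_le]
      constructor <;> nlinarith
    nlinarith
  calc _ = |(H - (Real.log x + γ)) + (3 / 2 - 2 / x * n + 1 / x ^ 2 * (n * (n + 1) / 2))| := by
        congr 1; ring
    _ ≤ 2 / x + 3 / x := (abs_add_le _ _).trans (add_le_add hH b)
    _ = _ := by ring

theorem abs_sum_mul_one_sub_kernel_sub_le {x : ℝ} (hx : 1 ≤ x) :
    |(∑ m ∈ Icc 1 ⌊x⌋₊, (1 : ℝ) / m * (m / x * (1 - m / x))) - 1 / 2| ≤ 1 / x := by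
  obtain ⟨h1, h2, h3, -⟩ := natFloor_bounds hx
  have hx0 : 0 < x := by linarith
  have e : ∑ m ∈ Icc 1 ⌊x⌋₊, (1 : ℝ) / m * (m / x * (1 - m / x)) =
      1 / x * ⌊x⌋₊ - 1 / x ^ 2 * (⌊x⌋₊ * (⌊x⌋₊ + 1) / 2) := by
    rw [← sum_Icc_natCast, ← sum_Icc_one_real, mul_sum, mul_sum, ← sum_sub_distrib]
    refine sum_congr rfl fun m hm => ?_
    have : (0 : ℝ) < m := by exact_mod_cast (mem_Icc.1 hm).1
    field_simp
  rw [e]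
  set n : ℝ := (⌊x⌋₊ : ℝ)
  have : 1 / x * n - 1 / x ^ 2 * (n * (n + 1) / 2) - 1 / 2 =
        (2 * x * n - n * (n + 1) - x ^ 2) / (2 * x ^ 2) := by field_simp
  rw [this, abs_div, abs_of_pos (show 0 < 2 * x ^ 2 by positivity),
    div_le_div_iff₀ (by positivity) hx0]
  have : |2 * x * n - n * (n + 1) - x ^ 2| ≤ 2 * x := by
    rw [abs_le]
    constructor <;> nlinarith
  nlinarith

/-! ### The contribution of the fractional parts -/

/-- The amount by which `α m` falls short of the next integer. -/
noncomputable def ceilDefect (α : ℝ) (m : ℕ) : ℝ := (⌈α * m⌉₊ : ℝ) - α * m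

/-- The sum of the series `∑ (⌈α m⌉ - α m) / m ^ 2`. -/
noncomputable def ceilSeries (α : ℝ) : ℝ := ∑' m : ℕ, ceilDefect α m / (m : ℝ) ^ 2

theorem ceilDefect_nonneg (α : ℝ) (m : ℕ) : 0 ≤ ceilDefect α m :=
  sub_nonneg.2 (Nat.le_ceil _)

theorem ceilDefect_le_one {α : ℝ} (hα : 0 ≤ α) (m : ℕ) : ceilDefect α m ≤ 1 := by
  have := Nat.ceil_lt_add_one (show 0 ≤ α * m by positivity)
  rw [ceilDefect]; linarith

theorem inv_sq_le_inv_rpow (m : ℕ) : 1 / (m : ℝ) ^ 2 ≤ ((m : ℝ) ^ (3 / 2 : ℝ))⁻¹ := by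
  rcases Nat.eq_zero_or_pos m with rfl | hm
  · simp
  have hm1 : (1 : ℝ) ≤ m := by exact_mod_cast hm
  rw [← one_div_sq_mul_sqrt (by linarith)]
  exact le_mul_of_one_le_right (by positivity) (Real.one_le_rpow hm1 (by norm_num))

theorem hasSum_ceilSeries {α : ℝ} (hα : 0 ≤ α) :
    HasSum (fun m : ℕ => ceilDefect α m / (m : ℝ) ^ 2) (ceilSeries α) := by
  refine (Summable.of_nonneg_of_le (fun m => ?_) (fun m => ?_)
    hasSum_zetaThreeHalves.summable).hasSum
  · exact div_nonneg (ceilDefect_nonneg α m) (by positivity)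
  · refine le_trans ?_ (inv_sq_le_inv_rpow m)
    gcongr
    exact ceilDefect_le_one hα m

theorem ceilSeries_nonneg (α : ℝ) : 0 ≤ ceilSeries α :=
  tsum_nonneg fun m => div_nonneg (ceilDefect_nonneg α m) (by positivity)

theorem ceilSeries_le {α : ℝ} (hα : 0 ≤ α) : ceilSeries α ≤ zetaThreeHalves := by
  refine hasSum_le (fun m => ?_) (hasSum_ceilSeries hα) hasSum_zetaThreeHalves
  refine le_trans ?_ (inv_sq_le_inv_rpow m)
  gcongr
  exact ceilDefect_le_one hα m

/-- The real Hurwitz series at `2`, in the form in which it occurs in `F`. -/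
theorem hasSum_hurwitzZeta_two_re {a : ℝ} (ha0 : 0 < a) (ha1 : a ≤ 1) :
    HasSum (fun n : ℕ => 1 / ((n : ℝ) + a) ^ 2)
      (HurwitzZeta.hurwitzZeta ((a : ℝ) : UnitAddCircle) 2).re := by
  have h := Complex.hasSum_re (HurwitzZeta.hasSum_hurwitzZeta_of_one_lt_re (a := a)
    ⟨ha0.le, ha1⟩ (s := 2) (by norm_num))
  refine h.congr_fun ?_
  intro n
  rw [show (2 : ℂ) = ((2 : ℕ) : ℂ) by norm_num, Complex.cpow_natCast]
  norm_cast

/-- The series `∑ (⌈α m⌉ - α m) / m ^ 2` splits into residue classes modulo the denominator. -/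
theorem ceilSeries_eq (α : ℚ) (hα : 0 < α) : ceilSeries α = α * F α := by
  have hw : NeZero α.den := ⟨α.den_nz⟩
  have hα' : (0 : ℝ) < α := by exact_mod_cast hα
  have hwpos : 0 < α.den := α.den_pos
  have hw0 : (0 : ℝ) < α.den := by exact_mod_cast hwpos
  have hv : (α : ℝ) * α.den = α.num := by
    have := Rat.mul_den_eq_num α
    exact_mod_cast this
  have hS := hasSum_ceilSeries hα'.le
  have defect : ∀ r n : ℕ, ceilDefect α (r + α.den * n) = ⌈(α : ℝ) * r⌉ - α * r := by
    intro r n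
    rw [ceilDefect, natCast_ceil_eq_intCast_ceil (by positivity)]
    have : (α : ℝ) * ((r + α.den * n : ℕ) : ℝ) = α * r + ((α.num * n : ℤ) : ℝ) := by
      push_cast
      rw [← hv]; ring
    rw [this, Int.ceil_add_intCast]
    push_cast
    ring
  rw [ceilSeries, Nat.sumByResidueClasses hS.summable α.den]
  have e := sum_zmod_eq_sum_range α.den (fun r => ∑' n : ℕ,
    ceilDefect α (r + α.den * n) / ((r + α.den * n : ℕ) : ℝ) ^ 2)
  rw [e, range_eq_Ico, sum_eq_sum_Ico_succ_bot hwpos]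
  have z : ∑' n : ℕ, ceilDefect α (0 + α.den * n) / ((0 + α.den * n : ℕ) : ℝ) ^ 2 = 0 := by
    rw [← tsum_zero (α := ℝ) (β := ℕ)]
    refine tsum_congr fun n => ?_
    rw [defect]; simp
  rw [z, zero_add, F, ← mul_assoc, mul_sum]
  refine sum_congr (by ext r; simp only [mem_Ico, mem_Ioo]; omega) fun r hr => ?_
  have hr0 : 0 < r ∧ r < α.den := by rw [mem_Ioo] at hr; exact hr
  have hfr : Int.fract ((α : ℝ) * r) ≠ 0 := by
    intro h
    have h1 : (α : ℝ) * r = (⌊(α : ℝ) * r⌋ : ℝ) := by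
      have := Int.floor_add_fract ((α : ℝ) * r); rw [h, add_zero] at this; exact this.symm
    set z := ⌊(α : ℝ) * r⌋
    have h2 : α.num * r = z * α.den := by
      have : (α.num : ℝ) * r = z * α.den := by rw [← hv, ← h1]; ring
      exact_mod_cast this
    have h3 : (α.den : ℤ) ∣ α.num * r := ⟨z, by rw [h2]; ring⟩
    have h4 : (α.den : ℤ) ∣ r := by
      refine IsCoprime.dvd_of_dvd_mul_left ?_ h3
      rw [Int.isCoprime_iff_gcd_eq_one, Int.gcd_comm]
      exact α.reduced
    have h5 := Nat.le_of_dvd hr0.1 (Int.natCast_dvd_natCast.1 h4)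
    omega
  have hceil : (⌈(α : ℝ) * r⌉ : ℝ) - α * r = 1 - Int.fract ((α : ℝ) * r) := by
    have := (Int.fract_eq_zero_or_add_one_sub_ceil ((α : ℝ) * r)).resolve_left hfr
    linarith
  have hH := hasSum_hurwitzZeta_two_re (a := (r : ℝ) / α.den)
    (by have : (0 : ℝ) < r := by exact_mod_cast hr0.1
        positivity)
    (by rw [div_le_one hw0]; exact_mod_cast hr0.2.le)
  rw [← hH.tsum_eq, ← tsum_mul_left, ← tsum_mul_left]
  refine tsum_congr fun n => ?_
  rw [defect, hceil]
  push_cast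
  have : (r : ℝ) + α.den * n ≠ 0 := by
    have : (0 : ℝ) < r := by exact_mod_cast hr0.1
    positivity
  rw [show (n : ℝ) + r / α.den = (r + α.den * n) / α.den by field_simp; ring]
  field_simp

/-- Weighted sums of the defects `⌈α m⌉ - α m` converge to a multiple of `ceilSeries α`. -/
theorem abs_sum_ceilDefect_sub_le {α : ℝ} (hα : 0 ≤ α) {n : ℕ} {f : ℕ → ℝ} {κ R : ℝ}
    (h : ∀ m : ℕ, 1 ≤ m → |(if m ≤ n then f m else 0) - κ| ≤ R * (m : ℝ) ^ (1 / 2 : ℝ)) :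
    |(∑ m ∈ Icc 1 n, ceilDefect α m / (m : ℝ) ^ 2 * f m) - κ * ceilSeries α|
      ≤ R * zetaThreeHalves := by
  have h1 : HasSum (fun m : ℕ => ceilDefect α m / (m : ℝ) ^ 2 * (if m ≤ n then f m else 0))
      (∑ m ∈ Icc 1 n, ceilDefect α m / (m : ℝ) ^ 2 * f m) := by
    have e : ∑ m ∈ Icc 1 n, ceilDefect α m / (m : ℝ) ^ 2 * f m =
        ∑ m ∈ Icc 1 n, ceilDefect α m / (m : ℝ) ^ 2 * (if m ≤ n then f m else 0) :=
      sum_congr rfl fun m hm => by rw [if_pos (mem_Icc.1 hm).2]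
    rw [e]
    refine hasSum_sum_of_ne_finset_zero fun m hm => ?_
    rcases Nat.eq_zero_or_pos m with rfl | hm0
    · simp
    · rw [if_neg, mul_zero]
      simp only [mem_Icc, not_and] at hm
      exact hm hm0
  have h2 := h1.sub ((hasSum_ceilSeries hα).mul_left κ)
  rw [← h2.tsum_eq, ← Real.norm_eq_abs]
  refine tsum_of_norm_bounded (hasSum_zetaThreeHalves.mul_left R) fun m => ?_
  rcases Nat.eq_zero_or_pos m with rfl | hm
  · simp
  have hm0 : (0 : ℝ) < m := by exact_mod_cast hm
  rw [← one_div_sq_mul_sqrt hm0, Real.norm_eq_abs,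
    show ceilDefect α m / (m : ℝ) ^ 2 * (if m ≤ n then f m else 0)
      - κ * (ceilDefect α m / (m : ℝ) ^ 2)
      = ceilDefect α m / (m : ℝ) ^ 2 * ((if m ≤ n then f m else 0) - κ) by ring, abs_mul,
    abs_of_nonneg (div_nonneg (ceilDefect_nonneg α m) (by positivity))]
  calc _ ≤ 1 / (m : ℝ) ^ 2 * (R * (m : ℝ) ^ (1 / 2 : ℝ)) := by
        gcongr
        · exact ceilDefect_le_one hα m
        · exact h m hm
    _ = _ := by ring

/-- The rounding error in a kernel sum of `⌈α m⌉` contributes the full series times the value `κ` of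
the kernel at `0`. -/
theorem abs_sum_ceilDefect_kernel_sub_le {α : ℝ} (hα : 0 ≤ α) {k : ℝ → ℝ} {κ R : ℝ}
    (hR : 0 ≤ R) (hk : ∀ t : ℝ, 0 < t → t ≤ 1 → |k t - κ| ≤ R * t ^ (1 / 2 : ℝ)) {x : ℝ}
    (hx : 0 < x) :
    |(∑ m ∈ Icc 1 ⌊x⌋₊, ceilDefect α m / (m : ℝ) ^ 2 * k (m / x)) - κ * ceilSeries α|
      ≤ (R + |κ|) * zetaThreeHalves * (x ^ (1 / 2 : ℝ))⁻¹ := by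
  have := abs_sum_ceilDefect_sub_le hα (n := ⌊x⌋₊) (f := fun m => k (m / x)) (κ := κ)
    (R := (R + |κ|) * (x ^ (1 / 2 : ℝ))⁻¹) ?_
  · refine this.trans (le_of_eq (by ring))
  intro m hm
  have hm0 : (0 : ℝ) < m := by exact_mod_cast hm
  have e : (R + |κ|) * (x ^ (1 / 2 : ℝ))⁻¹ * (m : ℝ) ^ (1 / 2 : ℝ) =
      (R + |κ|) * ((m : ℝ) / x) ^ (1 / 2 : ℝ) := by
    rw [Real.div_rpow hm0.le hx.le]; ring
  rw [e]
  have hκ := abs_nonneg κ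
  split_ifs with h
  · have h1 : (m : ℝ) / x ≤ 1 := by
      rw [div_le_one hx]
      exact (Nat.le_floor_iff hx.le).1 h
    refine (hk _ (by positivity) h1).trans ?_
    gcongr
    linarith
  · have h1 : 1 ≤ (m : ℝ) / x := by
      rw [one_le_div hx]
      exact ((Nat.floor_lt hx.le).1 (not_le.1 h)).le
    have h2 := Real.one_le_rpow h1 (show (0 : ℝ) ≤ 1 / 2 by norm_num)
    rw [zero_sub, abs_neg]
    nlinarith

theorem sum_ceil_eq (α : ℝ) (n : ℕ) (f : ℕ → ℝ) :
    ∑ m ∈ Icc 1 n, (⌈α * m⌉₊ : ℝ) / (m : ℝ) ^ 2 * f m =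
      α * (∑ m ∈ Icc 1 n, (1 : ℝ) / m * f m)
        + ∑ m ∈ Icc 1 n, ceilDefect α m / (m : ℝ) ^ 2 * f m := by
  rw [mul_sum, ← sum_add_distrib]
  refine sum_congr rfl fun m hm => ?_
  have : (0 : ℝ) < m := by exact_mod_cast (mem_Icc.1 hm).1
  rw [ceilDefect]
  field_simp
  ring

/-! ### Kernel sums over the coprime counts -/

theorem sum_coprimeCount_eq (α : ℝ) (n : ℕ) (f : ℕ → ℝ) :
    ∑ q ∈ Icc 1 n, (coprimeCount α q : ℝ) / (q : ℝ) ^ 2 * f q =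
      ∑ q ∈ Icc 1 n, (∑ d ∈ q.divisors, (ArithmeticFunction.moebius d : ℝ) *
        (⌈α * (q / d : ℕ)⌉₊ : ℝ)) / (q : ℝ) ^ 2 * f q := by
  refine sum_congr rfl fun q hq => ?_
  rw [coprimeCount_eq_sum_moebius (by have := (mem_Icc.1 hq).1; omega)]

/-- The passage from a kernel sum over `⌈α m⌉` to the kernel sum over `coprimeCount α`, which is
the Dirichlet convolution of the former with the Möbius function. -/
theorem abs_sum_coprimeCount_kernel_sub_le (α : ℝ) (k : ℝ → ℝ) (A B E K ρ : ℝ) (hK : 0 ≤ K)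
    (hρ : 0 ≤ ρ)
    (hG : ∀ x : ℝ, 1 ≤ x → |(∑ m ∈ Icc 1 ⌊x⌋₊, (⌈α * m⌉₊ : ℝ) / (m : ℝ) ^ 2 * k (m / x))
      - (A * Real.log x ^ 2 + B * Real.log x + E)| ≤ K * (ρ + (x ^ (1 / 2 : ℝ))⁻¹))
    {U : ℝ} (hU : 0 < U) :
    |(∑ q ∈ Icc 1 ⌊U⌋₊, (coprimeCount α q : ℝ) / (q : ℝ) ^ 2 * k (q / U))
      - (A * (Real.log U ^ 2 * (1 / zetaTwo) - 2 * Real.log U * moebiusSeries 1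
          + moebiusSeries 2) + B * (Real.log U * (1 / zetaTwo) - moebiusSeries 1)
          + E * (1 / zetaTwo))|
      ≤ (K + (16 * |A| + 2 * |B| + |E|)) * zetaThreeHalves * (ρ + (U ^ (1 / 2 : ℝ))⁻¹) := by
  rw [sum_coprimeCount_eq α ⌊U⌋₊ (fun q => k (q / U)), ← moebiusSeries_zero]
  exact abs_sum_moebius_convolution_sub_le (c := fun m => (⌈α * m⌉₊ : ℝ)) (k := k)
    (by positivity) hρ
    (fun x hx => abs_sum_sub_le_of_one_le (c := fun m => (⌈α * m⌉₊ : ℝ)) (k := k) hK hρ hG hx) hU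

theorem inv_sqrt_le_one {U : ℝ} (hU : 1 ≤ U) : (U ^ (1 / 2 : ℝ))⁻¹ ≤ 1 :=
  inv_le_one_of_one_le₀ (Real.one_le_rpow hU (by norm_num))

theorem one_div_le_inv_sqrt {x : ℝ} (hx : 1 ≤ x) : 1 / x ≤ (x ^ (1 / 2 : ℝ))⁻¹ := by
  rw [one_div]
  apply inv_anti₀ (by positivity)
  conv_rhs => rw [← Real.rpow_one x]
  exact Real.rpow_le_rpow_of_exponent_le hx (by norm_num)

/-- The constant kernel. -/
theorem exists_abs_sum_coprimeCount_sub_le :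
    ∃ C : ℝ, 0 ≤ C ∧ ∀ α U : ℝ, 0 ≤ α → α ≤ 1 → 1 ≤ U →
      |(∑ q ∈ Icc 1 ⌊U⌋₊, (coprimeCount α q : ℝ) / (q : ℝ) ^ 2) - α / zetaTwo * Real.log U|
        ≤ C := by
  have hZ := zetaThreeHalves_nonneg
  refine ⟨(6 + zetaThreeHalves) * zetaThreeHalves * 2 + |moebiusSeries 1|, by positivity,
    fun α U h0 h1 hU => ?_⟩
  have g1 := Real.one_half_lt_eulerMascheroniConstant
  have g2 := Real.eulerMascheroniConstant_lt_two_thirds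
  have hG : ∀ x : ℝ, 1 ≤ x → |(∑ m ∈ Icc 1 ⌊x⌋₊, (⌈α * m⌉₊ : ℝ) / (m : ℝ) ^ 2
      * (fun _ => 1 : ℝ → ℝ) (m / x)) - (0 * Real.log x ^ 2 + α * Real.log x + 0)|
      ≤ (3 + zetaThreeHalves) * (1 + (x ^ (1 / 2 : ℝ))⁻¹) := by
    intro x hx
    have hx0 : 0 < x := by linarith
    rw [sum_ceil_eq]
    simp only [mul_one]
    have hH := abs_harmonic_floor_sub_le hx
    have hx2 : 2 / x ≤ 2 := by rw [div_le_iff₀ hx0]; linarith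
    have hE0 : 0 ≤ ∑ m ∈ Icc 1 ⌊x⌋₊, ceilDefect α m / (m : ℝ) ^ 2 :=
      sum_nonneg fun m _ => div_nonneg (ceilDefect_nonneg α m) (by positivity)
    have hE1 : ∑ m ∈ Icc 1 ⌊x⌋₊, ceilDefect α m / (m : ℝ) ^ 2 ≤ zetaThreeHalves :=
      (sum_le_hasSum _ (fun m _ => div_nonneg (ceilDefect_nonneg α m) (by positivity))
        (hasSum_ceilSeries h0)).trans (ceilSeries_le h0)
    set H := ∑ m ∈ Icc 1 ⌊x⌋₊, (1 : ℝ) / m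
    set S := ∑ m ∈ Icc 1 ⌊x⌋₊, ceilDefect α m / (m : ℝ) ^ 2
    have hH' : |H - Real.log x| ≤ 3 := by
      rw [abs_le] at hH ⊢
      constructor <;> linarith
    calc _ = |α * (H - Real.log x) + S| := by congr 1; ring
      _ ≤ |α| * |H - Real.log x| + |S| := by
          rw [← abs_mul]; exact abs_add_le _ _
      _ ≤ 1 * 3 + zetaThreeHalves := by
          rw [abs_of_nonneg h0, abs_of_nonneg hE0]
          gcongr
      _ ≤ _ := by
          rw [one_mul]
          refine le_mul_of_one_le_right (by positivity) ?_
          have : 0 ≤ (x ^ (1 / 2 : ℝ))⁻¹ := by positivity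
          linarith
  have h := abs_sum_coprimeCount_kernel_sub_le α (fun _ => 1) 0 α 0
    (3 + zetaThreeHalves) 1 (by positivity) zero_le_one hG (show 0 < U by linarith)
  beta_reduce at h
  simp only [mul_one] at h
  have hU1 := inv_sqrt_le_one hU
  rw [abs_of_nonneg h0, abs_zero] at h
  set T := ∑ q ∈ Icc 1 ⌊U⌋₊, (coprimeCount α q : ℝ) / (q : ℝ) ^ 2
  calc |T - α / zetaTwo * Real.log U| = |_ + -(α * moebiusSeries 1)| := by
        congr 1; ring
    _ ≤ _ + |-(α * moebiusSeries 1)| := (abs_add_le _ _).trans (add_le_add h le_rfl)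
    _ ≤ _ := by
        rw [abs_neg, abs_mul, abs_of_nonneg h0]
        exact add_le_add (mul_le_mul (mul_le_mul_of_nonneg_right (by linarith) hZ) (by linarith)
          (by positivity) (by positivity)) (mul_le_of_le_one_left (abs_nonneg _) h1)

/-- The kernel `-log t`. -/
theorem exists_abs_sum_coprimeCount_log_sub_le :
    ∃ C : ℝ, 0 ≤ C ∧ ∀ α U : ℝ, 0 ≤ α → α ≤ 1 → 1 ≤ U →
      |(∑ q ∈ Icc 1 ⌊U⌋₊, (coprimeCount α q : ℝ) / (q : ℝ) ^ 2 * (-Real.log (q / U)))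
        - (α / (2 * zetaTwo) * Real.log U ^ 2 + Real.log U / zetaTwo *
          (α * (γ - zetaTwoDeriv / zetaTwo) + ceilSeries α))| ≤ C := by
  have hZ := zetaThreeHalves_nonneg
  refine ⟨(6 * zetaThreeHalves + 4 + 2 * zetaThreeHalves + (16 + 2 * (1 + zetaThreeHalves)))
      * zetaThreeHalves * 2 + (|moebiusSeries 2| + (1 + zetaThreeHalves) * |moebiusSeries 1|),
    by positivity, fun α U h0 h1 hU => ?_⟩
  have g1 := Real.one_half_lt_eulerMascheroniConstant
  have g2 := Real.eulerMascheroniConstant_lt_two_thirds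
  have hS0 := ceilSeries_nonneg α
  have hS1 := ceilSeries_le h0
  have hB0 : 0 ≤ α * γ + ceilSeries α := by positivity
  have hB1 : α * γ + ceilSeries α ≤ 1 + zetaThreeHalves := by nlinarith
  have hG : ∀ x : ℝ, 1 ≤ x → |(∑ m ∈ Icc 1 ⌊x⌋₊, (⌈α * m⌉₊ : ℝ) / (m : ℝ) ^ 2
      * (fun t => -Real.log t : ℝ → ℝ) (m / x)) - (α / 2 * Real.log x ^ 2 +
        (α * γ + ceilSeries α) * Real.log x + 0)|
      ≤ (6 * zetaThreeHalves + 4 + 2 * zetaThreeHalves) * (1 + (x ^ (1 / 2 : ℝ))⁻¹) := by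
    intro x hx
    have hx0 : 0 < x := by linarith
    rw [sum_ceil_eq]
    have hH := abs_sum_log_kernel_sub_le hx
    have hE := abs_sum_ceilDefect_sub_le h0 (n := ⌊x⌋₊) (f := fun m => -Real.log (m / x))
      (κ := Real.log x) (R := 2) (by
        intro m hm
        have hm1 : (1 : ℝ) ≤ m := by exact_mod_cast hm
        have hl := Real.log_nonneg hm1
        have hl2 := log_le_two_mul_sqrt hm1
        split_ifs with h
        · rw [Real.log_div (by linarith) hx0.ne',
            show -(Real.log m - Real.log x) - Real.log x = - Real.log m by ring, abs_neg,
            abs_of_nonneg hl]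
          exact hl2
        · rw [zero_sub, abs_neg, abs_of_nonneg (Real.log_nonneg hx)]
          have : x ≤ m := ((Nat.floor_lt hx0.le).1 (not_le.1 h)).le
          exact (Real.log_le_log hx0 this).trans hl2)
    beta_reduce at hE ⊢
    set H := ∑ m ∈ Icc 1 ⌊x⌋₊, (1 : ℝ) / m * -Real.log (m / x)
    set S := ∑ m ∈ Icc 1 ⌊x⌋₊, ceilDefect α m / (m : ℝ) ^ 2 * -Real.log (m / x)
    calc _ = |α * (H - (1 / 2 * Real.log x ^ 2 + γ * Real.log x)) +
            (S - Real.log x * ceilSeries α)| := by congr 1; ring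
      _ ≤ |α| * |H - (1 / 2 * Real.log x ^ 2 + γ * Real.log x)| +
            |S - Real.log x * ceilSeries α| := by
          rw [← abs_mul]; exact abs_add_le _ _
      _ ≤ 1 * (6 * zetaThreeHalves + 4) + 2 * zetaThreeHalves := by
          rw [abs_of_nonneg h0]
          gcongr
      _ ≤ _ := by
          rw [one_mul]
          refine le_mul_of_one_le_right (by positivity) ?_
          have : 0 ≤ (x ^ (1 / 2 : ℝ))⁻¹ := by positivity
          linarith
  have h := abs_sum_coprimeCount_kernel_sub_le α (fun t => -Real.log t) (α / 2)
    (α * γ + ceilSeries α) 0 (6 * zetaThreeHalves + 4 + 2 * zetaThreeHalves) 1 (by positivity)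
    zero_le_one hG (show 0 < U by linarith)
  beta_reduce at h
  rw [abs_of_nonneg hB0, abs_of_nonneg (by positivity : 0 ≤ α / 2),
    abs_zero] at h
  have hU1 := inv_sqrt_le_one hU
  set T := ∑ q ∈ Icc 1 ⌊U⌋₊, (coprimeCount α q : ℝ) / (q : ℝ) ^ 2 * -Real.log (q / U)
  have hz := zetaTwo_pos.ne'
  calc _ = |_ + (α / 2 * moebiusSeries 2 - (α * γ + ceilSeries α) * moebiusSeries 1)| := by
        congr 1
        rw [moebiusSeries_one]
        field_simp
        ring
    _ ≤ _ + |α / 2 * moebiusSeries 2 - (α * γ + ceilSeries α) * moebiusSeries 1| :=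
        (abs_add_le _ _).trans (add_le_add h le_rfl)
    _ ≤ _ := by
        have i1 : |α / 2 * moebiusSeries 2 - (α * γ + ceilSeries α) * moebiusSeries 1| ≤
            |moebiusSeries 2| + (1 + zetaThreeHalves) * |moebiusSeries 1| := by
          refine (abs_sub _ _).trans ?_
          rw [abs_mul, abs_mul, abs_of_nonneg hB0, abs_of_nonneg (by positivity : 0 ≤ α / 2)]
          gcongr
          exact mul_le_of_le_one_left (abs_nonneg _) (by linarith)
        exact add_le_add (mul_le_mul (mul_le_mul_of_nonneg_right (by linarith) hZ) (by linarith)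
          (by positivity) (by positivity)) i1

/-- The kernel `(1 - t) ^ 2`, with a power saving. -/
theorem exists_abs_sum_coprimeCount_one_sub_sq_sub_le :
    ∃ C : ℝ, 0 ≤ C ∧ ∀ α U : ℝ, 0 ≤ α → α ≤ 1 → 1 ≤ U →
      |(∑ q ∈ Icc 1 ⌊U⌋₊, (coprimeCount α q : ℝ) / (q : ℝ) ^ 2 * (1 - q / U) ^ 2)
        - 1 / zetaTwo * (α * (Real.log U + γ - 3 / 2 - zetaTwoDeriv / zetaTwo) + ceilSeries α)|
        ≤ C * (U ^ (1 / 2 : ℝ))⁻¹ := by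
  have hZ := zetaThreeHalves_nonneg
  refine ⟨(5 + (2 + |1|) * zetaThreeHalves + (2 + (1 + zetaThreeHalves))) * zetaThreeHalves,
    by positivity, fun α U h0 h1 hU => ?_⟩
  have g1 := Real.one_half_lt_eulerMascheroniConstant
  have g2 := Real.eulerMascheroniConstant_lt_two_thirds
  have hS0 := ceilSeries_nonneg α
  have hS1 := ceilSeries_le h0
  have hE1 : |α * (γ - 3 / 2) + ceilSeries α| ≤ 1 + zetaThreeHalves := by
    rw [abs_le]; constructor <;> nlinarith
  have hG : ∀ x : ℝ, 1 ≤ x → |(∑ m ∈ Icc 1 ⌊x⌋₊, (⌈α * m⌉₊ : ℝ) / (m : ℝ) ^ 2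
      * (fun t => (1 - t) ^ 2 : ℝ → ℝ) (m / x)) - (0 * Real.log x ^ 2 +
        α * Real.log x + (α * (γ - 3 / 2) + ceilSeries α))|
      ≤ (5 + (2 + |1|) * zetaThreeHalves) * (0 + (x ^ (1 / 2 : ℝ))⁻¹) := by
    intro x hx
    have hx0 : 0 < x := by linarith
    rw [sum_ceil_eq]
    have hH := abs_sum_one_sub_sq_kernel_sub_le hx
    have hE := abs_sum_ceilDefect_kernel_sub_le h0 (k := fun t => (1 - t) ^ 2) (κ := 1) (R := 2)
      (by norm_num) (by
        intro t ht0 ht1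
        have : t ≤ t ^ (1 / 2 : ℝ) := by
          conv_lhs => rw [← Real.rpow_one t]
          exact Real.rpow_le_rpow_of_exponent_ge ht0 ht1 (by norm_num)
        rw [abs_le]; constructor <;> nlinarith) hx0
    have hinv := one_div_le_inv_sqrt hx
    beta_reduce at hE ⊢
    set H := ∑ m ∈ Icc 1 ⌊x⌋₊, (1 : ℝ) / m * (1 - m / x) ^ 2
    set S := ∑ m ∈ Icc 1 ⌊x⌋₊, ceilDefect α m / (m : ℝ) ^ 2 * (1 - m / x) ^ 2
    calc _ = |α * (H - (Real.log x + (γ - 3 / 2))) + (S - 1 * ceilSeries α)| := by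
          congr 1; ring
      _ ≤ |α| * |H - (Real.log x + (γ - 3 / 2))| + |S - 1 * ceilSeries α| := by
          rw [← abs_mul]; exact abs_add_le _ _
      _ ≤ 1 * (5 * (x ^ (1 / 2 : ℝ))⁻¹) +
            (2 + |1|) * zetaThreeHalves * (x ^ (1 / 2 : ℝ))⁻¹ := by
          rw [abs_of_nonneg h0]
          gcongr
          refine hH.trans ?_
          rw [← mul_one_div]
          gcongr
      _ = _ := by ring
  have h := abs_sum_coprimeCount_kernel_sub_le α (fun t => (1 - t) ^ 2) 0 α
    (α * (γ - 3 / 2) + ceilSeries α) (5 + (2 + |1|) * zetaThreeHalves) 0 (by positivity) le_rfl hG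
    (show 0 < U by linarith)
  beta_reduce at h
  rw [moebiusSeries_one, abs_of_nonneg h0, abs_zero] at h
  have hz := zetaTwo_pos.ne'
  refine le_trans (le_of_eq ?_) (h.trans ?_)
  · congr 1
    generalize (∑ q ∈ Icc 1 ⌊U⌋₊, (_ : ℝ)) = T
    field_simp
    ring
  · rw [zero_add]
    gcongr
    linarith

/-- The kernel `t (1 - t)` vanishes at `0`, so neither a logarithm nor the series of rounding errors
occurs. -/
theorem exists_abs_sum_coprimeCount_mul_one_sub_sub_le :
    ∃ C : ℝ, 0 ≤ C ∧ ∀ α U : ℝ, 0 ≤ α → α ≤ 1 → 0 < U →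
      |(∑ q ∈ Icc 1 ⌊U⌋₊, (coprimeCount α q : ℝ) / (q : ℝ) ^ 2 * (q / U * (1 - q / U)))
        - α / (2 * zetaTwo)| ≤ C * (U ^ (1 / 2 : ℝ))⁻¹ := by
  have hZ := zetaThreeHalves_nonneg
  refine ⟨(1 + (1 + |0|) * zetaThreeHalves + 1) * zetaThreeHalves,
    by positivity, fun α U h0 h1 hU => ?_⟩
  have hG : ∀ x : ℝ, 1 ≤ x → |(∑ m ∈ Icc 1 ⌊x⌋₊, (⌈α * m⌉₊ : ℝ) / (m : ℝ) ^ 2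
      * (fun t => t * (1 - t) : ℝ → ℝ) (m / x)) - (0 * Real.log x ^ 2 +
        0 * Real.log x + α / 2)|
      ≤ (1 + (1 + |0|) * zetaThreeHalves) * (0 + (x ^ (1 / 2 : ℝ))⁻¹) := by
    intro x hx
    have hx0 : 0 < x := by linarith
    rw [sum_ceil_eq]
    have hH := abs_sum_mul_one_sub_kernel_sub_le hx
    have hE := abs_sum_ceilDefect_kernel_sub_le h0 (k := fun t => t * (1 - t)) (κ := 0) (R := 1)
      (by norm_num) (by
        intro t ht0 ht1
        have : t ≤ t ^ (1 / 2 : ℝ) := by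
          conv_lhs => rw [← Real.rpow_one t]
          exact Real.rpow_le_rpow_of_exponent_ge ht0 ht1 (by norm_num)
        rw [abs_le]; constructor <;> nlinarith) hx0
    have hinv := one_div_le_inv_sqrt hx
    beta_reduce at hE ⊢
    set H := ∑ m ∈ Icc 1 ⌊x⌋₊, (1 : ℝ) / m * (m / x * (1 - m / x))
    set S := ∑ m ∈ Icc 1 ⌊x⌋₊, ceilDefect α m / (m : ℝ) ^ 2 * (m / x * (1 - m / x))
    calc _ = |α * (H - 1 / 2) + (S - 0 * ceilSeries α)| := by
          congr 1; ring
      _ ≤ |α| * |H - 1 / 2| + |S - 0 * ceilSeries α| := by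
          rw [← abs_mul]; exact abs_add_le _ _
      _ ≤ 1 * (x ^ (1 / 2 : ℝ))⁻¹ +
            (1 + |0|) * zetaThreeHalves * (x ^ (1 / 2 : ℝ))⁻¹ := by
          rw [abs_of_nonneg h0]
          gcongr
          exact hH.trans hinv
      _ = _ := by ring
  have h := abs_sum_coprimeCount_kernel_sub_le α (fun t => t * (1 - t)) 0 0 (α / 2)
    (1 + (1 + |0|) * zetaThreeHalves) 0 (by positivity) le_rfl hG (show 0 < U by linarith)
  beta_reduce at h
  rw [abs_of_nonneg (by positivity : 0 ≤ α / 2)] at h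
  have hz := zetaTwo_pos.ne'
  refine le_trans (le_of_eq ?_) (h.trans ?_)
  · congr 1
    generalize (∑ q ∈ Icc 1 ⌊U⌋₊, (_ : ℝ)) = T
    field_simp
    ring
  · rw [zero_add, abs_zero]
    gcongr
    linarith

end

section

open scoped Classical

/-! ### The condition on the inverse as a congruence -/

/-- The number of `u ∈ (x, y]` and `j ∈ [s, t)` with `u j ≡ ε` modulo `m`. -/
noncomputable def congruenceCount (m : ℕ) (ε : (ZMod m)ˣ) (x y : ℝ) (s t : ℕ) : ℝ :=
  ∑ u ∈ Ioc ⌊x⌋₊ ⌊y⌋₊, ∑ j ∈ Ico s t, if (u : ZMod m) * (j : ZMod m) = ε then 1 else 0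

theorem card_coprime_le {m s t : ℕ} (hst : t ≤ s + m) : #{j ∈ Ico s t | j.Coprime m} ≤ m := by
  refine (card_filter_le _ _).trans ?_
  rw [Nat.card_Ico]; omega

theorem exists_abs_congruenceCount_sub_le :
    ∃ C : ℝ, 1 ≤ C ∧ ∀ (m : ℕ) (ε : (ZMod m)ˣ) (x y : ℝ) (s t : ℕ), 1 ≤ m → 0 ≤ x →
      t ≤ s + m →
      |congruenceCount m ε x y s t - max (y - x) 0 / m * #{j ∈ Ico s t | j.Coprime m}|
        ≤ C * (m : ℝ) ^ (9 / 10 : ℝ) := by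
  obtain ⟨C, hC0, hC⟩ := exists_equidistribution
  refine ⟨C + 1, by linarith, fun m ε x y s t hm hx hst => ?_⟩
  have : NeZero m := ⟨by omega⟩
  have hm1 : (1 : ℝ) ≤ m := by exact_mod_cast hm
  have hmp : 1 ≤ (m : ℝ) ^ (9 / 10 : ℝ) := Real.one_le_rpow hm1 (by norm_num)
  have hN : (#{j ∈ Ico s t | j.Coprime m} : ℝ) ≤ m := by exact_mod_cast card_coprime_le hst
  have hx1 := Nat.floor_le hx
  have hx2 := Nat.lt_floor_add_one x
  rcases lt_or_ge ⌊y⌋₊ ⌊x⌋₊ with h | h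
  · have hyx : y < x := lt_of_not_ge fun h' => absurd (Nat.floor_mono h') (by omega)
    rw [congruenceCount, Ioc_eq_empty_of_le h.le, sum_empty, max_eq_right (by linarith)]
    simp only [zero_div, zero_mul, sub_zero, abs_zero]
    positivity
  have hI : Ioc ⌊x⌋₊ ⌊y⌋₊ = Ico (⌊x⌋₊ + 1) (⌊y⌋₊ + 1) := by
    ext i; simp only [mem_Ioc, mem_Ico]; omega
  have h1 := hC m ε (⌊x⌋₊ + 1) (⌊y⌋₊ + 1) s t (by omega) hst
  rw [← hI] at h1
  push_cast at h1
  have hd : |((⌊y⌋₊ : ℝ) + 1 - (⌊x⌋₊ + 1)) - max (y - x) 0| ≤ 1 := by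
    have hxy : (⌊x⌋₊ : ℝ) ≤ ⌊y⌋₊ := by exact_mod_cast h
    have hy2 := Nat.lt_floor_add_one y
    rcases le_total x y with hle | hle
    · have hy1 := Nat.floor_le (hx.trans hle)
      rw [max_eq_left (by linarith), abs_le]
      constructor <;> linarith
    · rw [max_eq_right (by linarith)]
      have := Nat.floor_mono hle
      have e : ⌊x⌋₊ = ⌊y⌋₊ := le_antisymm h this
      rw [e]; simp
  set N : ℝ := ((#{j ∈ Ico s t | j.Coprime m} : ℕ) : ℝ)
  have hN0 : 0 ≤ N := by positivity
  set S : ℝ := ∑ u ∈ Ioc ⌊x⌋₊ ⌊y⌋₊, ∑ j ∈ Ico s t,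
    (if (u : ZMod m) * (j : ZMod m) = ε then (1 : ℝ) else 0)
  have hS : congruenceCount m ε x y s t = S := by
    simp only [congruenceCount, S]
  rw [hS]
  calc |S - max (y - x) 0 / m * N|
      = |(S - ((⌊y⌋₊ : ℝ) + 1 - (⌊x⌋₊ + 1)) / m * N) +
          (((⌊y⌋₊ : ℝ) + 1 - (⌊x⌋₊ + 1)) - max (y - x) 0) * (N / m)| := by congr 1; ring
    _ ≤ C * (m : ℝ) ^ (9 / 10 : ℝ) + 1 * 1 := by
        refine (abs_add_le _ _).trans (add_le_add h1 ?_)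
        rw [abs_mul, abs_of_nonneg (by positivity : 0 ≤ N / m)]
        gcongr
        rw [div_le_one (by linarith)]; exact hN
    _ ≤ _ := by linarith

theorem sum_ite_mul_eq {m : ℕ} (ε : (ZMod m)ˣ) (u : ℕ) {s t : ℕ} (hst : t ≤ s + m) :
    (∑ j ∈ Ico s t, if (u : ZMod m) * (j : ZMod m) = ε then (1 : ℝ) else 0) =
      if ∃ j ∈ Ico s t, (u : ZMod m) * (j : ZMod m) = ε then 1 else 0 := by
  split_ifs with h
  · obtain ⟨j, hj, hju⟩ := h
    rw [sum_eq_single j, if_pos hju]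
    · intro i hi hij
      rw [if_neg]
      intro hiu
      apply hij
      have hu : IsUnit (u : ZMod m) := isUnit_of_mul_isUnit_left (hju ▸ ε.isUnit)
      have h1 : (i : ZMod m) = j := hu.mul_left_cancel (hiu.trans hju.symm)
      rw [ZMod.natCast_eq_natCast_iff, Nat.modEq_iff_dvd] at h1
      rw [mem_Ico] at hi hj
      obtain ⟨c, hc⟩ := h1
      have hc0 : c = 0 := by
        by_contra hne
        rcases lt_or_gt_of_ne hne with hneg | hpos
        · have : (m : ℤ) * c ≤ -m := by nlinarith
          omega
        · have : (m : ℤ) ≤ m * c := by nlinarith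
          omega
      rw [hc0] at hc
      omega
    · exact fun h => absurd hj h
  · exact sum_eq_zero fun j hj => if_neg fun hju => h ⟨j, hj, hju⟩

/-- The conditions of the system that involve only `p` and `q`. -/
def Admissible (α : ℝ) (p q : ℕ) : Prop :=
  Nat.Coprime p q ∧ 2 ≤ p ∧ (inv q p : ℝ) ≤ α * p

theorem admissible_iff_exists_inv {α : ℝ} {p q : ℕ} (hp : 2 ≤ p) :
    Admissible α p q ↔ ∃ x ∈ Ico 1 (⌊α * p⌋₊ + 1), (q : ZMod p) * (x : ZMod p) = 1 := by
  constructor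
  · rintro ⟨h1, -, h3⟩
    obtain ⟨h4, h5⟩ := inv_spec (by omega : 0 < p) h1.symm
    refine ⟨inv q p, ?_, ?_⟩
    · rw [mem_Ico, Nat.lt_succ_iff, Nat.le_floor_iff' (by omega)]
      exact ⟨h4, h3⟩
    · rw [← ZMod.natCast_eq_natCast_iff] at h5
      exact_mod_cast h5
  · rintro ⟨x, hx, hqx⟩
    rw [mem_Ico, Nat.lt_succ_iff] at hx
    rw [Nat.le_floor_iff' (by omega)] at hx
    have hu : IsUnit (q : ZMod p) := IsUnit.of_mul_eq_one _ hqx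
    refine ⟨((ZMod.isUnit_iff_coprime q p).1 hu).symm, hp, le_trans ?_ hx.2⟩
    have : inv q p ≤ x := by
      refine Nat.sInf_le ⟨by omega, ?_⟩
      rw [← ZMod.natCast_eq_natCast_iff]
      exact_mod_cast hqx
    exact_mod_cast this

/-- The reciprocity behind the change of modulus: `q x = 1 + p y` turns the inverse of `q` modulo
`p` into minus the inverse of `p` modulo `q`. -/
theorem admissible_iff_exists_dvd {α : ℝ} {p q : ℕ} (hp : 2 ≤ p) (hq : 1 ≤ q) :
    Admissible α p q ↔ ∃ y : ℕ, q ∣ 1 + p * y ∧ ((1 + p * y : ℕ) : ℝ) ≤ α * p * q := by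
  have hq' : (0 : ℝ) < q := by exact_mod_cast hq
  rw [admissible_iff_exists_inv hp]
  constructor
  · rintro ⟨x, hx, hqx⟩
    rw [mem_Ico, Nat.lt_succ_iff] at hx
    rw [Nat.le_floor_iff' (by omega)] at hx
    have h1 : 1 ≤ q * x := Nat.mul_pos (by omega) (by omega)
    have h2 : 1 ≡ q * x [MOD p] := by
      rw [← ZMod.natCast_eq_natCast_iff]
      push_cast
      exact hqx.symm
    obtain ⟨y, hy⟩ := (Nat.modEq_iff_dvd' h1).1 h2
    have e : 1 + p * y = q * x := by omega
    refine ⟨y, ⟨x, e⟩, ?_⟩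
    rw [e]
    push_cast
    nlinarith
  · rintro ⟨y, ⟨x, hx⟩, hy⟩
    rw [hx] at hy
    push_cast at hy
    have hx0 : x ≠ 0 := by rintro rfl; omega
    refine ⟨x, ?_, ?_⟩
    · rw [mem_Ico, Nat.lt_succ_iff, Nat.le_floor_iff' hx0]
      refine ⟨by omega, ?_⟩
      nlinarith
    · have : ((q * x : ℕ) : ZMod p) = ((1 + p * y : ℕ) : ZMod p) := by rw [hx]
      push_cast at this
      simpa using this

theorem dvd_one_add_iff {p q y : ℕ} :
    q ∣ 1 + p * y ↔ (p : ZMod q) * (y : ZMod q) = ((-1 : (ZMod q)ˣ) : ZMod q) := by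
  rw [← ZMod.natCast_eq_zero_iff]
  push_cast
  rw [add_comm, add_eq_zero_iff_eq_neg]

theorem ceil_mul_le {α : ℝ} (h1 : α ≤ 1) (q : ℕ) : ⌈α * q⌉₊ ≤ q := by
  rw [Nat.ceil_le]
  exact mul_le_of_le_one_left (Nat.cast_nonneg q) h1

/-- Modulus `p`: the condition in terms of the inverse `j ≤ α p` of `q`. -/
theorem ite_admissible_eq_inv {α : ℝ} (h1 : α ≤ 1) {p q : ℕ} (hp : 2 ≤ p) :
    (if Admissible α p q then (1 : ℝ) else 0) =
      ∑ j ∈ Ico 1 (⌊α * p⌋₊ + 1),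
        if (q : ZMod p) * (j : ZMod p) = ((1 : (ZMod p)ˣ) : ZMod p) then 1 else 0 := by
  have : ⌊α * p⌋₊ ≤ p := by
    refine Nat.floor_le_of_le ?_
    exact mul_le_of_le_one_left (Nat.cast_nonneg p) h1
  rw [sum_ite_mul_eq _ _ (by omega)]
  simp only [admissible_iff_exists_inv hp, Units.val_one]

/-- Modulus `q`: if `q x = 1 + p y` then `x ≤ α p` means `y ≤ α q - 1 / p`. There is no integer
strictly between `α q - 1 / p` and `α q` as soon as `p` is at least the denominator of `α`. -/
theorem ite_admissible_eq_of_den_le {α : ℚ} (h1 : α ≤ 1) {p q : ℕ} (hp : 2 ≤ p)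
    (hq : 1 ≤ q) (hw : α.den ≤ p) :
    (if Admissible α p q then (1 : ℝ) else 0) =
      ∑ j ∈ Ico 0 ⌈(α : ℝ) * q⌉₊,
        if (p : ZMod q) * (j : ZMod q) = ((-1 : (ZMod q)ˣ) : ZMod q) then 1 else 0 := by
  have h1' : (α : ℝ) ≤ 1 := by exact_mod_cast h1
  have := ceil_mul_le h1' q
  rw [sum_ite_mul_eq _ _ (by omega)]
  congr 1
  rw [admissible_iff_exists_dvd hp hq]
  simp only [← dvd_one_add_iff, eq_iff_iff]
  refine exists_congr fun y => ?_
  rw [and_comm]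
  refine and_congr_left fun _ => ?_
  have hp0 : (0 : ℝ) < p := by exact_mod_cast (by omega : 0 < p)
  have hw0 : (0 : ℝ) < α.den := by exact_mod_cast α.den_pos
  have hwp : (α.den : ℝ) ≤ p := by exact_mod_cast hw
  have hv : (α : ℝ) * α.den = α.num := by
    have := Rat.mul_den_eq_num α
    exact_mod_cast this
  rw [mem_Ico, Nat.lt_ceil]
  push_cast
  constructor
  · intro h
    refine ⟨Nat.zero_le _, ?_⟩
    nlinarith
  · rintro ⟨-, h⟩
    have h2 : (y : ℤ) * α.den < α.num * q := by
      have : (y : ℝ) * α.den < α.num * q := by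
        rw [← hv]; nlinarith
      exact_mod_cast this
    have h3 : (y : ℝ) * α.den + 1 ≤ α * α.den * q := by
      rw [hv]
      exact_mod_cast h2
    have h4 : 1 ≤ ((α : ℝ) * q - y) * α.den := by linarith
    have h5 : 0 ≤ (α : ℝ) * q - y := by linarith
    nlinarith

/-- Together with `le_ite_admissible` this replaces `ite_admissible_eq_of_den_le` when `p` is not
compared with the denominator of `α`; the two bounds differ by at most one value of `j`. -/
theorem ite_admissible_le {α : ℝ} (h1 : α ≤ 1) {p q : ℕ} (hp : 2 ≤ p) (hq : 1 ≤ q) :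
    (if Admissible α p q then (1 : ℝ) else 0) ≤
      ∑ j ∈ Ico 0 ⌈α * q⌉₊,
        if (p : ZMod q) * (j : ZMod q) = ((-1 : (ZMod q)ˣ) : ZMod q) then 1 else 0 := by
  have := ceil_mul_le h1 q
  have hp0 : (0 : ℝ) < p := by exact_mod_cast (by omega : 0 < p)
  rw [sum_ite_mul_eq _ _ (by omega)]
  by_cases h : Admissible α p q
  · rw [if_pos h, if_pos]
    obtain ⟨y, hy1, hy2⟩ := (admissible_iff_exists_dvd hp hq).1 h
    refine ⟨y, ?_, dvd_one_add_iff.1 hy1⟩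
    rw [mem_Ico, Nat.lt_ceil]
    push_cast at hy2
    refine ⟨Nat.zero_le _, ?_⟩
    nlinarith
  · rw [if_neg h]
    split_ifs <;> norm_num

theorem le_ite_admissible {α : ℝ} (h1 : α ≤ 1) {p q : ℕ} (hp : 2 ≤ p) (hq : 1 ≤ q) :
    (∑ j ∈ Ico 0 (⌈α * q⌉₊ - 1),
        if (p : ZMod q) * (j : ZMod q) = ((-1 : (ZMod q)ˣ) : ZMod q) then (1 : ℝ) else 0) ≤
      if Admissible α p q then (1 : ℝ) else 0 := by
  have := ceil_mul_le h1 q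
  have hp1 : (1 : ℝ) ≤ p := by exact_mod_cast (by omega : 1 ≤ p)
  rw [sum_ite_mul_eq _ _ (by omega)]
  by_cases h : ∃ j ∈ Ico 0 (⌈α * q⌉₊ - 1),
      (p : ZMod q) * (j : ZMod q) = ((-1 : (ZMod q)ˣ) : ZMod q)
  · rw [if_pos h, if_pos]
    obtain ⟨y, hy1, hy2⟩ := h
    rw [admissible_iff_exists_dvd hp hq]
    refine ⟨y, dvd_one_add_iff.2 hy2, ?_⟩
    rw [mem_Ico] at hy1
    have hy3 : y + 1 < ⌈α * q⌉₊ := by omega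
    rw [Nat.lt_ceil] at hy3
    push_cast at hy3 ⊢
    nlinarith
  · rw [if_neg h]
    split_ifs <;> norm_num

theorem coprimeCount_eq_card (α : ℝ) (q : ℕ) :
    coprimeCount α q = #{j ∈ Ico 0 ⌈α * q⌉₊ | j.Coprime q} := by
  rw [coprimeCount, range_eq_Ico]

theorem coprimeCount_le {α : ℝ} (h1 : α ≤ 1) (q : ℕ) : coprimeCount α q ≤ q := by
  rw [coprimeCount_eq_card]
  exact card_coprime_le (by simpa using ceil_mul_le h1 q)

theorem abs_card_sub_coprimeCount_le {α : ℝ} (h0 : 0 ≤ α) {p : ℕ} (hp : 2 ≤ p) :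
    |(#{j ∈ Ico 1 (⌊α * p⌋₊ + 1) | j.Coprime p} : ℝ) - coprimeCount α p| ≤ 1 := by
  have hx : 0 ≤ α * p := by positivity
  have c1 : ⌈α * p⌉₊ ≤ ⌊α * p⌋₊ + 1 := Nat.ceil_le_floor_add_one _
  have c2 : ⌊α * p⌋₊ ≤ ⌈α * p⌉₊ := Nat.floor_le_ceil _
  have i1 : coprimeCount α p ≤ #{j ∈ Ico 1 (⌊α * p⌋₊ + 1) | j.Coprime p} := by
    rw [coprimeCount_eq_card]
    refine card_le_card fun j hj => ?_
    simp only [mem_filter, mem_Ico] at hj ⊢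
    have : j ≠ 0 := by
      rintro rfl
      rw [Nat.coprime_zero_left] at hj
      omega
    exact ⟨⟨by omega, by omega⟩, hj.2⟩
  have i2 : #{j ∈ Ico 1 (⌊α * p⌋₊ + 1) | j.Coprime p} ≤ coprimeCount α p + 1 := by
    rw [coprimeCount_eq_card]
    refine le_trans (card_le_card fun j hj => ?_) (card_insert_le ⌊α * p⌋₊ _)
    simp only [mem_filter, mem_Ico, mem_insert] at hj ⊢
    by_cases h : j = ⌊α * p⌋₊
    · exact Or.inl h
    · exact Or.inr ⟨⟨Nat.zero_le _, by omega⟩, hj.2⟩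
  have i1' : (coprimeCount α p : ℝ) ≤ #{j ∈ Ico 1 (⌊α * p⌋₊ + 1) | j.Coprime p} := by
    exact_mod_cast i1
  have i2' : (#{j ∈ Ico 1 (⌊α * p⌋₊ + 1) | j.Coprime p} : ℝ) ≤ coprimeCount α p + 1 := by
    exact_mod_cast i2
  rw [abs_le]
  constructor <;> linarith

theorem coprimeCount_le_card_add_one (α : ℝ) (q : ℕ) :
    coprimeCount α q ≤ #{j ∈ Ico 0 (⌈α * q⌉₊ - 1) | j.Coprime q} + 1 := by
  rw [coprimeCount_eq_card]
  refine le_trans (card_le_card fun j hj => ?_) (card_insert_le (⌈α * q⌉₊ - 1) _)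
  simp only [mem_filter, mem_Ico, mem_insert] at hj ⊢
  by_cases h : j = ⌈α * q⌉₊ - 1
  · exact Or.inl h
  · exact Or.inr ⟨⟨Nat.zero_le _, by omega⟩, hj.2⟩

/-! ### Counting lattice points and Abel summation -/

theorem count_eq_sum (α : ℚ) (U : ℝ) (c : ℕ → ℕ → ℕ → Prop) :
    (count α U c : ℝ) = ∑ p ∈ Icc 1 ⌊U ^ 2⌋₊, ∑ q ∈ Icc 1 ⌊U ^ 2⌋₊, ∑ n ∈ Icc 1 ⌊U ^ 2⌋₊,
      ∑ k ∈ Icc 1 ⌊U ^ 2⌋₊, if Admissible α p q ∧ c p q n ∧ k < n ∧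
        ((n * q + k * p : ℕ) : ℝ) ≤ U ^ 2 then 1 else 0 := by
  set I := Icc 1 ⌊U ^ 2⌋₊ with hI
  have e : {x : ℕ × ℕ × ℕ × ℕ |
      IsSolution α (U ^ 2) x.1 x.2.1 x.2.2.1 x.2.2.2 ∧ c x.1 x.2.1 x.2.2.1} =
      ((I ×ˢ I ×ˢ I ×ˢ I).filter fun x => Admissible α x.1 x.2.1 ∧ c x.1 x.2.1 x.2.2.1 ∧
        x.2.2.2 < x.2.2.1 ∧ ((x.2.2.1 * x.2.1 + x.2.2.2 * x.1 : ℕ) : ℝ) ≤ U ^ 2 :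
        Finset (ℕ × ℕ × ℕ × ℕ)) := by
    ext ⟨p, q, n, k⟩
    simp only [Set.mem_ofPred_eq, coe_filter, mem_product, hI, mem_Icc, IsSolution, Admissible]
    constructor
    · rintro ⟨⟨h1, h2, h3, h4, h5, h6, h7, h8⟩, h9⟩
      have hB : n * q + k * p ≤ ⌊U ^ 2⌋₊ := Nat.le_floor h5
      have g1 : n ≤ n * q := Nat.le_mul_of_pos_right n h3
      have g2 : q ≤ n * q := Nat.le_mul_of_pos_left q (by omega)
      have g3 : p ≤ k * p := Nat.le_mul_of_pos_left p h6
      exact ⟨⟨⟨by omega, by omega⟩, ⟨by omega, by omega⟩, ⟨by omega, by omega⟩, by omega,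
        by omega⟩, ⟨h1, h2, h8⟩, h9, h7, h5⟩
    · rintro ⟨⟨⟨a1, a2⟩, ⟨a3, a4⟩, ⟨a5, a6⟩, a7, a8⟩, ⟨h1, h2, h8⟩, h9, h7, h5⟩
      have g1 : n ≤ n * q := Nat.le_mul_of_pos_right n a3
      exact ⟨⟨h1, h2, a3, by omega, h5, a7, h7, h8⟩, h9⟩
  rw [count, e, Set.ncard_coe_finset, card_filter, sum_product]
  push_cast
  refine sum_congr rfl fun p _ => ?_
  rw [sum_product]
  refine sum_congr rfl fun q _ => ?_
  rw [sum_product]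

/-- The number of `u ∈ [1, B]` in a half-open real interval with a further property. -/
theorem sum_ite_interval_eq (φ : ℕ → Prop) (B : ℕ) {x y : ℝ} (hx : 0 ≤ x) (hy : ⌊y⌋₊ ≤ B) :
    (∑ u ∈ Icc 1 B, if φ u ∧ x < u ∧ (u : ℝ) ≤ y then (1 : ℝ) else 0) =
      ∑ u ∈ Ioc ⌊x⌋₊ ⌊y⌋₊, if φ u then 1 else 0 := by
  rw [← sum_filter, ← sum_filter]
  refine sum_congr ?_ fun _ _ => rfl
  ext u
  simp only [mem_filter, mem_Icc, mem_Ioc]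
  constructor
  · rintro ⟨⟨h1, h2⟩, h3, h4, h5⟩
    exact ⟨⟨(Nat.floor_lt hx).2 h4, (Nat.le_floor_iff' (by omega)).2 h5⟩, h3⟩
  · rintro ⟨⟨h1, h2⟩, h3⟩
    exact ⟨⟨by omega, by omega⟩, h3, (Nat.floor_lt hx).1 h1, (Nat.le_floor_iff' (by omega)).1 h2⟩

/-- The number of lattice points `(n, k)` with `1 ≤ k < n` and `n q + k p ≤ Q`. -/
noncomputable def triangleCount (Q : ℝ) (p q : ℕ) : ℝ :=
  ∑ n ∈ Icc 1 ⌊Q⌋₊, ∑ k ∈ Icc 1 ⌊Q⌋₊,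
    if k < n ∧ ((n * q + k * p : ℕ) : ℝ) ≤ Q then 1 else 0

/-- The main term is the area of the triangle `0 < k < n`, `n q + k p ≤ Q`. -/
theorem abs_triangleCount_sub_le {Q : ℝ} (hQ : 0 ≤ Q) {p q : ℕ} (hp : 1 ≤ p) (hq : 1 ≤ q) :
    |triangleCount Q p q - Q ^ 2 / 2 * (1 / (q * (p + q)))| ≤ 2 * Q / q := by
  have hp1 : (1 : ℝ) ≤ p := by exact_mod_cast hp
  have hq1 : (1 : ℝ) ≤ q := by exact_mod_cast hq
  have hq0 : (0 : ℝ) < q := by linarith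
  set s : ℝ := p + q with hs
  have hs0 : 0 < s := by linarith
  set K := ⌊Q / s⌋₊ with hK
  have hK1 : (K : ℝ) ≤ Q / s := Nat.floor_le (by positivity)
  have hK2 : Q / s < K + 1 := Nat.lt_floor_add_one _
  rw [le_div_iff₀ hs0] at hK1
  rw [div_lt_iff₀ hs0] at hK2
  have inner : ∀ k ∈ Icc 1 ⌊Q⌋₊, (∑ n ∈ Icc 1 ⌊Q⌋₊,
      if k < n ∧ ((n * q + k * p : ℕ) : ℝ) ≤ Q then (1 : ℝ) else 0) =
      if k ≤ K then (⌊(Q - k * p) / q⌋₊ : ℝ) - k else 0 := by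
    intro k hk
    have hk1 : (1 : ℝ) ≤ k := by exact_mod_cast (mem_Icc.1 hk).1
    have h1 : ⌊(Q - k * p) / q⌋₊ ≤ ⌊Q⌋₊ := by
      refine Nat.floor_mono ?_
      rw [div_le_iff₀ hq0]
      nlinarith
    have h2 := sum_ite_interval_eq (fun _ => True) ⌊Q⌋₊ (x := k) (y := (Q - k * p) / q)
      (by linarith) h1
    simp only [true_and, if_true, sum_const, Nat.card_Ioc, Nat.floor_natCast, nsmul_eq_mul,
      mul_one] at h2
    have h3 : (∑ n ∈ Icc 1 ⌊Q⌋₊, if k < n ∧ ((n * q + k * p : ℕ) : ℝ) ≤ Q then (1 : ℝ) else 0) =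
        ((⌊(Q - k * p) / q⌋₊ - k : ℕ) : ℝ) := by
      rw [← h2]
      refine sum_congr rfl fun n _ => ?_
      congr 1
      rw [le_div_iff₀ hq0, Nat.cast_lt, eq_iff_iff]
      push_cast
      refine and_congr_right fun _ => ⟨fun h => by linarith, fun h => by linarith⟩
    rw [h3]
    split_ifs with hkK
    · rw [Nat.cast_sub]
      refine Nat.le_floor ?_
      have : (k : ℝ) ≤ K := by exact_mod_cast hkK
      rw [le_div_iff₀ hq0]
      nlinarith
    · have : (K : ℝ) + 1 ≤ k := by exact_mod_cast not_le.1 hkK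
      rw [Nat.sub_eq_zero_of_le, Nat.cast_zero]
      have : (Q - k * p) / q < k := by
        rw [div_lt_iff₀ hq0]; nlinarith
      exact Nat.floor_le_of_le this.le
  have hKQ : K ≤ ⌊Q⌋₊ := by
    refine Nat.floor_mono ?_
    rw [div_le_iff₀ hs0]; nlinarith
  have e1 : triangleCount Q p q = ∑ k ∈ Icc 1 K, ((⌊(Q - k * p) / q⌋₊ : ℝ) - k) := by
    rw [triangleCount, sum_comm, sum_congr rfl inner, ← sum_filter]
    refine sum_congr ?_ fun _ _ => rfl
    ext k
    simp only [mem_filter, mem_Icc]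
    omega
  have e2 : |triangleCount Q p q - ∑ k ∈ Icc 1 K, ((Q - k * s) / q)| ≤ K := by
    rw [e1, ← sum_sub_distrib]
    refine (abs_sum_le_sum_abs _ _).trans ?_
    rw [← sum_Icc_one_real K]
    refine sum_le_sum fun k hk => ?_
    have hkK : (k : ℝ) ≤ K := by exact_mod_cast (mem_Icc.1 hk).2
    have hnn : 0 ≤ (Q - k * p) / q := div_nonneg (by nlinarith) hq0.le
    have f1 := Nat.floor_le hnn
    have f2 := Nat.lt_floor_add_one ((Q - k * p) / q)
    have : (Q - k * s) / q = (Q - k * p) / q - k := by rw [hs]; field_simp; ring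
    rw [this, abs_le]
    constructor <;> linarith
  have e3 : ∑ k ∈ Icc 1 K, ((Q - k * s) / q) = (K * Q - s * (K * (K + 1) / 2)) / q := by
    rw [← sum_div, ← sum_Icc_natCast, sum_sub_distrib, mul_sum]
    simp [mul_comm]
  have e4 : |(K * Q - s * (K * (K + 1) / 2)) / q - Q ^ 2 / 2 * (1 / (q * s))| ≤ Q / q := by
    have : (K * Q - s * (K * (K + 1) / 2)) / q - Q ^ 2 / 2 * (1 / (q * s)) =
        -((Q - K * s) ^ 2 / s + K * s) / 2 / q := by field_simp; ring
    rw [this, abs_div, abs_of_pos hq0]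
    gcongr
    rw [abs_div, abs_neg, abs_two, div_le_iff₀ two_pos,
      abs_of_nonneg (by positivity)]
    have : (Q - K * s) ^ 2 / s ≤ Q := by
      rw [div_le_iff₀ hs0, sq]
      have hKs : 0 ≤ K * s := by positivity
      exact mul_le_mul (by linarith) (by linarith) (by linarith) hQ
    linarith
  have e5 : (K : ℝ) ≤ Q / q := by
    rw [le_div_iff₀ hq0]
    nlinarith [Nat.cast_nonneg (α := ℝ) K]
  rw [e3] at e2
  calc _ = |(triangleCount Q p q - (K * Q - s * (K * (K + 1) / 2)) / q) +
        ((K * Q - s * (K * (K + 1) / 2)) / q - Q ^ 2 / 2 * (1 / (q * s)))| := by congr 1; ring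
    _ ≤ Q / q + Q / q := (abs_add_le _ _).trans (add_le_add (e2.trans e5) e4)
    _ = _ := by ring

/-- Abel summation against a nonnegative antitone weight. -/
theorem abs_sum_mul_antitone_le {c f : ℕ → ℝ} {a : ℕ} {D : ℝ}
    (hf : ∀ i, a < i → f (i + 1) ≤ f i) (hf0 : ∀ i, a < i → 0 ≤ f i)
    (hc : ∀ t, |∑ i ∈ Ioc a t, c i| ≤ D) (b : ℕ) :
    |∑ i ∈ Ioc a b, c i * f i| ≤ D * f (a + 1) := by
  have hD : 0 ≤ D := (abs_nonneg _).trans (hc 0)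
  rcases le_total b a with hab | hab
  · rw [Ioc_eq_empty_of_le hab, sum_empty, abs_zero]
    exact mul_nonneg hD (hf0 _ (by omega))
  have key : |∑ i ∈ Ioc a b, c i * f i - (∑ i ∈ Ioc a b, c i) * f (b + 1)| ≤
      D * (f (a + 1) - f (b + 1)) := by
    induction b, hab using Nat.le_induction with
    | base => simp
    | succ b hab ih =>
      rw [sum_Ioc_succ_top hab]
      have hb := hc (b + 1)
      have e : ∑ i ∈ Ioc a b, c i * f i + c (b + 1) * f (b + 1) -
          (∑ i ∈ Ioc a (b + 1), c i) * f (b + 1 + 1) =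
          (∑ i ∈ Ioc a b, c i * f i - (∑ i ∈ Ioc a b, c i) * f (b + 1)) +
          (∑ i ∈ Ioc a (b + 1), c i) * (f (b + 1) - f (b + 1 + 1)) := by
        rw [sum_Ioc_succ_top hab]; ring
      rw [e]
      refine (abs_add_le _ _).trans ?_
      rw [abs_mul, abs_of_nonneg (sub_nonneg.2 (hf (b + 1) (by omega)))]
      have := mul_le_mul_of_nonneg_right hb (sub_nonneg.2 (hf (b + 1) (by omega)))
      linarith
  have h1 := hf0 (b + 1) (by omega)
  calc _ = |(∑ i ∈ Ioc a b, c i * f i - (∑ i ∈ Ioc a b, c i) * f (b + 1)) +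
        (∑ i ∈ Ioc a b, c i) * f (b + 1)| := by congr 1; ring
    _ ≤ D * (f (a + 1) - f (b + 1)) + D * f (b + 1) := by
        refine (abs_add_le _ _).trans (add_le_add key ?_)
        rw [abs_mul, abs_of_nonneg h1]
        gcongr
        exact hc b
    _ = _ := by ring

/-- Equidistribution of modular inverses, weighted by an antitone function. -/
theorem exists_abs_weighted_sum_le :
    ∃ C : ℝ, 1 ≤ C ∧ ∀ (m : ℕ) (ε : (ZMod m)ˣ) (a b s t : ℕ) (f : ℕ → ℝ), 1 ≤ m →
      t ≤ s + m → (∀ i, a < i → f (i + 1) ≤ f i) → (∀ i, a < i → 0 ≤ f i) →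
      |∑ u ∈ Ioc a b, ((∑ j ∈ Ico s t, if (u : ZMod m) * (j : ZMod m) = ε then (1 : ℝ) else 0)
        - (#{j ∈ Ico s t | j.Coprime m} : ℝ) / m) * f u| ≤
        C * (m : ℝ) ^ (9 / 10 : ℝ) * f (a + 1) := by
  obtain ⟨C, hC1, hC⟩ := exists_abs_congruenceCount_sub_le
  refine ⟨C, hC1, fun m ε a b s t f hm hst hf hf0 => ?_⟩
  refine abs_sum_mul_antitone_le hf hf0 (fun r => ?_) b
  have h := hC m ε a r s t hm (Nat.cast_nonneg a) hst
  rw [congruenceCount, Nat.floor_natCast, Nat.floor_natCast] at h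
  rw [sum_sub_distrib, sum_const, Nat.card_Ioc, nsmul_eq_mul]
  have e : ((r - a : ℕ) : ℝ) = max ((r : ℝ) - a) 0 := by
    rcases le_total a r with h | h
    · have : (a : ℝ) ≤ r := by exact_mod_cast h
      rw [Nat.cast_sub h, max_eq_left (by linarith)]
    · have : (r : ℝ) ≤ a := by exact_mod_cast h
      rw [Nat.sub_eq_zero_of_le h, max_eq_right (by linarith), Nat.cast_zero]
  rw [e, mul_div_assoc', mul_div_right_comm]
  exact h

/-! ### The range `p ≤ q ≤ U` -/

theorem count_eq_sum_triangleCount (α : ℚ) (U : ℝ) (c : ℕ → ℕ → Prop) :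
    (count α U (fun p q _ => c p q) : ℝ) = ∑ p ∈ Icc 1 ⌊U ^ 2⌋₊, ∑ q ∈ Icc 1 ⌊U ^ 2⌋₊,
      if Admissible α p q ∧ c p q then triangleCount (U ^ 2) p q else 0 := by
  rw [count_eq_sum]
  refine sum_congr rfl fun p _ => sum_congr rfl fun q _ => ?_
  split_ifs with h
  · rw [triangleCount]
    refine sum_congr rfl fun n _ => sum_congr rfl fun k _ => ?_
    congr 1
    simp only [h.1, h.2, true_and]
  · refine sum_eq_zero fun n _ => sum_eq_zero fun k _ => if_neg fun h' => h ⟨h'.1, h'.2.1⟩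

theorem sum_Ioc_one_div {a b : ℕ} (hab : a ≤ b) :
    ∑ q ∈ Ioc a b, (1 : ℝ) / q = (∑ q ∈ Icc 1 b, (1 : ℝ) / q) - ∑ q ∈ Icc 1 a, (1 : ℝ) / q := by
  induction b, hab using Nat.le_induction with
  | base => simp
  | succ b hab ih => rw [sum_Ioc_succ_top hab, sum_Icc_succ_top (by omega), ih]; ring

theorem sum_Ioc_one_div_add_eq (a b : ℕ) :
    ∑ q ∈ Ioc a b, (1 : ℝ) / ((q : ℝ) + a) = ∑ r ∈ Ioc (a + a) (b + a), (1 : ℝ) / r := by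
  rw [← map_add_right_Ioc a b a, sum_map]
  simp

theorem abs_sum_Ioc_one_div_sub_le {a b : ℕ} (ha : 1 ≤ a) (hab : a ≤ b) :
    |(∑ q ∈ Ioc a b, (1 : ℝ) / q) - (Real.log b - Real.log a)| ≤ 2 / a := by
  rw [sum_Ioc_one_div hab]
  have h1 := abs_harmonic_sub_le ha
  have h2 := abs_harmonic_sub_le (ha.trans hab)
  have ha' : (1 : ℝ) ≤ a := by exact_mod_cast ha
  have hab' : (a : ℝ) ≤ b := by exact_mod_cast hab
  have h3 : 1 / (b : ℝ) ≤ 1 / a := by gcongr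
  have h4 : (2 : ℝ) / a = 1 / a + 1 / a := by ring
  rw [h4]
  rw [abs_le] at h1 h2 ⊢
  constructor <;> linarith

theorem abs_sum_Ioc_one_div_add_sub_le {a b : ℕ} (ha : 1 ≤ a) (hab : a ≤ b) :
    |(∑ q ∈ Ioc a b, (1 : ℝ) / ((q : ℝ) + a)) - (Real.log b - Real.log a - Real.log 2)|
      ≤ 1 / a + a / b := by
  have ha' : (1 : ℝ) ≤ a := by exact_mod_cast ha
  have hab' : (a : ℝ) ≤ b := by exact_mod_cast hab
  rw [sum_Ioc_one_div_add_eq]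
  have h := abs_sum_Ioc_one_div_sub_le (a := a + a) (b := b + a) (by omega) (by omega)
  push_cast at h
  have e1 : Real.log ((a : ℝ) + a) = Real.log 2 + Real.log a := by
    rw [← Real.log_mul (by norm_num) (by linarith)]; ring_nf
  have e2 : 0 ≤ Real.log ((b : ℝ) + a) - Real.log b := by
    have := Real.log_le_log (show 0 < (b : ℝ) by linarith) (show (b : ℝ) ≤ b + a by linarith)
    linarith
  have e3 : Real.log ((b : ℝ) + a) - Real.log b ≤ a / b := by
    rw [← Real.log_div (by linarith) (by linarith)]
    refine (Real.log_le_sub_one_of_pos (div_pos (by linarith) (by linarith))).trans (le_of_eq ?_)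
    have : (b : ℝ) ≠ 0 := by linarith
    field_simp
    ring
  have e4 : (2 : ℝ) / (a + a) = 1 / a := by
    have : (a : ℝ) ≠ 0 := by linarith
    field_simp
    ring
  rw [e1, e4] at h
  rw [abs_le] at h ⊢
  constructor <;> linarith

theorem abs_sum_Ioc_one_div_mul_sub_le {a b : ℕ} (ha : 1 ≤ a) (hab : a ≤ b) :
    |a * (∑ q ∈ Ioc a b, (1 : ℝ) / ((q : ℝ) * (a + q))) - Real.log 2| ≤ 3 / a + a / b := by
  have ha' : (1 : ℝ) ≤ a := by exact_mod_cast ha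
  have e : a * (∑ q ∈ Ioc a b, (1 : ℝ) / ((q : ℝ) * (a + q))) =
      (∑ q ∈ Ioc a b, (1 : ℝ) / q) - ∑ q ∈ Ioc a b, (1 : ℝ) / ((q : ℝ) + a) := by
    rw [mul_sum, ← sum_sub_distrib]
    refine sum_congr rfl fun q hq => ?_
    have : (0 : ℝ) < q := by exact_mod_cast (by have := (mem_Ioc.1 hq).1; omega : 0 < q)
    field_simp
    ring
  rw [e]
  have h1 := abs_sum_Ioc_one_div_sub_le ha hab
  have h2 := abs_sum_Ioc_one_div_add_sub_le ha hab
  have h3 : (3 : ℝ) / a = 2 / a + 1 / a := by ring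
  rw [h3]
  rw [abs_le] at h1 h2 ⊢
  constructor <;> linarith

theorem sum_Icc_floor_one_div_le {U : ℝ} (hU : 1 ≤ U) :
    ∑ q ∈ Icc 1 ⌊U⌋₊, (1 : ℝ) / q ≤ 1 + Real.log U := by
  have := harmonic_floor_le_one_add_log U hU
  rw [harmonic_eq_sum_Icc] at this
  push_cast at this
  simpa using this

theorem abs_log_floor_sub_log_le {U : ℝ} (hU : 1 ≤ U) :
    |Real.log ⌊U⌋₊ - Real.log U| ≤ 2 / U := by
  obtain ⟨-, -, -, f1⟩ := natFloor_bounds hU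
  obtain ⟨f2, f3⟩ := log_sub_log_floor hU
  rw [abs_le]
  constructor <;> linarith

theorem abs_sum_one_div_sub_log_le {U : ℝ} (hU : 1 ≤ U) :
    |(∑ q ∈ Icc 1 ⌊U⌋₊, (1 : ℝ) / q) - Real.log U| ≤ 3 := by
  have h := abs_harmonic_floor_sub_le hU
  have g1 := Real.eulerMascheroniConstant_lt_two_thirds
  have g2 := Real.one_half_lt_eulerMascheroniConstant
  have : 2 / U ≤ 2 := div_le_self (by norm_num) hU
  rw [abs_le] at h ⊢
  constructor <;> linarith

theorem one_add_log_le {U : ℝ} (hU : 1 ≤ U) : 1 + Real.log U ≤ U := by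
  have := Real.log_le_sub_one_of_pos (show 0 < U by linarith)
  linarith

theorem floor_le_floor_sq {U : ℝ} (hU : 1 ≤ U) : ⌊U⌋₊ ≤ ⌊U ^ 2⌋₊ :=
  Nat.floor_mono (by nlinarith)

/-- The sum of the series `∑ d ^ (-11 / 10)`. -/
noncomputable def zetaElevenTenths : ℝ := ∑' d : ℕ, ((d : ℝ) ^ (11 / 10 : ℝ))⁻¹

theorem sum_rpow_div_sq_le (s : Finset ℕ) :
    ∑ m ∈ s, (m : ℝ) ^ (9 / 10 : ℝ) / (m : ℝ) ^ 2 ≤ zetaElevenTenths := by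
  have h : HasSum (fun d : ℕ => ((d : ℝ) ^ (11 / 10 : ℝ))⁻¹) zetaElevenTenths :=
    (Real.summable_nat_rpow_inv.2 (by norm_num)).hasSum
  refine le_trans (le_of_eq (sum_congr rfl fun m _ => ?_))
    (sum_le_hasSum s (fun _ _ => by positivity) h)
  rcases Nat.eq_zero_or_pos m with rfl | hm
  · rw [Nat.cast_zero, Real.zero_rpow (by norm_num), Real.zero_rpow (by norm_num)]; simp
  have hm0 : (0 : ℝ) < m := by exact_mod_cast hm
  rw [← Real.rpow_natCast (m : ℝ) 2, ← Real.rpow_sub hm0, ← Real.rpow_neg hm0.le]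
  norm_num

theorem zetaElevenTenths_nonneg : 0 ≤ zetaElevenTenths := tsum_nonneg fun _ => by positivity

theorem one_le_rpow_natCast {m : ℕ} (hm : 1 ≤ m) : 1 ≤ (m : ℝ) ^ (9 / 10 : ℝ) :=
  Real.one_le_rpow (by exact_mod_cast hm) (by norm_num)

theorem R1_eq_sum (α : ℚ) {U : ℝ} (hU : 1 ≤ U) :
    (R1 α U : ℝ) = ∑ p ∈ Icc 1 ⌊U⌋₊, ∑ q ∈ Ioc p ⌊U⌋₊,
      (if Admissible α p q then 1 else 0) * triangleCount (U ^ 2) p q := by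
  rw [R1, count_eq_sum_triangleCount]
  have hB := floor_le_floor_sq hU
  have inner : ∀ p ∈ Icc 1 ⌊U ^ 2⌋₊, (∑ q ∈ Icc 1 ⌊U ^ 2⌋₊,
      if Admissible α p q ∧ p ≤ q ∧ (q : ℝ) ≤ U then triangleCount (U ^ 2) p q else 0) =
      ∑ q ∈ Ioc p ⌊U⌋₊, (if Admissible α p q then 1 else 0) * triangleCount (U ^ 2) p q := by
    intro p hp
    simp only [ite_mul, one_mul, zero_mul]
    rw [← sum_filter, ← sum_filter]
    refine sum_congr ?_ fun _ _ => rfl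
    ext q
    simp only [mem_filter, mem_Icc, mem_Ioc]
    constructor
    · rintro ⟨⟨h1, h2⟩, h3, h4, h5⟩
      refine ⟨⟨lt_of_le_of_ne h4 ?_, (Nat.le_floor_iff' (by omega)).2 h5⟩, h3⟩
      rintro rfl
      have := h3.1
      rw [Nat.coprime_self] at this
      have := h3.2.1
      omega
    · rintro ⟨⟨h1, h2⟩, h3⟩
      exact ⟨⟨by omega, by omega⟩, h3, h1.le, (Nat.le_floor_iff' (by omega)).1 h2⟩
  refine Eq.trans (sum_congr rfl fun p _ => sum_congr rfl fun q _ => ?_)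
    ((sum_congr rfl inner).trans ?_)
  · congr
  refine (sum_subset (Icc_subset_Icc_right hB) fun p hp hp' => ?_).symm
  rw [Ioc_eq_empty_of_le, sum_empty]
  simp only [mem_Icc] at hp hp'
  omega

/-- The equidistribution input for `R1`: for fixed `p`, the condition on the inverse selects the
expected proportion of the `q ∈ (p, b]`. -/
theorem exists_abs_sum_admissible_fixed_p_sub_le :
    ∃ C : ℝ, 0 ≤ C ∧ ∀ (α : ℝ) (p b : ℕ), 0 ≤ α → α ≤ 1 → 1 ≤ p → p ≤ b →
      |(∑ q ∈ Ioc p b, (if Admissible α p q then (1 : ℝ) else 0) * (1 / ((q : ℝ) * (p + q)))) -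
        coprimeCount α p / p * (∑ q ∈ Ioc p b, 1 / ((q : ℝ) * (p + q)))| ≤
        C * ((p : ℝ) ^ (9 / 10 : ℝ) / (p : ℝ) ^ 2) := by
  obtain ⟨C, hC1, hC⟩ := exists_abs_weighted_sum_le
  refine ⟨C + 5, by linarith, fun α p b h0 h1 hp hpb => ?_⟩
  have hp1 : (1 : ℝ) ≤ p := by exact_mod_cast hp
  have hpb' : (p : ℝ) ≤ b := by exact_mod_cast hpb
  have hpp := one_le_rpow_natCast hp
  set w : ℕ → ℝ := fun q => 1 / ((q : ℝ) * (p + q)) with hw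
  set S := ∑ q ∈ Ioc p b, w q with hS
  have hS0 : 0 ≤ S := sum_nonneg fun q _ => by positivity
  have hS1 : p * S ≤ 5 := by
    have h := abs_sum_Ioc_one_div_mul_sub_le hp hpb
    have l2 : Real.log 2 ≤ 1 := by linarith [Real.log_two_lt_d9]
    have i1 : 3 / (p : ℝ) ≤ 3 := div_le_self (by norm_num) hp1
    have i2 : (p : ℝ) / b ≤ 1 := div_le_one_of_le₀ hpb' (by linarith)
    have := (abs_le.1 h).2
    linarith
  have hS2 : S / p ≤ 5 / (p : ℝ) ^ 2 := by
    rw [div_le_div_iff₀ (by linarith) (by positivity)]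
    nlinarith
  have hfin : 5 / (p : ℝ) ^ 2 ≤ 5 * ((p : ℝ) ^ (9 / 10 : ℝ) / (p : ℝ) ^ 2) := by
    rw [mul_div_assoc']
    gcongr
    linarith
  rcases Nat.lt_or_ge p 2 with h2 | h2
  · have e : ∀ q, (if Admissible α p q then (1 : ℝ) else 0) = 0 := fun q =>
      if_neg fun h => by have := h.2.1; omega
    simp only [e, zero_mul, sum_const_zero, zero_sub, abs_neg]
    have hp' : p = 1 := by omega
    have hc : (coprimeCount α p : ℝ) ≤ p := by exact_mod_cast coprimeCount_le h1 p
    rw [abs_of_nonneg (by positivity)]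
    subst hp'
    simp only [Nat.cast_one, one_mul, div_one, Real.one_rpow, one_pow, mul_one] at hc hS1 ⊢
    nlinarith
  · have hc := hC p 1 p b 1 (⌊α * p⌋₊ + 1) w hp (by
        have : ⌊α * p⌋₊ ≤ p :=
          Nat.floor_le_of_le (mul_le_of_le_one_left (Nat.cast_nonneg p) h1)
        omega) (fun i hi => by
        have hi0 : (0 : ℝ) < i := by exact_mod_cast (by omega : 0 < i)
        simp only [hw]
        push_cast
        gcongr <;> linarith) (fun i _ => by positivity)
    simp only [← ite_admissible_eq_inv h1 h2] at hc
    set c : ℝ := ((#{j ∈ Ico 1 (⌊α * p⌋₊ + 1) | j.Coprime p} : ℕ) : ℝ) with hcdef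
    have hcc : |c - coprimeCount α p| ≤ 1 := abs_card_sub_coprimeCount_le h0 h2
    have hw1 : w (p + 1) ≤ 1 / (p : ℝ) ^ 2 := by
      simp only [hw]
      push_cast
      gcongr
      nlinarith
    have e1 : ∑ q ∈ Ioc p b, ((if Admissible α p q then (1 : ℝ) else 0) - c / p) * w q =
        (∑ q ∈ Ioc p b, (if Admissible α p q then (1 : ℝ) else 0) * w q) - c / p * S := by
      rw [hS, mul_sum, ← sum_sub_distrib]
      exact sum_congr rfl fun _ _ => sub_mul _ _ _
    rw [e1] at hc
    calc _ = |((∑ q ∈ Ioc p b, (if Admissible α p q then (1 : ℝ) else 0) * w q) - c / p * S) +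
          (c - coprimeCount α p) * (S / p)| := by congr 1; ring
      _ ≤ C * (p : ℝ) ^ (9 / 10 : ℝ) * (1 / (p : ℝ) ^ 2) + 1 * (5 / (p : ℝ) ^ 2) := by
          refine (abs_add_le _ _).trans (add_le_add (hc.trans ?_) ?_)
          · gcongr
          · rw [abs_mul, abs_of_nonneg (by positivity : 0 ≤ S / p)]
            gcongr
      _ ≤ _ := by
          rw [add_mul]
          refine add_le_add (le_of_eq (by ring)) (by rw [one_mul]; exact hfin)

theorem sum_one_div_sq_le (s : Finset ℕ) : ∑ m ∈ s, 1 / (m : ℝ) ^ 2 ≤ zetaThreeHalves :=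
  (sum_le_sum fun m _ => inv_sq_le_inv_rpow m).trans (sum_zetaThreeHalves_le s)

/-- Replacing the number of lattice points in a triangle by its area costs `O(U ^ 4)`. -/
theorem abs_sum_triangleCount_sub_le {U : ℝ} (hU : 1 ≤ U) (P : ℕ → ℕ → Prop) (s : Finset (ℕ × ℕ))
    (hs : s ⊆ Icc 1 ⌊U⌋₊ ×ˢ Icc 1 ⌊U⌋₊) :
    |(∑ x ∈ s, (if P x.1 x.2 then (1 : ℝ) else 0) * triangleCount (U ^ 2) x.1 x.2) -
      U ^ 4 / 2 * ∑ x ∈ s, (if P x.1 x.2 then (1 : ℝ) else 0) *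
        (1 / ((x.2 : ℝ) * (x.1 + x.2)))| ≤ 2 * U ^ 4 := by
  rw [mul_sum, ← sum_sub_distrib]
  refine (abs_sum_le_sum_abs _ _).trans ?_
  calc _ ≤ ∑ x ∈ s, 2 * U ^ 2 * (1 / (x.2 : ℝ)) := by
        refine sum_le_sum fun x hx => ?_
        have hx' := hs hx
        simp only [mem_product, mem_Icc] at hx'
        have h := abs_triangleCount_sub_le (sq_nonneg U) hx'.1.1 hx'.2.1
        rw [show (U ^ 2) ^ 2 = U ^ 4 by ring] at h
        split_ifs
        · rw [one_mul, one_mul]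
          exact h.trans (le_of_eq (by ring))
        · simp only [zero_mul, mul_zero, sub_zero, abs_zero]; positivity
    _ ≤ ∑ x ∈ Icc 1 ⌊U⌋₊ ×ˢ Icc 1 ⌊U⌋₊, 2 * U ^ 2 * (1 / (x.2 : ℝ)) :=
        sum_le_sum_of_subset_of_nonneg hs fun _ _ _ => by positivity
    _ = 2 * U ^ 2 * (⌊U⌋₊ * ∑ q ∈ Icc 1 ⌊U⌋₊, 1 / (q : ℝ)) := by
        rw [← mul_sum, sum_product]
        dsimp only
        rw [sum_const, nsmul_eq_mul, Nat.card_Icc, Nat.add_sub_cancel]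
    _ ≤ 2 * U ^ 2 * (U * U) := by
        have h1 := Nat.floor_le (show 0 ≤ U by linarith)
        have h2 := (sum_Icc_floor_one_div_le hU).trans (one_add_log_le hU)
        have h3 : 0 ≤ ∑ q ∈ Icc 1 ⌊U⌋₊, 1 / (q : ℝ) := sum_nonneg fun _ _ => by positivity
        gcongr
    _ = _ := by ring

theorem exists_abs_R1_sub_le :
    ∃ C : ℝ, 0 ≤ C ∧ ∀ (α : ℚ) (U : ℝ), 0 < α → α ≤ 1 → 1 ≤ U →
      |(R1 α U : ℝ) - (α : ℝ) * Real.log 2 / (2 * zetaTwo) * U ^ 4 * Real.log U| ≤ C * U ^ 4 := by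
  obtain ⟨C₁, hC₁, h₁⟩ := exists_abs_sum_admissible_fixed_p_sub_le
  obtain ⟨C₂, hC₂, h₂⟩ := exists_abs_sum_coprimeCount_sub_le
  have hZ := zetaThreeHalves_nonneg
  have hZ' := zetaElevenTenths_nonneg
  refine ⟨2 + 1 / 2 * (C₁ * zetaElevenTenths + (3 * zetaThreeHalves + 1) + C₂), by positivity,
    fun α U hα0 hα1 hU => ?_⟩
  have h0 : (0 : ℝ) ≤ α := by exact_mod_cast hα0.le
  have h1 : (α : ℝ) ≤ 1 := by exact_mod_cast hα1
  set N := ⌊U⌋₊ with hN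
  have hN1 : 1 ≤ N := Nat.floor_pos.2 hU
  have hN1' : (1 : ℝ) ≤ N := by exact_mod_cast hN1
  set W := ∑ p ∈ Icc 1 N, ∑ q ∈ Ioc p N,
    (if Admissible α p q then (1 : ℝ) else 0) * (1 / ((q : ℝ) * (p + q))) with hW
  have s1 : |(R1 α U : ℝ) - U ^ 4 / 2 * W| ≤ 2 * U ^ 4 := by
    have hs : ((Icc 1 N ×ˢ Icc 1 N).filter fun x => x.1 < x.2) ⊆ Icc 1 N ×ˢ Icc 1 N :=
      filter_subset _ _
    have h := abs_sum_triangleCount_sub_le hU (Admissible α) _ hs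
    have conv : ∀ g : ℕ → ℕ → ℝ, ∑ x ∈ ((Icc 1 N ×ˢ Icc 1 N).filter fun x => x.1 < x.2),
        g x.1 x.2 = ∑ p ∈ Icc 1 N, ∑ q ∈ Ioc p N, g p q := by
      intro g
      rw [sum_filter, sum_product]
      refine sum_congr rfl fun p hp => ?_
      rw [← sum_filter]
      refine sum_congr ?_ fun _ _ => rfl
      ext q
      simp only [mem_filter, mem_Icc, mem_Ioc] at hp ⊢
      omega
    rw [conv fun p q => (if Admissible α p q then (1 : ℝ) else 0) * triangleCount (U ^ 2) p q,
      conv fun p q => (if Admissible α p q then (1 : ℝ) else 0) * (1 / ((q : ℝ) * (p + q))),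
      ← R1_eq_sum α hU] at h
    exact h
  have s2 : |W - ∑ p ∈ Icc 1 N, (coprimeCount α p : ℝ) / p *
      (∑ q ∈ Ioc p N, 1 / ((q : ℝ) * (p + q)))| ≤ C₁ * zetaElevenTenths := by
    rw [hW, ← sum_sub_distrib]
    refine (abs_sum_le_sum_abs _ _).trans ?_
    refine (sum_le_sum fun p hp => h₁ α p N h0 h1 (mem_Icc.1 hp).1 (mem_Icc.1 hp).2).trans ?_
    rw [← mul_sum]
    gcongr
    exact sum_rpow_div_sq_le _
  have s3 : |(∑ p ∈ Icc 1 N, (coprimeCount α p : ℝ) / p *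
      (∑ q ∈ Ioc p N, 1 / ((q : ℝ) * (p + q)))) -
      Real.log 2 * ∑ p ∈ Icc 1 N, (coprimeCount α p : ℝ) / (p : ℝ) ^ 2| ≤
      3 * zetaThreeHalves + 1 := by
    rw [mul_sum, ← sum_sub_distrib]
    refine (abs_sum_le_sum_abs _ _).trans ?_
    calc _ ≤ ∑ p ∈ Icc 1 N, (3 * (1 / (p : ℝ) ^ 2) + 1 / N) := by
          refine sum_le_sum fun p hp => ?_
          rw [mem_Icc] at hp
          have hp1 : (1 : ℝ) ≤ p := by exact_mod_cast hp.1
          have hc : (coprimeCount α p : ℝ) ≤ p := by exact_mod_cast coprimeCount_le h1 p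
          have hh := abs_sum_Ioc_one_div_mul_sub_le hp.1 hp.2
          rw [show (coprimeCount α p : ℝ) / p * (∑ q ∈ Ioc p N, 1 / ((q : ℝ) * (p + q))) -
            Real.log 2 * ((coprimeCount α p : ℝ) / (p : ℝ) ^ 2) =
            ((coprimeCount α p : ℝ) / p) * (1 / p) *
              (p * (∑ q ∈ Ioc p N, 1 / ((q : ℝ) * (p + q))) - Real.log 2) by field_simp,
            abs_mul, abs_of_nonneg (by positivity)]
          calc _ ≤ 1 * (1 / p) * (3 / p + (p : ℝ) / N) := by
                gcongr
                exact div_le_one_of_le₀ hc (by linarith)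
            _ = _ := by field_simp
      _ ≤ _ := by
          rw [sum_add_distrib, ← mul_sum, sum_const, Nat.card_Icc, nsmul_eq_mul,
            Nat.add_sub_cancel, mul_one_div_cancel (by linarith)]
          gcongr
          exact sum_one_div_sq_le _
  have s4 := h₂ α U h0 h1 hU
  set T := ∑ p ∈ Icc 1 N, (coprimeCount α p : ℝ) / (p : ℝ) ^ 2
  set V := ∑ p ∈ Icc 1 N, (coprimeCount α p : ℝ) / p * (∑ q ∈ Ioc p N, 1 / ((q : ℝ) * (p + q)))
  have l2 : Real.log 2 ≤ 1 := by linarith [Real.log_two_lt_d9]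
  have l0 : 0 ≤ Real.log 2 := Real.log_nonneg (by norm_num)
  have s5 : |W - Real.log 2 * (α / zetaTwo * Real.log U)| ≤
      C₁ * zetaElevenTenths + (3 * zetaThreeHalves + 1) + C₂ := by
    calc _ = |(W - V) + (V - Real.log 2 * T) +
          Real.log 2 * (T - α / zetaTwo * Real.log U)| := by congr 1; ring
      _ ≤ |W - V| + |V - Real.log 2 * T| + |Real.log 2 * (T - α / zetaTwo * Real.log U)| :=
          abs_add_three _ _ _
      _ ≤ _ := by
          rw [abs_mul, abs_of_nonneg l0]
          gcongr
          calc _ ≤ 1 * C₂ := by gcongr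
            _ = C₂ := one_mul _
  have hU4 : 0 ≤ U ^ 4 := by positivity
  have hz := zetaTwo_pos.ne'
  calc _ = |((R1 α U : ℝ) - U ^ 4 / 2 * W) +
        U ^ 4 / 2 * (W - Real.log 2 * (α / zetaTwo * Real.log U))| := by
        congr 1
        field_simp
        ring
    _ ≤ 2 * U ^ 4 + U ^ 4 / 2 * (C₁ * zetaElevenTenths + (3 * zetaThreeHalves + 1) + C₂) := by
        refine (abs_add_le _ _).trans (add_le_add s1 ?_)
        rw [abs_mul, abs_of_nonneg (by positivity)]
        gcongr
    _ = _ := by ring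

/-! ### The range `q < p ≤ U` -/

theorem R3_eq_sum (α : ℚ) {U : ℝ} (hU : 1 ≤ U) :
    (R3 α U : ℝ) = ∑ q ∈ Icc 1 ⌊U⌋₊, ∑ p ∈ Ioc q ⌊U⌋₊,
      (if Admissible α p q then 1 else 0) * triangleCount (U ^ 2) p q := by
  rw [R3, count_eq_sum_triangleCount, sum_comm]
  have hB := floor_le_floor_sq hU
  have inner : ∀ q ∈ Icc 1 ⌊U ^ 2⌋₊, (∑ p ∈ Icc 1 ⌊U ^ 2⌋₊,
      if Admissible α p q ∧ q < p ∧ (p : ℝ) ≤ U then triangleCount (U ^ 2) p q else 0) =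
      ∑ p ∈ Ioc q ⌊U⌋₊, (if Admissible α p q then 1 else 0) * triangleCount (U ^ 2) p q := by
    intro q hq
    simp only [ite_mul, one_mul, zero_mul]
    rw [← sum_filter, ← sum_filter]
    refine sum_congr ?_ fun _ _ => rfl
    ext p
    simp only [mem_filter, mem_Icc, mem_Ioc]
    constructor
    · rintro ⟨⟨h1, h2⟩, h3, h4, h5⟩
      exact ⟨⟨h4, (Nat.le_floor_iff' (by omega)).2 h5⟩, h3⟩
    · rintro ⟨⟨h1, h2⟩, h3⟩
      exact ⟨⟨by omega, by omega⟩, h3, h1, (Nat.le_floor_iff' (by omega)).1 h2⟩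
  refine Eq.trans (sum_congr rfl fun p _ => sum_congr rfl fun q _ => ?_)
    ((sum_congr rfl inner).trans ?_)
  · congr
  refine (sum_subset (Icc_subset_Icc_right hB) fun q hq hq' => ?_).symm
  rw [Ioc_eq_empty_of_le, sum_empty]
  simp only [mem_Icc] at hq hq'
  omega

/-- The equidistribution input for `R3`: for fixed `q` and `p` beyond the denominator of `α`, the
condition on the inverse selects the expected proportion of the `p`. -/
theorem exists_abs_sum_admissible_fixed_q_sub_le :
    ∃ C : ℝ, 0 ≤ C ∧ ∀ (α : ℚ) (q a b : ℕ), α ≤ 1 → 1 ≤ q → q ≤ a → α.den ≤ a →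
      |∑ p ∈ Ioc a b, ((if Admissible α p q then (1 : ℝ) else 0) - coprimeCount α q / q) *
        (1 / ((q : ℝ) * (p + q)))| ≤ C * ((q : ℝ) ^ (9 / 10 : ℝ) / (q : ℝ) ^ 2) := by
  obtain ⟨C, hC1, hC⟩ := exists_abs_weighted_sum_le
  refine ⟨C, by linarith, fun α q a b h1 hq hqa hwa => ?_⟩
  have h1' : (α : ℝ) ≤ 1 := by exact_mod_cast h1
  have hq1 : (1 : ℝ) ≤ q := by exact_mod_cast hq
  have hqa' : (q : ℝ) ≤ a := by exact_mod_cast hqa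
  have h := hC q (-1) a b 0 ⌈(α : ℝ) * q⌉₊ (fun p => 1 / ((q : ℝ) * (p + q))) hq
    (by have := ceil_mul_le h1' q; omega) (fun i _ => by push_cast; gcongr; linarith)
    (fun i _ => by positivity)
  rw [← coprimeCount_eq_card] at h
  have e : ∀ p ∈ Ioc a b, ((if Admissible α p q then (1 : ℝ) else 0) - coprimeCount α q / q) *
      (1 / ((q : ℝ) * (p + q))) = ((∑ j ∈ Ico 0 ⌈(α : ℝ) * q⌉₊,
        if (p : ZMod q) * (j : ZMod q) = ((-1 : (ZMod q)ˣ) : ZMod q) then (1 : ℝ) else 0) -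
        coprimeCount α q / q) * (1 / ((q : ℝ) * (p + q))) := fun p hp => by
    rw [mem_Ioc] at hp
    rw [ite_admissible_eq_of_den_le h1 (by omega) hq (by omega)]
  rw [sum_congr rfl e]
  refine h.trans ?_
  rw [mul_assoc, div_eq_mul_one_div ((q : ℝ) ^ (9 / 10 : ℝ))]
  gcongr
  push_cast
  nlinarith

/-- The pairs `q < p ≤ w`, for which the modulus cannot be changed exactly. With `w` the denominator
of `α` this is the source of the error `(log w) ^ 2`. -/
theorem sum_Ioc_filter_le_den_le (w N : ℕ) (hw : 1 ≤ w) :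
    ∑ q ∈ Icc 1 N, ∑ p ∈ Ioc q N with p ≤ w, 1 / ((q : ℝ) * (p + q)) ≤
      (1 + Real.log w) ^ 2 := by
  have hH : ∑ p ∈ Icc 1 w, 1 / (p : ℝ) ≤ 1 + Real.log w := by
    have := sum_Icc_floor_one_div_le (U := w) (by exact_mod_cast hw)
    rwa [Nat.floor_natCast] at this
  have hH0 : 0 ≤ ∑ p ∈ Icc 1 w, 1 / (p : ℝ) := sum_nonneg fun _ _ => by positivity
  calc _ ≤ ∑ q ∈ Icc 1 N, if q ≤ w then 1 / (q : ℝ) * ∑ p ∈ Icc 1 w, 1 / (p : ℝ) else 0 := by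
        refine sum_le_sum fun q hq => ?_
        have hq1 : (1 : ℝ) ≤ q := by exact_mod_cast (mem_Icc.1 hq).1
        split_ifs with h
        · rw [mul_sum]
          calc _ ≤ ∑ p ∈ Ioc q N with p ≤ w, 1 / (q : ℝ) * (1 / (p : ℝ)) := by
                refine sum_le_sum fun p hp => ?_
                have hp' : 0 < p := by
                  have := (mem_Ioc.1 (mem_filter.1 hp).1).1
                  omega
                have : (0 : ℝ) < p := by exact_mod_cast hp'
                rw [one_div_mul_one_div]
                gcongr
                linarith
            _ ≤ _ := by
                refine sum_le_sum_of_subset_of_nonneg (fun p hp => ?_) fun _ _ _ => by positivity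
                simp only [mem_filter, mem_Ioc, mem_Icc] at hp ⊢
                omega
        · refine (sum_eq_zero fun p hp => ?_).le
          simp only [mem_filter, mem_Ioc] at hp
          omega
    _ ≤ ∑ q ∈ Icc 1 w, 1 / (q : ℝ) * ∑ p ∈ Icc 1 w, 1 / (p : ℝ) := by
        rw [← sum_filter]
        refine sum_le_sum_of_subset_of_nonneg (fun q hq => ?_) fun _ _ _ => by positivity
        simp only [mem_filter, mem_Icc] at hq ⊢
        omega
    _ ≤ _ := by
        rw [← sum_mul, sq]
        gcongr

theorem exists_abs_R3_sub_le :
    ∃ C : ℝ, 0 ≤ C ∧ ∀ (α : ℚ) (U : ℝ), 0 < α → α ≤ 1 → 1 ≤ U →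
      |(R3 α U : ℝ) / U ^ 4 - ((α : ℝ) * Real.log U ^ 2 / (4 * zetaTwo)
        + (α : ℝ) * Real.log U / (2 * zetaTwo) *
          (Real.eulerMascheroniConstant - zetaTwoDeriv / zetaTwo + F α - Real.log 2))| ≤
      C * (1 + Real.log (α.den : ℝ) ^ 2) := by
  obtain ⟨C₁, hC₁, h₁⟩ := exists_abs_sum_admissible_fixed_q_sub_le
  obtain ⟨C₂, hC₂, h₂⟩ := exists_abs_sum_coprimeCount_sub_le
  obtain ⟨C₃, hC₃, h₃⟩ := exists_abs_sum_coprimeCount_log_sub_le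
  have hZ := zetaThreeHalves_nonneg
  have hZ' := zetaElevenTenths_nonneg
  refine ⟨2 + 1 / 2 * (2 + C₁ * zetaElevenTenths + (zetaThreeHalves + 1) + 2 + C₂ + C₃),
    by positivity, fun α U hα0 hα1 hU => ?_⟩
  have h0 : (0 : ℝ) ≤ α := by exact_mod_cast hα0.le
  have h1 : (α : ℝ) ≤ 1 := by exact_mod_cast hα1
  set N := ⌊U⌋₊ with hN
  have hN1 : 1 ≤ N := Nat.floor_pos.2 hU
  have hN1' : (1 : ℝ) ≤ N := by exact_mod_cast hN1
  have hw1 : 1 ≤ α.den := α.den_pos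
  set w := α.den with hw
  set A : ℕ → ℕ → ℝ := fun p q => if Admissible α p q then (1 : ℝ) else 0 with hA
  have hc0 : ∀ q : ℕ, (0 : ℝ) ≤ coprimeCount α q := fun q => Nat.cast_nonneg _
  have hc1 : ∀ q : ℕ, (coprimeCount α q : ℝ) ≤ q := fun q => by
    exact_mod_cast coprimeCount_le h1 q
  set W := ∑ q ∈ Icc 1 N, ∑ p ∈ Ioc q N, A p q * (1 / ((q : ℝ) * (p + q))) with hW
  set V := ∑ q ∈ Icc 1 N, ∑ p ∈ Ioc q N,
    (coprimeCount α q : ℝ) / q * (1 / ((q : ℝ) * (p + q))) with hV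
  set T := ∑ q ∈ Icc 1 N, (coprimeCount α q : ℝ) / (q : ℝ) ^ 2 with hT
  set S := ∑ q ∈ Icc 1 N, (coprimeCount α q : ℝ) / (q : ℝ) ^ 2 * (-Real.log (q / U)) with hS
  have s1 : |(R3 α U : ℝ) - U ^ 4 / 2 * W| ≤ 2 * U ^ 4 := by
    have hs : ((Icc 1 N ×ˢ Icc 1 N).filter fun x => x.2 < x.1) ⊆ Icc 1 N ×ˢ Icc 1 N :=
      filter_subset _ _
    have h := abs_sum_triangleCount_sub_le hU (Admissible α) _ hs
    have conv : ∀ g : ℕ → ℕ → ℝ, ∑ x ∈ ((Icc 1 N ×ˢ Icc 1 N).filter fun x => x.2 < x.1),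
        g x.1 x.2 = ∑ q ∈ Icc 1 N, ∑ p ∈ Ioc q N, g p q := by
      intro g
      rw [sum_filter, sum_product_right]
      refine sum_congr rfl fun q hq => ?_
      rw [← sum_filter]
      refine sum_congr ?_ fun _ _ => rfl
      ext p
      simp only [mem_filter, mem_Icc, mem_Ioc] at hq ⊢
      omega
    rw [conv fun p q => (if Admissible α p q then (1 : ℝ) else 0) * triangleCount (U ^ 2) p q,
      conv fun p q => (if Admissible α p q then (1 : ℝ) else 0) * (1 / ((q : ℝ) * (p + q))),
      ← R3_eq_sum α hU] at h
    exact h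
  have s2 : |W - V| ≤ (1 + Real.log w) ^ 2 + C₁ * zetaElevenTenths := by
    rw [hW, hV, ← sum_sub_distrib]
    refine (abs_sum_le_sum_abs _ _).trans ?_
    calc _ ≤ ∑ q ∈ Icc 1 N, ((∑ p ∈ Ioc q N with p ≤ w, 1 / ((q : ℝ) * (p + q))) +
          C₁ * ((q : ℝ) ^ (9 / 10 : ℝ) / (q : ℝ) ^ 2)) := by
          refine sum_le_sum fun q hq => ?_
          have hq1 : 1 ≤ q := (mem_Icc.1 hq).1
          have hq1' : (1 : ℝ) ≤ q := by exact_mod_cast hq1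
          rw [← sum_sub_distrib, ← sum_filter_add_sum_filter_not (Ioc q N) (fun p => p ≤ w)]
          refine (abs_add_le _ _).trans (add_le_add ?_ ?_)
          · refine (abs_sum_le_sum_abs _ _).trans (sum_le_sum fun p hp => ?_)
            rw [← sub_mul, abs_mul, abs_of_nonneg (by positivity : 0 ≤ 1 / ((q : ℝ) * (p + q)))]
            refine mul_le_of_le_one_left (by positivity) ?_
            have i1 : (coprimeCount α q : ℝ) / q ≤ 1 := div_le_one_of_le₀ (hc1 q) (by linarith)
            have i2 : 0 ≤ (coprimeCount α q : ℝ) / q := div_nonneg (hc0 q) (by linarith)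
            simp only [hA]
            rw [abs_le]
            split_ifs <;> constructor <;> linarith
          · have e : {p ∈ Ioc q N | ¬ p ≤ w} = Ioc (max q w) N := by
              ext p
              simp only [mem_filter, mem_Ioc]
              omega
            rw [e]
            simp only [← sub_mul]
            exact h₁ α q (max q w) N hα1 hq1 (le_max_left _ _) (le_max_right _ _)
      _ ≤ _ := by
          rw [sum_add_distrib, ← mul_sum]
          refine add_le_add (sum_Ioc_filter_le_den_le w N hw1) ?_
          gcongr
          exact sum_rpow_div_sq_le _
  have s3 : |V - (S - Real.log 2 * T)| ≤ zetaThreeHalves + 1 + 2 := by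
    rw [hV, hS, hT, mul_sum, ← sum_sub_distrib, ← sum_sub_distrib]
    refine (abs_sum_le_sum_abs _ _).trans ?_
    calc _ ≤ ∑ q ∈ Icc 1 N, ((1 / (q : ℝ) ^ 2 + 1 / N) + 2 / U * (1 / q)) := by
          refine sum_le_sum fun q hq => ?_
          rw [mem_Icc] at hq
          have hq1 : (1 : ℝ) ≤ q := by exact_mod_cast hq.1
          have hh := abs_sum_Ioc_one_div_add_sub_le hq.1 hq.2
          have hl : |Real.log N - Real.log U| ≤ 2 / U := abs_log_floor_sub_log_le hU
          have e1 : ∑ p ∈ Ioc q N, (coprimeCount α q : ℝ) / q * (1 / ((q : ℝ) * (p + q))) =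
              (coprimeCount α q : ℝ) / q ^ 2 * ∑ p ∈ Ioc q N, (1 : ℝ) / ((p : ℝ) + q) := by
            rw [mul_sum]
            refine sum_congr rfl fun p _ => ?_
            field_simp
          rw [e1, Real.log_div (by linarith) (by linarith)]
          set H := ∑ p ∈ Ioc q N, (1 : ℝ) / ((p : ℝ) + q)
          calc _ = (coprimeCount α q : ℝ) / q * (1 / q) *
                |(H - (Real.log N - Real.log q - Real.log 2)) + (Real.log N - Real.log U)| := by
                have hcq : 0 ≤ (coprimeCount α q : ℝ) / q * (1 / q) := by
                  have := hc0 q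
                  positivity
                rw [show ∀ x : ℝ, (coprimeCount α q : ℝ) / q * (1 / q) * |x| =
                  |(coprimeCount α q : ℝ) / q * (1 / q) * x| from fun x => by
                    rw [abs_mul, abs_of_nonneg hcq]]
                congr 1
                field_simp
                ring
            _ ≤ 1 * (1 / q) * ((1 / q + q / N) + 2 / U) := by
                gcongr
                · exact div_le_one_of_le₀ (hc1 q) (by linarith)
                · exact (abs_add_le _ _).trans (add_le_add hh hl)
            _ = _ := by field_simp
      _ ≤ _ := by
          rw [sum_add_distrib, sum_add_distrib, ← mul_sum, sum_const, Nat.card_Icc, nsmul_eq_mul,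
            Nat.add_sub_cancel, mul_one_div_cancel (by linarith)]
          have h2 := (sum_Icc_floor_one_div_le hU).trans (one_add_log_le hU)
          gcongr
          · exact sum_one_div_sq_le _
          · calc _ ≤ 2 / U * U := by gcongr
              _ = 2 := by field_simp
  have s4 := h₂ α U h0 h1 hU
  have s5 := h₃ α U h0 h1 hU
  rw [ceilSeries_eq α hα0] at s5
  have l2 : Real.log 2 ≤ 1 := by linarith [Real.log_two_lt_d9]
  have l0 : 0 ≤ Real.log 2 := Real.log_nonneg (by norm_num)
  have s6 : |Real.log 2 * (T - α / zetaTwo * Real.log U)| ≤ C₂ := by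
    rw [abs_mul, abs_of_nonneg l0]
    calc _ ≤ 1 * C₂ := by gcongr
      _ = C₂ := one_mul _
  have hlw : (1 + Real.log w) ^ 2 ≤ 2 * (1 + Real.log w ^ 2) := by
    nlinarith [sq_nonneg (1 - Real.log w)]
  have hU4 : 0 < U ^ 4 := by positivity
  have hz := zetaTwo_pos.ne'
  have s7 : |(R3 α U : ℝ) / U ^ 4 - 1 / 2 * W| ≤ 2 := by
    rw [show (R3 α U : ℝ) / U ^ 4 - 1 / 2 * W = ((R3 α U : ℝ) - U ^ 4 / 2 * W) / U ^ 4 by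
      field_simp, abs_div, abs_of_pos hU4, div_le_iff₀ hU4]
    exact s1
  set E := (α : ℝ) / (2 * zetaTwo) * Real.log U ^ 2 + Real.log U / zetaTwo *
    (α * (Real.eulerMascheroniConstant - zetaTwoDeriv / zetaTwo) + α * F α) with hE
  have hX : 0 ≤ Real.log w ^ 2 := sq_nonneg _
  set X := Real.log w ^ 2
  calc _ = |((R3 α U : ℝ) / U ^ 4 - 1 / 2 * W) + 1 / 2 * ((W - V) + (V - (S - Real.log 2 * T)) +
        (S - E) + -(Real.log 2 * (T - α / zetaTwo * Real.log U)))| := by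
        congr 1
        rw [hE]
        field_simp
        ring
    _ ≤ 2 + 1 / 2 * (((1 + Real.log w) ^ 2 + C₁ * zetaElevenTenths) +
        (zetaThreeHalves + 1 + 2) + C₃ + C₂) := by
        refine (abs_add_le _ _).trans (add_le_add s7 ?_)
        rw [abs_mul, abs_of_nonneg (by norm_num : (0 : ℝ) ≤ 1 / 2)]
        gcongr
        refine (abs_add_le _ _).trans (add_le_add ((abs_add_three _ _ _).trans ?_) ?_)
        · gcongr
        · rw [abs_neg]; exact s6
    _ ≤ 2 + 1 / 2 * (2 * (1 + X) + C₁ * zetaElevenTenths +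
        (zetaThreeHalves + 1) + 2 + C₂ + C₃) := by linarith
    _ ≤ _ := by
        have : 0 ≤ (2 + 1 / 2 * (C₁ * zetaElevenTenths +
          (zetaThreeHalves + 1) + 2 + C₂ + C₃)) * X := by positivity
        nlinarith

/-! ### Sums over pairs of coefficients -/

/-- The length of the interval `(max m U, (U ^ 2 - a m) / b]` of the `u` with `a m + b u ≤ U ^ 2`
and `u > m`, `u > U`. -/
noncomputable def intervalLength (U : ℝ) (a b m : ℕ) : ℝ :=
  max ((U ^ 2 - a * m) / b - max (m : ℝ) U) 0

theorem intervalLength_nonneg (U : ℝ) (a b m : ℕ) : 0 ≤ intervalLength U a b m := le_max_right _ _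

/-- The error made for a pair `k < n` in the count of the remaining two variables; its sum over all
pairs up to `U` is `O(U ^ 4)`. -/
noncomputable def pairError (U : ℝ) (n k : ℕ) : ℝ :=
  U ^ 4 / (n : ℝ) ^ 2 * (U ^ (1 / 10 : ℝ))⁻¹ + U ^ 2 / k * (1 + Real.log (U ^ 2)) + U ^ 2 +
    U ^ 4 / (k * n) * (U ^ (1 / 2 : ℝ))⁻¹

theorem inv_rpow_le_two_mul {U P ε : ℝ} (hU : 0 < U) (hUP : U ≤ 2 * P) (h0 : 0 ≤ ε) (h1 : ε ≤ 1) :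
    (P ^ ε)⁻¹ ≤ 2 * (U ^ ε)⁻¹ := by
  have hP : 0 < P := by linarith
  have h2 : (2 : ℝ) ^ ε ≤ 2 := by
    calc (2 : ℝ) ^ ε ≤ 2 ^ (1 : ℝ) := Real.rpow_le_rpow_of_exponent_le (by norm_num) h1
      _ = 2 := Real.rpow_one 2
  have hPe : 0 < P ^ ε := Real.rpow_pos_of_pos hP ε
  have hUe : 0 < U ^ ε := Real.rpow_pos_of_pos hU ε
  have h3 : U ^ ε ≤ 2 * P ^ ε := by
    calc U ^ ε ≤ (2 * P) ^ ε := Real.rpow_le_rpow hU.le hUP h0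
      _ = 2 ^ ε * P ^ ε := Real.mul_rpow (by norm_num) hP.le
      _ ≤ 2 * P ^ ε := by gcongr
  rw [← div_eq_mul_inv, inv_eq_one_div, div_le_div_iff₀ hPe hUe]
  linarith

/-- For a single modulus, the truncation of the interval at `U` only matters for `m ≤ U`. -/
theorem abs_sub_expected_le {α U D P x : ℝ} {k a b m : ℕ} (hD : 0 ≤ D) (h1 : α ≤ 1) (hU : 1 ≤ U)
    (hk : 1 ≤ k) (hkb : k ≤ b) (hP : P = U ^ 2 / (a + b)) (hm : 1 ≤ m) (hmP : (m : ℝ) ≤ P)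
    (hx : |x - intervalLength U a b m / m * coprimeCount α m| ≤
      D * (m : ℝ) ^ (9 / 10 : ℝ) + intervalLength U a b m / m) :
    |x - (a + b) / b * (P - m) / m * coprimeCount α m| ≤
      D * P ^ (9 / 10 : ℝ) + U ^ 2 / k * (1 / m) + if (m : ℝ) ≤ U then U else 0 := by
  have hk1 : (1 : ℝ) ≤ k := by exact_mod_cast hk
  have hkb' : (k : ℝ) ≤ b := by exact_mod_cast hkb
  have hb0 : (0 : ℝ) < b := by linarith
  have ha0 : (0 : ℝ) ≤ a := Nat.cast_nonneg a
  have hs0 : (0 : ℝ) < a + b := by linarith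
  have hPs : P * (a + b) = U ^ 2 := by rw [hP]; field_simp
  have hm1 : (1 : ℝ) ≤ m := by exact_mod_cast hm
  have hN1 : (coprimeCount α m : ℝ) / m ≤ 1 :=
    div_le_one_of_le₀ (by exact_mod_cast coprimeCount_le h1 m) (by linarith)
  have hN0 : 0 ≤ (coprimeCount α m : ℝ) / m := by positivity
  have e : (a + b) / b * (P - m) = (U ^ 2 - a * m) / b - m := by
    rw [← hPs]; field_simp; ring
  have hL0 : 0 ≤ (U ^ 2 - a * m) / b - m := by
    rw [← e]
    exact mul_nonneg (by positivity) (by linarith)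
  have hL1 : (U ^ 2 - a * m) / b - m ≤ U ^ 2 / k := by
    have : (U ^ 2 - a * m) / b ≤ U ^ 2 / k := by
      have : 0 ≤ a * (m : ℝ) := by positivity
      gcongr
      linarith
    linarith
  rw [e]
  set L := (U ^ 2 - a * m) / b - m with hL
  set l := intervalLength U a b m with hl
  have hl0 : 0 ≤ l := intervalLength_nonneg U a b m
  have hlL : l ≤ L := by
    refine max_le ?_ hL0
    have := le_max_left (m : ℝ) U
    linarith
  have hLl : L - l ≤ if (m : ℝ) ≤ U then U else 0 := by
    have := le_max_left ((U ^ 2 - a * m) / b - max (m : ℝ) U) 0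
    rw [← intervalLength, ← hl] at this
    split_ifs with h
    · rw [max_eq_right h] at this
      linarith
    · rw [max_eq_left (by linarith)] at this
      linarith
  calc _ = |(x - l / m * coprimeCount α m) - (L - l) * (coprimeCount α m / m)| := by
        congr 1; ring
    _ ≤ (D * (m : ℝ) ^ (9 / 10 : ℝ) + l / m) + (L - l) * 1 := by
        refine (abs_sub _ _).trans (add_le_add hx ?_)
        rw [abs_mul, abs_of_nonneg (by linarith : 0 ≤ L - l), abs_of_nonneg hN0]
        exact mul_le_mul_of_nonneg_left hN1 (by linarith)
    _ ≤ _ := by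
        rw [mul_one]
        refine add_le_add (add_le_add ?_ ?_) hLl
        · gcongr
        · rw [div_eq_mul_one_div]
          gcongr
          linarith

/-- The sum over the modulus `m` for a fixed pair: the counts `X m` are replaced by their expected
values, which are summed with the kernel `t (1 - t)`. -/
theorem exists_abs_pair_sum_sub_le {D : ℝ} (hD : 0 ≤ D) :
    ∃ C : ℝ, 0 ≤ C ∧ ∀ (α U : ℝ) (k n a b : ℕ) (X : ℕ → ℝ), 0 ≤ α → α ≤ 1 → 1 ≤ U → 1 ≤ k →
      k < n → (n : ℝ) ≤ U → a + b = n + k → k ≤ b →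
      (∀ m : ℕ, 1 ≤ m → (m : ℝ) ≤ U ^ 2 / (a + b) →
        |X m - intervalLength U a b m / m * coprimeCount α m| ≤
          D * (m : ℝ) ^ (9 / 10 : ℝ) + intervalLength U a b m / m) →
      |(∑ m ∈ Icc 1 ⌊U ^ 2 / (a + b)⌋₊, X m) -
        α * U ^ 4 / (2 * zetaTwo) * (1 / (b * (a + b)))| ≤ C * pairError U n k := by
  obtain ⟨C₁, hC₁, h₁⟩ := exists_abs_sum_coprimeCount_mul_one_sub_sub_le
  refine ⟨2 * D + 2 + 2 * C₁, by positivity,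
    fun α U k n a b X h0 h1 hU hk hkn hnU hab hkb hX => ?_⟩
  have hk1 : (1 : ℝ) ≤ k := by exact_mod_cast hk
  have hn1 : (1 : ℝ) ≤ n := by exact_mod_cast hk.trans hkn.le
  have hkn' : (k : ℝ) ≤ n := by exact_mod_cast hkn.le
  have hkb' : (k : ℝ) ≤ b := by exact_mod_cast hkb
  have hab' : (a : ℝ) + b = n + k := by exact_mod_cast hab
  have hb0 : (0 : ℝ) < b := by linarith
  have ha0 : (0 : ℝ) ≤ a := Nat.cast_nonneg a
  have hs0 : (0 : ℝ) < a + b := by linarith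
  have hU0 : 0 < U := by linarith
  set P : ℝ := U ^ 2 / (a + b) with hP
  have hPs : P * (a + b) = U ^ 2 := by rw [hP]; field_simp
  have hP0 : 0 < P := by positivity
  have hUP : U ≤ 2 * P := by
    have : U * (a + b) ≤ 2 * P * (a + b) := by
      rw [mul_assoc, hPs]
      nlinarith
    exact le_of_mul_le_mul_right this hs0
  have hP2 : P ^ 2 ≤ U ^ 4 / (n : ℝ) ^ 2 := by
    have : P ≤ U ^ 2 / n := by
      rw [hP, hab']
      gcongr
      linarith
    calc P ^ 2 ≤ (U ^ 2 / n) ^ 2 := by gcongr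
      _ = _ := by ring
  have hPU : P ≤ U ^ 2 := div_le_self (by positivity) (by linarith)
  have hfl : (⌊P⌋₊ : ℝ) ≤ P := Nat.floor_le hP0.le
  have hpt : ∀ m ∈ Icc 1 ⌊P⌋₊, |X m - (a + b) / b * (P - m) / m * coprimeCount α m| ≤
      D * P ^ (9 / 10 : ℝ) + U ^ 2 / k * (1 / m) + if (m : ℝ) ≤ U then U else 0 := by
    intro m hm
    rw [mem_Icc] at hm
    have hmP : (m : ℝ) ≤ P := (Nat.le_floor_iff' (by omega)).1 hm.2
    exact abs_sub_expected_le hD h1 hU hk hkb hP hm.1 hmP (hX m hm.1 hmP)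
  have hmain : ∑ m ∈ Icc 1 ⌊P⌋₊, (a + b) / b * (P - m) / m * coprimeCount α m =
      U ^ 4 / (b * (a + b)) * ∑ m ∈ Icc 1 ⌊P⌋₊,
        (coprimeCount α m : ℝ) / (m : ℝ) ^ 2 * (m / P * (1 - m / P)) := by
    rw [mul_sum]
    refine sum_congr rfl fun m hm => ?_
    have hm1 : (0 : ℝ) < m := by exact_mod_cast (mem_Icc.1 hm).1
    rw [show U ^ 4 = (P * (a + b)) ^ 2 by rw [hPs]; ring]
    field_simp
  have hker := h₁ α P h0 h1 hP0
  set Z := ∑ m ∈ Icc 1 ⌊P⌋₊, (coprimeCount α m : ℝ) / (m : ℝ) ^ 2 * (m / P * (1 - m / P)) with hZ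
  have r1 : |(∑ m ∈ Icc 1 ⌊P⌋₊, X m) - U ^ 4 / (b * (a + b)) * Z| ≤
      2 * D * (U ^ 4 / (n : ℝ) ^ 2 * (U ^ (1 / 10 : ℝ))⁻¹) +
        U ^ 2 / k * (1 + Real.log (U ^ 2)) + U ^ 2 := by
    rw [← hmain, ← sum_sub_distrib]
    refine (abs_sum_le_sum_abs _ _).trans ((sum_le_sum hpt).trans ?_)
    rw [sum_add_distrib, sum_add_distrib]
    refine add_le_add (add_le_add ?_ ?_) ?_
    · rw [sum_const, Nat.card_Icc, nsmul_eq_mul, Nat.add_sub_cancel]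
      have e : P * P ^ (9 / 10 : ℝ) = P ^ 2 * (P ^ (1 / 10 : ℝ))⁻¹ := by
        rw [← Real.rpow_neg hP0.le, ← Real.rpow_natCast P 2, ← Real.rpow_add hP0]
        nth_rewrite 1 [← Real.rpow_one P]
        rw [← Real.rpow_add hP0]
        norm_num
      calc _ ≤ P * (D * P ^ (9 / 10 : ℝ)) := by gcongr
        _ = D * (P ^ 2 * (P ^ (1 / 10 : ℝ))⁻¹) := by rw [← e]; ring
        _ ≤ D * (U ^ 4 / (n : ℝ) ^ 2 * (2 * (U ^ (1 / 10 : ℝ))⁻¹)) := by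
            gcongr
            exact inv_rpow_le_two_mul hU0 hUP (by norm_num) (by norm_num)
        _ = _ := by ring
    · rw [← mul_sum]
      gcongr
      refine le_trans (sum_le_sum_of_subset_of_nonneg
        (Icc_subset_Icc_right (Nat.floor_mono hPU)) fun _ _ _ => by positivity)
        (sum_Icc_floor_one_div_le (by nlinarith))
    · rw [← sum_filter]
      calc _ ≤ ∑ m ∈ Icc 1 ⌊U⌋₊, U := by
            refine sum_le_sum_of_subset_of_nonneg (fun m hm => ?_) fun _ _ _ => hU0.le
            simp only [mem_filter, mem_Icc] at hm ⊢
            exact ⟨hm.1.1, (Nat.le_floor_iff' (by omega)).2 hm.2⟩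
        _ ≤ U * U := by
            rw [sum_const, Nat.card_Icc, nsmul_eq_mul, Nat.add_sub_cancel]
            gcongr
            exact Nat.floor_le hU0.le
        _ = _ := by ring
  have r2 : |U ^ 4 / (b * (a + b)) * (Z - α / (2 * zetaTwo))| ≤
      2 * C₁ * (U ^ 4 / (k * n) * (U ^ (1 / 2 : ℝ))⁻¹) := by
    rw [abs_mul, abs_of_nonneg (by positivity)]
    calc _ ≤ U ^ 4 / (k * n) * (C₁ * (2 * (U ^ (1 / 2 : ℝ))⁻¹)) := by
          refine mul_le_mul ?_ (hker.trans ?_) (abs_nonneg _) (by positivity)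
          · gcongr
            linarith
          · gcongr
            exact inv_rpow_le_two_mul hU0 hUP (by norm_num) (by norm_num)
      _ = _ := by ring
  have hlog : 0 ≤ Real.log (U ^ 2) := Real.log_nonneg (by nlinarith)
  calc _ = |((∑ m ∈ Icc 1 ⌊P⌋₊, X m) - U ^ 4 / (b * (a + b)) * Z) +
        U ^ 4 / (b * (a + b)) * (Z - α / (2 * zetaTwo))| := by
        congr 1; ring
    _ ≤ _ := (abs_add_le _ _).trans (add_le_add r1 r2)
    _ ≤ _ := by
        have t1 : 0 ≤ U ^ 4 / (n : ℝ) ^ 2 * (U ^ (1 / 10 : ℝ))⁻¹ := by positivity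
        have t2 : 0 ≤ U ^ 2 / k * (1 + Real.log (U ^ 2)) := by positivity
        have t3 : 0 ≤ U ^ 2 := by positivity
        have t4 : 0 ≤ U ^ 4 / (k * n) * (U ^ (1 / 2 : ℝ))⁻¹ := by positivity
        rw [pairError]
        have u1 := mul_nonneg hD t2
        have u2 := mul_nonneg hD t3
        have u3 := mul_nonneg hD t4
        have u4 := mul_nonneg hC₁ t1
        have u5 := mul_nonneg hC₁ t2
        have u6 := mul_nonneg hC₁ t3
        linarith

theorem one_add_log_le_rpow {U ε : ℝ} (hU : 1 ≤ U) (hε : 0 < ε) :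
    1 + Real.log U ≤ (1 + 1 / ε) * U ^ ε := by
  have h1 := Real.log_le_rpow_div (show 0 ≤ U by linarith) hε
  have h2 := Real.one_le_rpow hU hε.le
  calc _ ≤ U ^ ε + U ^ ε / ε := add_le_add h2 h1
    _ = _ := by ring

theorem sum_pairError_le {U : ℝ} (hU : 1 ≤ U) :
    ∑ k ∈ Icc 1 ⌊U⌋₊, ∑ n ∈ Ioc k ⌊U⌋₊, pairError U n k ≤ 55 * U ^ 4 := by
  have hU0 : 0 < U := by linarith
  have hlog : 0 ≤ Real.log U := Real.log_nonneg hU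
  have hlog2 : Real.log (U ^ 2) = 2 * Real.log U := by rw [Real.log_pow]; norm_num
  set N := ⌊U⌋₊ with hN
  have hNU : (N : ℝ) ≤ U := Nat.floor_le hU0.le
  set H := ∑ k ∈ Icc 1 N, (1 : ℝ) / k with hH
  have hH0 : 0 ≤ H := sum_nonneg fun _ _ => by positivity
  have hH1 : H ≤ 1 + Real.log U := sum_Icc_floor_one_div_le hU
  have p1 : 0 < U ^ (1 / 10 : ℝ) := Real.rpow_pos_of_pos hU0 _
  have p2 : 0 < U ^ (1 / 2 : ℝ) := Real.rpow_pos_of_pos hU0 _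
  have a1 : H ≤ 11 * U ^ (1 / 10 : ℝ) := by
    refine hH1.trans ((one_add_log_le_rpow hU (by norm_num : (0 : ℝ) < 1 / 10)).trans_eq ?_)
    norm_num
  have a2 : H ≤ 3 * U ^ (1 / 2 : ℝ) := by
    refine hH1.trans ((one_add_log_le_rpow hU (by norm_num : (0 : ℝ) < 1 / 2)).trans_eq ?_)
    norm_num
  have a3 : 1 + Real.log (U ^ 2) ≤ 6 * U ^ (1 / 2 : ℝ) := by
    have := one_add_log_le_rpow hU (by norm_num : (0 : ℝ) < 1 / 2)
    norm_num at this ⊢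
    rw [hlog2] at *
    linarith
  have a4 : H ≤ 5 * U ^ (1 / 4 : ℝ) := by
    refine hH1.trans ((one_add_log_le_rpow hU (by norm_num : (0 : ℝ) < 1 / 4)).trans_eq ?_)
    norm_num
  have a5 : U ^ (1 / 4 : ℝ) * U ^ (1 / 4 : ℝ) = U ^ (1 / 2 : ℝ) := by
    rw [← Real.rpow_add hU0]; norm_num
  have a6 : U ^ (1 / 2 : ℝ) * U ^ (1 / 2 : ℝ) = U := by
    rw [← Real.rpow_add hU0]; norm_num
  have hl2 : 0 ≤ 1 + Real.log (U ^ 2) := by rw [hlog2]; linarith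
  have b1 : ∑ k ∈ Icc 1 N, ∑ n ∈ Ioc k N, U ^ 4 / (n : ℝ) ^ 2 * (U ^ (1 / 10 : ℝ))⁻¹ ≤
      11 * U ^ 4 := by
    have hsw : ∑ k ∈ Icc 1 N, ∑ n ∈ Ioc k N, U ^ 4 / (n : ℝ) ^ 2 * (U ^ (1 / 10 : ℝ))⁻¹ =
        ∑ n ∈ Icc 1 N, ∑ k ∈ Ico 1 n, U ^ 4 / (n : ℝ) ^ 2 * (U ^ (1 / 10 : ℝ))⁻¹ := by
      refine sum_comm' fun k n => ?_
      simp only [mem_Icc, mem_Ioc, mem_Ico]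
      omega
    rw [hsw]
    calc _ ≤ ∑ n ∈ Icc 1 N, U ^ 4 * (U ^ (1 / 10 : ℝ))⁻¹ * (1 / n) := by
          refine sum_le_sum fun n hn => ?_
          have hn1 : (1 : ℝ) ≤ n := by exact_mod_cast (mem_Icc.1 hn).1
          rw [sum_const, Nat.card_Ico, nsmul_eq_mul]
          have : ((n - 1 : ℕ) : ℝ) ≤ n := by exact_mod_cast Nat.sub_le n 1
          calc _ ≤ n * (U ^ 4 / (n : ℝ) ^ 2 * (U ^ (1 / 10 : ℝ))⁻¹) := by gcongr
            _ = _ := by field_simp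
      _ = U ^ 4 * (U ^ (1 / 10 : ℝ))⁻¹ * H := by rw [← mul_sum]
      _ ≤ U ^ 4 * (U ^ (1 / 10 : ℝ))⁻¹ * (11 * U ^ (1 / 10 : ℝ)) := by gcongr
      _ = _ := by field_simp
  -- the remaining three terms are small enough to be summed over the whole square
  have sq : ∀ f : ℕ → ℕ → ℝ, (∀ n k, 0 ≤ f n k) →
      ∑ k ∈ Icc 1 N, ∑ n ∈ Ioc k N, f n k ≤ ∑ k ∈ Icc 1 N, ∑ n ∈ Icc 1 N, f n k := by
    intro f hf
    refine sum_le_sum fun k _ => sum_le_sum_of_subset_of_nonneg (fun n hn => ?_) fun _ _ _ => hf _ _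
    simp only [mem_Ioc, mem_Icc] at hn ⊢
    omega
  have b2 : ∑ k ∈ Icc 1 N, ∑ n ∈ Ioc k N, U ^ 2 / k * (1 + Real.log (U ^ 2)) ≤ 18 * U ^ 4 := by
    refine (sq (fun n k => U ^ 2 / k * (1 + Real.log (U ^ 2))) fun n k => by positivity).trans ?_
    calc _ = N * (U ^ 2 * (1 + Real.log (U ^ 2)) * H) := by
          simp only [sum_const, Nat.card_Icc, nsmul_eq_mul, Nat.add_sub_cancel]
          rw [← mul_sum, hH, mul_sum (a := U ^ 2 * (1 + Real.log (U ^ 2)))]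
          congr 1
          exact sum_congr rfl fun k _ => by ring
      _ ≤ U * (U ^ 2 * (6 * U ^ (1 / 2 : ℝ)) * (3 * U ^ (1 / 2 : ℝ))) := by gcongr
      _ = 18 * U ^ 3 * (U ^ (1 / 2 : ℝ) * U ^ (1 / 2 : ℝ)) := by ring
      _ = _ := by rw [a6]; ring
  have b3 : ∑ k ∈ Icc 1 N, ∑ n ∈ Ioc k N, U ^ 2 ≤ U ^ 4 := by
    refine (sq (fun n k => U ^ 2) fun n k => by positivity).trans ?_
    simp only [sum_const, Nat.card_Icc, nsmul_eq_mul, Nat.add_sub_cancel]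
    calc _ ≤ U * (U * U ^ 2) := by gcongr
      _ = _ := by ring
  have b4 : ∑ k ∈ Icc 1 N, ∑ n ∈ Ioc k N, U ^ 4 / (k * n) * (U ^ (1 / 2 : ℝ))⁻¹ ≤ 25 * U ^ 4 := by
    refine (sq (fun n k => U ^ 4 / (k * n) * (U ^ (1 / 2 : ℝ))⁻¹) fun n k => by positivity).trans ?_
    calc _ = U ^ 4 * (U ^ (1 / 2 : ℝ))⁻¹ * (H * H) := by
          rw [hH, sum_mul_sum, mul_sum]
          refine sum_congr rfl fun k _ => ?_
          rw [mul_sum]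
          exact sum_congr rfl fun n _ => by ring
      _ ≤ U ^ 4 * (U ^ (1 / 2 : ℝ))⁻¹ * ((5 * U ^ (1 / 4 : ℝ)) * (5 * U ^ (1 / 4 : ℝ))) := by
          gcongr
      _ = 25 * U ^ 4 * (U ^ (1 / 2 : ℝ))⁻¹ * (U ^ (1 / 4 : ℝ) * U ^ (1 / 4 : ℝ)) := by ring
      _ = _ := by rw [a5]; field_simp
  simp only [pairError, sum_add_distrib]
  linarith

/-- `∑ 1 / (n (n + k)) = log 2 log U + O(1)` over `k < n ≤ U`. -/
theorem abs_sum_one_div_mul_add_sub_le {U : ℝ} (hU : 1 ≤ U) :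
    |(∑ k ∈ Icc 1 ⌊U⌋₊, ∑ n ∈ Ioc k ⌊U⌋₊, 1 / ((n : ℝ) * (k + n))) -
      Real.log 2 * Real.log U| ≤ 3 * zetaThreeHalves + 4 := by
  set N := ⌊U⌋₊ with hN
  have hN1 : 1 ≤ N := Nat.floor_pos.2 hU
  have hN1' : (1 : ℝ) ≤ N := by exact_mod_cast hN1
  set H := ∑ k ∈ Icc 1 N, (1 : ℝ) / k with hH
  have hH1 : H ≤ 1 + Real.log U := sum_Icc_floor_one_div_le hU
  have l2 : Real.log 2 ≤ 1 := by linarith [Real.log_two_lt_d9]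
  have l0 : 0 ≤ Real.log 2 := Real.log_nonneg (by norm_num)
  have s1 : |(∑ k ∈ Icc 1 N, ∑ n ∈ Ioc k N, 1 / ((n : ℝ) * (k + n))) - Real.log 2 * H| ≤
      3 * zetaThreeHalves + 1 := by
    rw [hH, mul_sum, ← sum_sub_distrib]
    refine (abs_sum_le_sum_abs _ _).trans ?_
    calc _ ≤ ∑ k ∈ Icc 1 N, (3 * (1 / (k : ℝ) ^ 2) + 1 / N) := by
          refine sum_le_sum fun k hk => ?_
          rw [mem_Icc] at hk
          have hk1 : (1 : ℝ) ≤ k := by exact_mod_cast hk.1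
          have hh := abs_sum_Ioc_one_div_mul_sub_le hk.1 hk.2
          calc _ = 1 / k * |k * (∑ n ∈ Ioc k N, 1 / ((n : ℝ) * (k + n))) - Real.log 2| := by
                rw [← abs_of_nonneg (by positivity : 0 ≤ 1 / (k : ℝ)), ← abs_mul,
                  abs_of_nonneg (by positivity : 0 ≤ 1 / (k : ℝ))]
                congr 1
                field_simp
            _ ≤ 1 / k * (3 / k + (k : ℝ) / N) := by gcongr
            _ = _ := by field_simp
      _ ≤ _ := by
          rw [sum_add_distrib, ← mul_sum, sum_const, Nat.card_Icc, nsmul_eq_mul,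
            Nat.add_sub_cancel, mul_one_div_cancel (by linarith)]
          gcongr
          exact sum_one_div_sq_le _
  have s2 : |H - Real.log U| ≤ 3 := abs_sum_one_div_sub_log_le hU
  calc _ = |((∑ k ∈ Icc 1 N, ∑ n ∈ Ioc k N, 1 / ((n : ℝ) * (k + n))) - Real.log 2 * H) +
        Real.log 2 * (H - Real.log U)| := by congr 1; ring
    _ ≤ (3 * zetaThreeHalves + 1) + 1 * 3 := by
        refine (abs_add_le _ _).trans (add_le_add s1 ?_)
        rw [abs_mul, abs_of_nonneg l0]
        gcongr
    _ = _ := by ring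

/-- `∑ 1 / (k (n + k)) = (log U) ^ 2 / 2 + (γ - log 2) log U + O(1)` over `k < n ≤ U`. -/
theorem abs_sum_one_div_mul_add_sub_le' {U : ℝ} (hU : 1 ≤ U) :
    |(∑ k ∈ Icc 1 ⌊U⌋₊, ∑ n ∈ Ioc k ⌊U⌋₊, 1 / ((k : ℝ) * (n + k))) -
      (1 / 2 * Real.log U ^ 2 + (Real.eulerMascheroniConstant - Real.log 2) * Real.log U)| ≤
      7 * zetaThreeHalves + 10 := by
  set N := ⌊U⌋₊ with hN
  have hN1 : 1 ≤ N := Nat.floor_pos.2 hU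
  have hN1' : (1 : ℝ) ≤ N := by exact_mod_cast hN1
  set H := ∑ k ∈ Icc 1 N, (1 : ℝ) / k with hH
  have hH1 : H ≤ 1 + Real.log U := sum_Icc_floor_one_div_le hU
  have hK := abs_sum_log_kernel_sub_le hU
  set K := ∑ k ∈ Icc 1 N, (1 : ℝ) / k * (-Real.log (k / U)) with hKd
  have l2 : Real.log 2 ≤ 1 := by linarith [Real.log_two_lt_d9]
  have l0 : 0 ≤ Real.log 2 := Real.log_nonneg (by norm_num)
  have s1 : |(∑ k ∈ Icc 1 N, ∑ n ∈ Ioc k N, 1 / ((k : ℝ) * (n + k))) - (K - Real.log 2 * H)| ≤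
      zetaThreeHalves + 1 + 2 := by
    rw [hKd, hH, mul_sum, ← sum_sub_distrib, ← sum_sub_distrib]
    refine (abs_sum_le_sum_abs _ _).trans ?_
    calc _ ≤ ∑ k ∈ Icc 1 N, ((1 / (k : ℝ) ^ 2 + 1 / N) + 2 / U * (1 / k)) := by
          refine sum_le_sum fun k hk => ?_
          rw [mem_Icc] at hk
          have hk1 : (1 : ℝ) ≤ k := by exact_mod_cast hk.1
          have hh := abs_sum_Ioc_one_div_add_sub_le hk.1 hk.2
          have hl : |Real.log N - Real.log U| ≤ 2 / U := abs_log_floor_sub_log_le hU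
          have e1 : ∑ n ∈ Ioc k N, 1 / ((k : ℝ) * (n + k)) =
              1 / k * ∑ n ∈ Ioc k N, (1 : ℝ) / ((n : ℝ) + k) := by
            rw [mul_sum]
            exact sum_congr rfl fun p _ => by field_simp
          rw [e1, Real.log_div (by linarith) (by linarith)]
          set G := ∑ n ∈ Ioc k N, (1 : ℝ) / ((n : ℝ) + k)
          calc _ = 1 / k *
                |(G - (Real.log N - Real.log k - Real.log 2)) + (Real.log N - Real.log U)| := by
                rw [← abs_of_nonneg (by positivity : 0 ≤ 1 / (k : ℝ)), ← abs_mul,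
                  abs_of_nonneg (by positivity : 0 ≤ 1 / (k : ℝ))]
                congr 1
                ring
            _ ≤ 1 / k * ((1 / k + k / N) + 2 / U) := by
                gcongr
                exact (abs_add_le _ _).trans (add_le_add hh hl)
            _ = _ := by field_simp
      _ ≤ _ := by
          rw [sum_add_distrib, sum_add_distrib, ← mul_sum, sum_const, Nat.card_Icc, nsmul_eq_mul,
            Nat.add_sub_cancel, mul_one_div_cancel (by linarith)]
          have h2 := hH1.trans (one_add_log_le hU)
          gcongr
          · exact sum_one_div_sq_le _
          · calc _ ≤ 2 / U * U := by gcongr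
              _ = 2 := by field_simp
  have s2 : |H - Real.log U| ≤ 3 := abs_sum_one_div_sub_log_le hU
  calc _ = |((∑ k ∈ Icc 1 N, ∑ n ∈ Ioc k N, 1 / ((k : ℝ) * (n + k))) - (K - Real.log 2 * H)) +
        (K - (1 / 2 * Real.log U ^ 2 + Real.eulerMascheroniConstant * Real.log U)) +
        -(Real.log 2 * (H - Real.log U))| := by congr 1; ring
    _ ≤ (zetaThreeHalves + 1 + 2) + (6 * zetaThreeHalves + 4) + 1 * 3 := by
        refine (abs_add_three _ _ _).trans (add_le_add (add_le_add s1 hK) ?_)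
        rw [abs_neg, abs_mul, abs_of_nonneg l0]
        gcongr
    _ = _ := by ring

/-! ### The ranges with one variable above `U` -/

theorem sum_sum_sum_sum_comm (s : Finset ℕ) (f : ℕ → ℕ → ℕ → ℕ → ℝ) :
    ∑ p ∈ s, ∑ q ∈ s, ∑ n ∈ s, ∑ k ∈ s, f p q n k =
      ∑ k ∈ s, ∑ n ∈ s, ∑ q ∈ s, ∑ p ∈ s, f p q n k := by
  calc _ = ∑ q ∈ s, ∑ p ∈ s, ∑ n ∈ s, ∑ k ∈ s, f p q n k := sum_comm
    _ = ∑ q ∈ s, ∑ n ∈ s, ∑ p ∈ s, ∑ k ∈ s, f p q n k := sum_congr rfl fun _ _ => sum_comm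
    _ = ∑ n ∈ s, ∑ q ∈ s, ∑ p ∈ s, ∑ k ∈ s, f p q n k := sum_comm
    _ = ∑ n ∈ s, ∑ q ∈ s, ∑ k ∈ s, ∑ p ∈ s, f p q n k :=
        sum_congr rfl fun _ _ => sum_congr rfl fun _ _ => sum_comm
    _ = ∑ n ∈ s, ∑ k ∈ s, ∑ q ∈ s, ∑ p ∈ s, f p q n k := sum_congr rfl fun _ _ => sum_comm
    _ = _ := sum_comm

/-- The number of admissible `q` in an interval, for fixed `p`. -/
theorem exists_abs_sum_admissible_left_sub_le :
    ∃ D : ℝ, 0 ≤ D ∧ ∀ (α x y : ℝ) (p : ℕ), 0 ≤ α → α ≤ 1 → 1 ≤ p → 0 ≤ x →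
      |(∑ q ∈ Ioc ⌊x⌋₊ ⌊y⌋₊, if Admissible α p q then (1 : ℝ) else 0) -
        max (y - x) 0 / p * coprimeCount α p| ≤
        D * (p : ℝ) ^ (9 / 10 : ℝ) + max (y - x) 0 / p := by
  obtain ⟨C, hC1, hC⟩ := exists_abs_congruenceCount_sub_le
  refine ⟨C, by linarith, fun α x y p h0 h1 hp hx => ?_⟩
  have hp1 : (1 : ℝ) ≤ p := by exact_mod_cast hp
  have hpp := one_le_rpow_natCast hp
  have hl : 0 ≤ max (y - x) 0 / p := div_nonneg (le_max_right _ _) (by linarith)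
  set l := max (y - x) 0 / p with hld
  rcases Nat.lt_or_ge p 2 with h2 | h2
  · have e : ∀ q, (if Admissible α p q then (1 : ℝ) else 0) = 0 := fun q =>
      if_neg fun h => by have := h.2.1; omega
    have hc : coprimeCount α p ≤ p := coprimeCount_le h1 p
    have hc' : (coprimeCount α p : ℝ) ≤ 1 := by exact_mod_cast (by omega : coprimeCount α p ≤ 1)
    simp only [e, sum_const_zero, zero_sub, abs_neg]
    rw [abs_of_nonneg (by positivity)]
    nlinarith
  · have hfl : ⌊α * p⌋₊ ≤ p := Nat.floor_le_of_le (mul_le_of_le_one_left (Nat.cast_nonneg p) h1)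
    have h := hC p 1 x y 1 (⌊α * p⌋₊ + 1) hp hx (by omega)
    simp only [congruenceCount, ← ite_admissible_eq_inv h1 h2] at h
    have hcc := abs_card_sub_coprimeCount_le h0 h2
    set c : ℝ := ((#{j ∈ Ico 1 (⌊α * p⌋₊ + 1) | j.Coprime p} : ℕ) : ℝ) with hcdef
    set S := ∑ q ∈ Ioc ⌊x⌋₊ ⌊y⌋₊, if Admissible α p q then (1 : ℝ) else 0
    calc |S - l * coprimeCount α p| = |(S - l * c) + l * (c - coprimeCount α p)| := by
          congr 1; ring
      _ ≤ C * (p : ℝ) ^ (9 / 10 : ℝ) + l * 1 := by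
          refine (abs_add_le _ _).trans (add_le_add h ?_)
          rw [abs_mul, abs_of_nonneg hl]
          gcongr
      _ = _ := by rw [mul_one]

/-- The number of admissible `p > q` in an interval, for fixed `q`. -/
theorem exists_abs_sum_admissible_right_sub_le :
    ∃ D : ℝ, 0 ≤ D ∧ ∀ (α x y : ℝ) (q : ℕ), 0 ≤ α → α ≤ 1 → 1 ≤ q → (q : ℝ) ≤ x →
      |(∑ p ∈ Ioc ⌊x⌋₊ ⌊y⌋₊, if Admissible α p q then (1 : ℝ) else 0) -
        max (y - x) 0 / q * coprimeCount α q| ≤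
        D * (q : ℝ) ^ (9 / 10 : ℝ) + max (y - x) 0 / q := by
  obtain ⟨C, hC1, hC⟩ := exists_abs_congruenceCount_sub_le
  refine ⟨C, by linarith, fun α x y q h0 h1 hq hqx => ?_⟩
  have hq1 : (1 : ℝ) ≤ q := by exact_mod_cast hq
  have hl : 0 ≤ max (y - x) 0 / q := div_nonneg (le_max_right _ _) (by linarith)
  set l := max (y - x) 0 / q with hld
  have hceil := ceil_mul_le h1 q
  have h2 : ∀ p ∈ Ioc ⌊x⌋₊ ⌊y⌋₊, 2 ≤ p := fun p hp => by
    have := Nat.le_floor hqx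
    have := (mem_Ioc.1 hp).1
    omega
  have hup := hC q (-1) x y 0 ⌈α * q⌉₊ hq (by linarith) (by omega)
  have hlo := hC q (-1) x y 0 (⌈α * q⌉₊ - 1) hq (by linarith) (by omega)
  rw [← coprimeCount_eq_card] at hup
  have hcc : (coprimeCount α q : ℝ) ≤ #{j ∈ Ico 0 (⌈α * q⌉₊ - 1) | j.Coprime q} + 1 := by
    exact_mod_cast coprimeCount_le_card_add_one α q
  set S := ∑ p ∈ Ioc ⌊x⌋₊ ⌊y⌋₊, if Admissible α p q then (1 : ℝ) else 0
  have i1 : S ≤ congruenceCount q (-1) x y 0 ⌈α * q⌉₊ :=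
    sum_le_sum fun p hp => ite_admissible_le h1 (h2 p hp) hq
  have i2 : congruenceCount q (-1) x y 0 (⌈α * q⌉₊ - 1) ≤ S :=
    sum_le_sum fun p hp => le_ite_admissible h1 (h2 p hp) hq
  have i3 := mul_le_mul_of_nonneg_left hcc hl
  rw [abs_le] at hup hlo ⊢
  constructor <;> linarith

/-- The count of quadruples `(n, k, m, u)` with `k < n ≤ U`, `u > m`, `u > U` and
`a m + b u ≤ U ^ 2`, where `{a, b} = {n, k}`, subject to an equidistributed condition on
`(m, u)`. -/
theorem exists_abs_quadruple_sum_sub_le {D : ℝ} (hD : 0 ≤ D) :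
    ∃ C : ℝ, 0 ≤ C ∧ ∀ (α U : ℝ) (a b : ℕ → ℕ → ℕ) (φ : ℕ → ℕ → Prop)
      (ψ : ℕ → ℕ → ℕ → ℕ → Prop), 0 ≤ α → α ≤ 1 → 1 ≤ U →
      (∀ n k, 1 ≤ k → k < n → a n k + b n k = n + k ∧ k ≤ b n k) →
      (∀ n k m u : ℕ, 1 ≤ k → 1 ≤ m → 1 ≤ u → (ψ n k m u ↔ k < n ∧ (n : ℝ) ≤ U ∧
        φ m u ∧ max (m : ℝ) U < u ∧ (u : ℝ) ≤ (U ^ 2 - a n k * m) / b n k)) →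
      (∀ (x y : ℝ) (m : ℕ), 1 ≤ m → (m : ℝ) ≤ x →
        |(∑ u ∈ Ioc ⌊x⌋₊ ⌊y⌋₊, if φ m u then (1 : ℝ) else 0) -
          max (y - x) 0 / m * coprimeCount α m| ≤
          D * (m : ℝ) ^ (9 / 10 : ℝ) + max (y - x) 0 / m) →
      |(∑ k ∈ Icc 1 ⌊U ^ 2⌋₊, ∑ n ∈ Icc 1 ⌊U ^ 2⌋₊, ∑ m ∈ Icc 1 ⌊U ^ 2⌋₊, ∑ u ∈ Icc 1 ⌊U ^ 2⌋₊,
          if ψ n k m u then (1 : ℝ) else 0) -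
        α * U ^ 4 / (2 * zetaTwo) * ∑ k ∈ Icc 1 ⌊U⌋₊, ∑ n ∈ Ioc k ⌊U⌋₊,
          1 / ((b n k : ℝ) * (a n k + b n k))| ≤ C * U ^ 4 := by
  obtain ⟨C, hC0, hC⟩ := exists_abs_pair_sum_sub_le hD
  refine ⟨C * 55, by positivity, fun α U a b φ ψ h0 h1 hU hab hψ hφ => ?_⟩
  have hU0 : 0 < U := by linarith
  have hB := floor_le_floor_sq hU
  set B := ⌊U ^ 2⌋₊ with hBd
  set N := ⌊U⌋₊ with hN
  set X : ℕ → ℕ → ℕ → ℝ := fun n k m =>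
    ∑ u ∈ Ioc ⌊max (m : ℝ) U⌋₊ ⌊(U ^ 2 - a n k * m) / b n k⌋₊, if φ m u then 1 else 0 with hX
  have inner : ∀ k ∈ Icc 1 B, ∀ n ∈ Icc 1 B,
      (∑ m ∈ Icc 1 B, ∑ u ∈ Icc 1 B, if ψ n k m u then (1 : ℝ) else 0) =
      if k < n ∧ n ≤ N then ∑ m ∈ Icc 1 ⌊U ^ 2 / (a n k + b n k)⌋₊, X n k m else 0 := by
    intro k hk n hn
    rw [mem_Icc] at hk hn
    split_ifs with h
    · obtain ⟨e1, e2⟩ := hab n k hk.1 h.1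
      have hb1 : (1 : ℝ) ≤ b n k := by exact_mod_cast hk.1.trans e2
      have ha0 : (0 : ℝ) ≤ a n k := Nat.cast_nonneg _
      have hnU : (n : ℝ) ≤ U := (Nat.le_floor_iff' (by omega)).1 h.2
      have g : ∀ m ∈ Icc 1 B, (∑ u ∈ Icc 1 B, if ψ n k m u then (1 : ℝ) else 0) = X n k m := by
        intro m hm
        have hm1 := (mem_Icc.1 hm).1
        have hy : (U ^ 2 - a n k * m) / b n k ≤ U ^ 2 := by
          have : 0 ≤ (a n k : ℝ) * m := by positivity
          rw [div_le_iff₀ (by linarith)]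
          nlinarith
        refine Eq.trans (sum_congr rfl fun u hu => ?_) (sum_ite_interval_eq (φ m) B
          (x := max (m : ℝ) U) (by positivity) (Nat.floor_mono hy))
        congr 1
        rw [hψ n k m u hk.1 hm1 (mem_Icc.1 hu).1, eq_iff_iff]
        exact ⟨fun h' => h'.2.2, fun h' => ⟨h.1, hnU, h'⟩⟩
      rw [sum_congr rfl g]
      refine (sum_subset (Icc_subset_Icc_right (Nat.floor_mono
        (div_le_self (by positivity) (by linarith)))) fun m hm hm' => ?_).symm
      simp only [mem_Icc, not_and, not_le] at hm hm'
      have hm2 : U ^ 2 / (a n k + b n k) < m := (Nat.floor_lt (by positivity)).1 (hm' hm.1)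
      rw [div_lt_iff₀ (by linarith)] at hm2
      change ∑ u ∈ Ioc _ _, _ = _
      rw [Ioc_eq_empty_of_le, sum_empty]
      refine Nat.floor_mono (le_trans ?_ (le_max_left _ _))
      rw [div_le_iff₀ (by linarith)]
      linarith
    · refine sum_eq_zero fun m hm => sum_eq_zero fun u hu => if_neg fun h' => h ?_
      rw [hψ n k m u hk.1 (mem_Icc.1 hm).1 (mem_Icc.1 hu).1] at h'
      exact ⟨h'.1, Nat.le_floor h'.2.1⟩
  have total : (∑ k ∈ Icc 1 B, ∑ n ∈ Icc 1 B, ∑ m ∈ Icc 1 B, ∑ u ∈ Icc 1 B,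
      if ψ n k m u then (1 : ℝ) else 0) =
      ∑ k ∈ Icc 1 N, ∑ n ∈ Ioc k N, ∑ m ∈ Icc 1 ⌊U ^ 2 / (a n k + b n k)⌋₊, X n k m := by
    rw [sum_congr rfl fun k hk => sum_congr rfl fun n hn => inner k hk n hn]
    have e : ∀ k ∈ Icc 1 B, (∑ n ∈ Icc 1 B, if k < n ∧ n ≤ N then
        ∑ m ∈ Icc 1 ⌊U ^ 2 / (a n k + b n k)⌋₊, X n k m else 0) =
        ∑ n ∈ Ioc k N, ∑ m ∈ Icc 1 ⌊U ^ 2 / (a n k + b n k)⌋₊, X n k m := by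
      intro k hk
      rw [← sum_filter]
      refine sum_congr ?_ fun _ _ => rfl
      ext n
      simp only [mem_filter, mem_Icc, mem_Ioc]
      omega
    rw [sum_congr rfl e]
    refine (sum_subset (Icc_subset_Icc_right hB) fun k hk hk' => ?_).symm
    rw [Ioc_eq_empty_of_le, sum_empty]
    simp only [mem_Icc] at hk hk'
    omega
  rw [total, mul_sum, ← sum_sub_distrib]
  refine (abs_sum_le_sum_abs _ _).trans ?_
  calc _ ≤ ∑ k ∈ Icc 1 N, ∑ n ∈ Ioc k N, C * pairError U n k := by
        refine sum_le_sum fun k hk => ?_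
        rw [mul_sum, ← sum_sub_distrib]
        refine (abs_sum_le_sum_abs _ _).trans (sum_le_sum fun n hn => ?_)
        rw [mem_Icc] at hk
        rw [mem_Ioc] at hn
        obtain ⟨e1, e2⟩ := hab n k hk.1 hn.1
        have hnU : (n : ℝ) ≤ U := (Nat.le_floor_iff' (by omega)).1 hn.2
        exact hC α U k n (a n k) (b n k) (X n k) h0 h1 hU hk.1 hn.1 hnU e1 e2
          fun m hm _ => hφ _ _ m hm (le_max_left _ _)
    _ = C * ∑ k ∈ Icc 1 N, ∑ n ∈ Ioc k N, pairError U n k := by simp only [mul_sum]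
    _ ≤ C * (55 * U ^ 4) := mul_le_mul_of_nonneg_left (sum_pairError_le hU) hC0
    _ = _ := by ring

theorem exists_abs_R4_sub_le :
    ∃ C : ℝ, 0 ≤ C ∧ ∀ (α : ℚ) (U : ℝ), 0 < α → α ≤ 1 → 1 ≤ U →
      |(R4 α U : ℝ) - ((α : ℝ) * U ^ 4 * Real.log U ^ 2 / (4 * zetaTwo)
        + (α : ℝ) * U ^ 4 * Real.log U / (2 * zetaTwo) *
          (Real.eulerMascheroniConstant - Real.log 2))| ≤ C * U ^ 4 := by
  obtain ⟨D, hD0, hD⟩ := exists_abs_sum_admissible_right_sub_le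
  obtain ⟨C, hC0, hC⟩ := exists_abs_quadruple_sum_sub_le hD0
  have hZ := zetaThreeHalves_nonneg
  have hz := zetaTwo_pos
  refine ⟨C + 1 / (2 * zetaTwo) * (7 * zetaThreeHalves + 10), by positivity,
    fun α U hα0 hα1 hU => ?_⟩
  have h0 : (0 : ℝ) ≤ α := by exact_mod_cast hα0.le
  have h1 : (α : ℝ) ≤ 1 := by exact_mod_cast hα1
  have h := hC α U (fun n _ => n) (fun _ k => k) (fun m u => Admissible α u m)
    (fun n k m u => Admissible α u m ∧ (m < u ∧ U < (u : ℝ) ∧ (n : ℝ) ≤ U) ∧ k < n ∧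
      ((n * m + k * u : ℕ) : ℝ) ≤ U ^ 2) h0 h1 hU (fun n k _ _ => ⟨rfl, le_rfl⟩)
    (fun n k m u hk hm hu => by
      have hk0 : (0 : ℝ) < k := by exact_mod_cast hk
      rw [le_div_iff₀ hk0, max_lt_iff, Nat.cast_lt]
      push_cast
      constructor
      · rintro ⟨c1, ⟨c2, c3, c4⟩, c5, c6⟩
        exact ⟨c5, c4, c1, ⟨c2, c3⟩, by linarith⟩
      · rintro ⟨c5, c4, c1, ⟨c2, c3⟩, c6⟩
        exact ⟨c1, ⟨c2, c3, c4⟩, c5, by linarith⟩)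
    (fun x y m hm hx => hD α x y m h0 h1 hm hx)
  have h' : |(R4 α U : ℝ) - α * U ^ 4 / (2 * zetaTwo) * ∑ k ∈ Icc 1 ⌊U⌋₊, ∑ n ∈ Ioc k ⌊U⌋₊,
      1 / ((k : ℝ) * (n + k))| ≤ C * U ^ 4 := by
    rw [R4, count_eq_sum, sum_sum_sum_sum_comm]
    convert h
  have hS := abs_sum_one_div_mul_add_sub_le' hU
  set S := ∑ k ∈ Icc 1 ⌊U⌋₊, ∑ n ∈ Ioc k ⌊U⌋₊, 1 / ((k : ℝ) * (n + k)) with hSd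
  have hc : 0 ≤ α * U ^ 4 / (2 * zetaTwo) := by positivity
  calc _ = |((R4 α U : ℝ) - α * U ^ 4 / (2 * zetaTwo) * S) + α * U ^ 4 / (2 * zetaTwo) *
        (S - (1 / 2 * Real.log U ^ 2 +
          (Real.eulerMascheroniConstant - Real.log 2) * Real.log U))| := by
        congr 1
        field_simp
        ring
    _ ≤ C * U ^ 4 + 1 * U ^ 4 / (2 * zetaTwo) * (7 * zetaThreeHalves + 10) := by
        refine (abs_add_le _ _).trans (add_le_add h' ?_)
        rw [abs_mul, abs_of_nonneg hc]
        gcongr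
    _ = _ := by ring

theorem exists_abs_R2_sub_le :
    ∃ C : ℝ, 0 ≤ C ∧ ∀ (α : ℚ) (U : ℝ), 0 < α → α ≤ 1 → 1 ≤ U →
      |(R2 α U : ℝ) - (α : ℝ) * Real.log 2 / (2 * zetaTwo) * U ^ 4 * Real.log U| ≤ C * U ^ 4 := by
  obtain ⟨D, hD0, hD⟩ := exists_abs_sum_admissible_left_sub_le
  obtain ⟨C, hC0, hC⟩ := exists_abs_quadruple_sum_sub_le hD0
  have hZ := zetaThreeHalves_nonneg
  have hz := zetaTwo_pos
  refine ⟨C + 1 / (2 * zetaTwo) * (3 * zetaThreeHalves + 4), by positivity,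
    fun α U hα0 hα1 hU => ?_⟩
  have h0 : (0 : ℝ) ≤ α := by exact_mod_cast hα0.le
  have h1 : (α : ℝ) ≤ 1 := by exact_mod_cast hα1
  have h := hC α U (fun _ k => k) (fun n _ => n) (fun m u => Admissible α m u)
    (fun n k m u => Admissible α m u ∧ (m ≤ u ∧ U < (u : ℝ)) ∧ k < n ∧
      ((n * u + k * m : ℕ) : ℝ) ≤ U ^ 2) h0 h1 hU (fun n k _ h => ⟨add_comm _ _, h.le⟩)
    (fun n k m u hk hm hu => by
      have hu0 : (1 : ℝ) ≤ u := by exact_mod_cast hu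
      push_cast
      constructor
      · rintro ⟨c1, ⟨c2, c3⟩, c5, c6⟩
        have hn0 : (0 : ℝ) < n := by exact_mod_cast (by omega : 0 < n)
        have hkm : 0 ≤ (k : ℝ) * m := by positivity
        rw [le_div_iff₀ hn0, max_lt_iff, Nat.cast_lt]
        refine ⟨c5, ?_, c1, ⟨lt_of_le_of_ne c2 ?_, c3⟩, by linarith⟩
        · -- the other conditions force `n ≤ U`
          by_contra hcon
          push Not at hcon
          nlinarith
        · rintro rfl
          have := c1.1
          rw [Nat.coprime_self] at this
          have := c1.2.1
          omega
      · rintro ⟨c5, c4, c1, c2, c6⟩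
        have hn0 : (0 : ℝ) < n := by exact_mod_cast (by omega : 0 < n)
        rw [le_div_iff₀ hn0] at c6
        rw [max_lt_iff, Nat.cast_lt] at c2
        exact ⟨c1, ⟨c2.1.le, c2.2⟩, c5, by linarith⟩)
    (fun x y m hm hx => hD α x y m h0 h1 hm ((Nat.cast_nonneg m).trans hx))
  have h' : |(R2 α U : ℝ) - α * U ^ 4 / (2 * zetaTwo) * ∑ k ∈ Icc 1 ⌊U⌋₊, ∑ n ∈ Ioc k ⌊U⌋₊,
      1 / ((n : ℝ) * (k + n))| ≤ C * U ^ 4 := by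
    rw [R2, count_eq_sum, sum_comm, sum_sum_sum_sum_comm]
    convert h
  have hS := abs_sum_one_div_mul_add_sub_le hU
  set S := ∑ k ∈ Icc 1 ⌊U⌋₊, ∑ n ∈ Ioc k ⌊U⌋₊, 1 / ((n : ℝ) * (k + n)) with hSd
  have hc : 0 ≤ α * U ^ 4 / (2 * zetaTwo) := by positivity
  calc _ = |((R2 α U : ℝ) - α * U ^ 4 / (2 * zetaTwo) * S) + α * U ^ 4 / (2 * zetaTwo) *
        (S - Real.log 2 * Real.log U)| := by
        congr 1
        field_simp
        ring
    _ ≤ C * U ^ 4 + 1 * U ^ 4 / (2 * zetaTwo) * (3 * zetaThreeHalves + 4) := by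
        refine (abs_add_le _ _).trans (add_le_add h' ?_)
        rw [abs_mul, abs_of_nonneg hc]
        gcongr
    _ = _ := by ring

/-! ### The range `U < p`, `U < n` -/

theorem abs_sum_Ioc_floor_sub_sub_le {U M : ℝ} (hU : 1 ≤ U) (hUM : U ≤ M) :
    |(∑ n ∈ Ioc ⌊U⌋₊ ⌊M⌋₊, (M - n)) - (M - U) ^ 2 / 2| ≤ M := by
  have a1 := Nat.floor_le (show 0 ≤ U by linarith)
  have a2 := Nat.lt_floor_add_one U
  have b1 := Nat.floor_le (show 0 ≤ M by linarith)
  have b2 := Nat.lt_floor_add_one M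
  have hBA : ⌊U⌋₊ ≤ ⌊M⌋₊ := Nat.floor_mono hUM
  have key : ∀ {b a : ℕ}, b ≤ a → ∑ n ∈ Ioc b a, (M - n) =
      ((a : ℝ) - b) * M - ((a : ℝ) * (a + 1) - b * (b + 1)) / 2 := by
    intro b a h
    induction a, h using Nat.le_induction with
    | base => simp
    | succ a h ih => rw [sum_Ioc_succ_top (by omega), ih]; push_cast; ring
  rw [key hBA]
  have hBA' : (⌊U⌋₊ : ℝ) ≤ ⌊M⌋₊ := by exact_mod_cast hBA
  set A : ℝ := (⌊M⌋₊ : ℝ)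
  set B : ℝ := (⌊U⌋₊ : ℝ)
  -- the difference in terms of the fractional parts of `U` and `M`
  have e : (A - B) * M - (A * (A + 1) - B * (B + 1)) / 2 - (M - U) ^ 2 / 2 =
      (A - B) * ((U - B) - 1 / 2) - ((M - A) - (U - B)) ^ 2 / 2 := by ring
  have h1 : ((M - A) - (U - B)) ^ 2 ≤ 1 := by
    rw [sq_le_one_iff_abs_le_one, abs_le]
    constructor <;> linarith
  have h2 := sq_nonneg ((M - A) - (U - B))
  rw [e, abs_le]
  constructor <;> nlinarith

/-- The harmonic sum over `k` for a fixed `q`; for `U - q < 1` the sum is empty. -/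
theorem abs_sum_one_div_mul_sub_sq_sub_le {U : ℝ} {q : ℕ} (hU : 1 ≤ U) (hq : 1 ≤ q)
    (hqU : (q : ℝ) ≤ U) :
    |(∑ k ∈ Icc 1 ⌊U - q⌋₊, (1 : ℝ) / k * (U - q - k) ^ 2) -
      (U - q) ^ 2 * (Real.log U + (Real.eulerMascheroniConstant - 3 / 2))| ≤ 6 * U * q := by
  have hq1 : (1 : ℝ) ≤ q := by exact_mod_cast hq
  have g1 := Real.eulerMascheroniConstant_lt_two_thirds
  have g2 := Real.one_half_lt_eulerMascheroniConstant
  have hU0 : 0 < U := by linarith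
  have hlog : 0 ≤ Real.log U := Real.log_nonneg hU
  have hlogU := one_add_log_le hU
  set y := U - q with hy
  have hy0 : 0 ≤ y := by rw [hy]; linarith
  rcases lt_or_ge y 1 with h | h
  · have h0 : ⌊y⌋₊ = 0 := Nat.floor_eq_zero.2 h
    rw [h0, Icc_eq_empty (by norm_num), sum_empty, zero_sub, abs_neg, abs_mul,
      abs_of_nonneg (sq_nonneg y)]
    have h1 : |Real.log U + (Real.eulerMascheroniConstant - 3 / 2)| ≤ U := by
      rw [abs_le]; constructor <;> linarith
    have h2 : y ^ 2 ≤ 1 := by nlinarith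
    calc _ ≤ 1 * U := mul_le_mul h2 h1 (abs_nonneg _) (by norm_num)
      _ ≤ _ := by nlinarith
  · have hy1 : 0 < y := by linarith
    have hK := abs_sum_one_sub_sq_kernel_sub_le h
    set K := ∑ k ∈ Icc 1 ⌊y⌋₊, (1 : ℝ) / k * (1 - k / y) ^ 2 with hKd
    have e : ∑ k ∈ Icc 1 ⌊y⌋₊, (1 : ℝ) / k * (y - k) ^ 2 = y ^ 2 * K := by
      rw [hKd, mul_sum]
      refine sum_congr rfl fun k _ => ?_
      field_simp
    have hl1 : 0 ≤ Real.log U - Real.log y := by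
      have := Real.log_le_log hy1 (show y ≤ U by rw [hy]; linarith)
      linarith
    have hl2 : Real.log U - Real.log y ≤ q / y := by
      rw [← Real.log_div hU0.ne' hy1.ne']
      refine (Real.log_le_sub_one_of_pos (by positivity)).trans (le_of_eq ?_)
      rw [eq_div_iff hy1.ne', sub_mul, div_mul_cancel₀ _ hy1.ne', hy]
      ring
    rw [e]
    calc _ = |y ^ 2 * (K - (Real.log y + (Real.eulerMascheroniConstant - 3 / 2))) -
          y ^ 2 * (Real.log U - Real.log y)| := by congr 1; ring
      _ ≤ y ^ 2 * (5 / y) + y ^ 2 * (q / y) := by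
          refine (abs_sub _ _).trans (add_le_add ?_ ?_)
          · rw [abs_mul, abs_of_nonneg (sq_nonneg y)]
            gcongr
          · rw [abs_mul, abs_of_nonneg (sq_nonneg y), abs_of_nonneg hl1]
            gcongr
      _ = y * (5 + q) := by field_simp
      _ ≤ U * (5 * q + q) := by
          gcongr
          · rw [hy]; linarith
          · linarith
      _ = _ := by ring

theorem R5_eq_sum (α : ℚ) {U : ℝ} (hU : 1 ≤ U) :
    (R5 α U : ℝ) = ∑ q ∈ Icc 1 ⌊U⌋₊, ∑ k ∈ Icc 1 ⌊U - q⌋₊,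
      ∑ n ∈ Ioc ⌊U⌋₊ ⌊(U ^ 2 - k * U) / q⌋₊, ∑ p ∈ Ioc ⌊U⌋₊ ⌊(U ^ 2 - n * q) / k⌋₊,
        if Admissible α p q then (1 : ℝ) else 0 := by
  have hU0 : 0 < U := by linarith
  have hB := floor_le_floor_sq hU
  have e0 : (R5 α U : ℝ) = ∑ q ∈ Icc 1 ⌊U ^ 2⌋₊, ∑ k ∈ Icc 1 ⌊U ^ 2⌋₊, ∑ n ∈ Icc 1 ⌊U ^ 2⌋₊,
      ∑ p ∈ Icc 1 ⌊U ^ 2⌋₊, if Admissible α p q ∧ (q < p ∧ U < (p : ℝ) ∧ U < (n : ℝ)) ∧ k < n ∧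
        ((n * q + k * p : ℕ) : ℝ) ≤ U ^ 2 then 1 else 0 := by
    rw [R5, count_eq_sum, sum_sum_sum_sum_comm, sum_comm (s := Icc 1 ⌊U ^ 2⌋₊)
      (t := Icc 1 ⌊U ^ 2⌋₊) (f := fun q k => ∑ n ∈ Icc 1 ⌊U ^ 2⌋₊, ∑ p ∈ Icc 1 ⌊U ^ 2⌋₊,
        if Admissible α p q ∧ (q < p ∧ U < (p : ℝ) ∧ U < (n : ℝ)) ∧ k < n ∧
        ((n * q + k * p : ℕ) : ℝ) ≤ U ^ 2 then (1 : ℝ) else 0)]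
    refine sum_congr rfl fun k _ => ?_
    refine sum_comm.trans ?_
    congr!
  rw [e0]
  set B := ⌊U ^ 2⌋₊ with hBd
  set N := ⌊U⌋₊ with hN
  have inner : ∀ q ∈ Icc 1 B, ∀ k ∈ Icc 1 B, (∑ n ∈ Icc 1 B, ∑ p ∈ Icc 1 B,
      if Admissible α p q ∧ (q < p ∧ U < (p : ℝ) ∧ U < (n : ℝ)) ∧ k < n ∧
        ((n * q + k * p : ℕ) : ℝ) ≤ U ^ 2 then (1 : ℝ) else 0) =
      if (q : ℝ) + k ≤ U then ∑ n ∈ Ioc N ⌊(U ^ 2 - k * U) / q⌋₊,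
        ∑ p ∈ Ioc N ⌊(U ^ 2 - n * q) / k⌋₊, if Admissible α p q then (1 : ℝ) else 0 else 0 := by
    intro q hq k hk
    rw [mem_Icc] at hq hk
    have hq1 : (1 : ℝ) ≤ q := by exact_mod_cast hq.1
    have hk1 : (1 : ℝ) ≤ k := by exact_mod_cast hk.1
    split_ifs with h
    · have hM : (U ^ 2 - k * U) / q ≤ U ^ 2 := by
        rw [div_le_iff₀ (by linarith)]
        nlinarith
      have g : ∀ n ∈ Icc 1 B, (∑ p ∈ Icc 1 B,
          if Admissible α p q ∧ (q < p ∧ U < (p : ℝ) ∧ U < (n : ℝ)) ∧ k < n ∧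
          ((n * q + k * p : ℕ) : ℝ) ≤ U ^ 2 then (1 : ℝ) else 0) =
          if n ∈ Ioc N ⌊(U ^ 2 - k * U) / q⌋₊ then
            ∑ p ∈ Ioc N ⌊(U ^ 2 - n * q) / k⌋₊, if Admissible α p q then (1 : ℝ) else 0
          else 0 := by
        intro n hn
        have hn0 : 0 < n := (mem_Icc.1 hn).1
        have hn1 : (1 : ℝ) ≤ n := by exact_mod_cast hn0
        have hmem : n ∈ Ioc N ⌊(U ^ 2 - k * U) / q⌋₊ ↔ U < n ∧ (n : ℝ) * q ≤ U ^ 2 - k * U := by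
          rw [mem_Ioc, hN, Nat.floor_lt hU0.le, Nat.le_floor_iff' hn0.ne',
            le_div_iff₀ (by linarith)]
        split_ifs with hn' <;> rw [hmem] at hn'
        · have hy : (U ^ 2 - n * q) / k ≤ U ^ 2 := by
            rw [div_le_iff₀ (by linarith)]
            nlinarith
          refine Eq.trans (sum_congr rfl fun p hp => ?_)
            (sum_ite_interval_eq (fun p => Admissible α p q) B (x := U) hU0.le (Nat.floor_mono hy))
          congr 1
          rw [le_div_iff₀ (by linarith), eq_iff_iff]
          push_cast
          constructor
          · rintro ⟨c1, ⟨c2, c3, c4⟩, c5, c6⟩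
            exact ⟨c1, c3, by linarith⟩
          · rintro ⟨c1, c3, c6⟩
            refine ⟨c1, ⟨?_, c3, hn'.1⟩, ?_, by linarith⟩
            · exact_mod_cast (by linarith : (q : ℝ) < p)
            · exact_mod_cast (by linarith : (k : ℝ) < n)
        · refine sum_eq_zero fun p hp => if_neg ?_
          rintro ⟨c1, ⟨c2, c3, c4⟩, c5, c6⟩
          push_cast at c6
          refine hn' ⟨c4, ?_⟩
          nlinarith
      rw [sum_congr rfl g, ← sum_filter]
      refine sum_congr ?_ fun _ _ => rfl
      ext n
      have := Nat.floor_mono hM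
      simp only [mem_filter, mem_Icc, mem_Ioc]
      omega
    · refine sum_eq_zero fun n hn => sum_eq_zero fun p hp => if_neg ?_
      rintro ⟨c1, ⟨c2, c3, c4⟩, c5, c6⟩
      push_cast at c6
      apply h
      have hUq : U * ((q : ℝ) + k) ≤ U * U := by nlinarith
      exact le_of_mul_le_mul_left hUq hU0
  rw [sum_congr rfl fun q hq => sum_congr rfl fun k hk => inner q hq k hk]
  have e : ∀ q ∈ Icc 1 B, (∑ k ∈ Icc 1 B, if (q : ℝ) + k ≤ U then
      ∑ n ∈ Ioc N ⌊(U ^ 2 - k * U) / q⌋₊,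
        ∑ p ∈ Ioc N ⌊(U ^ 2 - n * q) / k⌋₊, if Admissible α p q then (1 : ℝ) else 0 else 0) =
      ∑ k ∈ Icc 1 ⌊U - q⌋₊, ∑ n ∈ Ioc N ⌊(U ^ 2 - k * U) / q⌋₊,
        ∑ p ∈ Ioc N ⌊(U ^ 2 - n * q) / k⌋₊, if Admissible α p q then (1 : ℝ) else 0 := by
    intro q hq
    have hq1 : (1 : ℝ) ≤ q := by exact_mod_cast (mem_Icc.1 hq).1
    rw [← sum_filter]
    refine sum_congr ?_ fun _ _ => rfl
    have : ⌊U - q⌋₊ ≤ N := Nat.floor_mono (by linarith)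
    ext k
    simp only [mem_filter, mem_Icc]
    constructor
    · rintro ⟨⟨h1, h2⟩, h3⟩
      exact ⟨h1, (Nat.le_floor_iff' (by omega)).2 (by linarith)⟩
    · rintro ⟨h1, h2⟩
      have := (Nat.le_floor_iff' (by omega)).1 h2
      exact ⟨⟨h1, by omega⟩, by linarith⟩
  rw [sum_congr rfl e]
  refine (sum_subset (Icc_subset_Icc_right hB) fun q hq hq' => ?_).symm
  simp only [mem_Icc, not_and, not_le] at hq hq'
  have hUq := (Nat.floor_lt hU0.le).1 (hq' hq.1)
  rw [Nat.floor_of_nonpos (by linarith), Icc_eq_empty (by norm_num), sum_empty]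

/-- For fixed `q` and `k` the number of `(n, p)` is asymptotic to the area of a triangle. -/
theorem exists_abs_sum_admissible_triangle_sub_le :
    ∃ C : ℝ, 0 ≤ C ∧ ∀ (α : ℚ) (U : ℝ) (q k : ℕ), 0 < α → α ≤ 1 → 1 ≤ U → (α.den : ℝ) < U →
      1 ≤ q → 1 ≤ k → (q : ℝ) + k ≤ U →
      |(∑ n ∈ Ioc ⌊U⌋₊ ⌊(U ^ 2 - k * U) / q⌋₊, ∑ p ∈ Ioc ⌊U⌋₊ ⌊(U ^ 2 - n * q) / k⌋₊,
        if Admissible α p q then (1 : ℝ) else 0) -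
        U ^ 2 / 2 * ((coprimeCount α q : ℝ) / (q : ℝ) ^ 2 * (1 / k * (U - q - k) ^ 2))| ≤
        C * U ^ 2 := by
  obtain ⟨C, hC1, hC⟩ := exists_abs_congruenceCount_sub_le
  refine ⟨C + 1, by linarith, fun α U q k hα0 hα1 hU hw hq hk hqk => ?_⟩
  have h1 : (α : ℝ) ≤ 1 := by exact_mod_cast hα1
  have hU0 : 0 < U := by linarith
  have hq1 : (1 : ℝ) ≤ q := by exact_mod_cast hq
  have hk1 : (1 : ℝ) ≤ k := by exact_mod_cast hk
  set M := (U ^ 2 - k * U) / q with hM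
  have hMq : M * q = U ^ 2 - k * U := by rw [hM]; field_simp
  have hUM : U ≤ M := by
    rw [hM, le_div_iff₀ (by linarith)]
    nlinarith
  have hM2 : M ≤ U ^ 2 / q := by
    rw [hM]
    gcongr
    nlinarith
  have hc1 : (coprimeCount α q : ℝ) ≤ q := by exact_mod_cast coprimeCount_le h1 q
  have hceil := ceil_mul_le h1 q
  have hqq : (q : ℝ) ^ (9 / 10 : ℝ) ≤ q := by
    calc (q : ℝ) ^ (9 / 10 : ℝ) ≤ (q : ℝ) ^ (1 : ℝ) :=
          Real.rpow_le_rpow_of_exponent_le hq1 (by norm_num)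
      _ = q := Real.rpow_one _
  have hn : ∀ n ∈ Ioc ⌊U⌋₊ ⌊M⌋₊, |(∑ p ∈ Ioc ⌊U⌋₊ ⌊(U ^ 2 - n * q) / k⌋₊,
      if Admissible α p q then (1 : ℝ) else 0) - coprimeCount α q / k * (M - n)| ≤ C * q := by
    intro n hn
    have hnM : (n : ℝ) ≤ M := by
      rw [mem_Ioc] at hn
      exact (Nat.le_floor_iff' (by omega)).1 hn.2
    have h := hC q (-1) U ((U ^ 2 - n * q) / k) 0 ⌈(α : ℝ) * q⌉₊ hq hU0.le (by omega)
    rw [← coprimeCount_eq_card, congruenceCount] at h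
    have e1 : (∑ p ∈ Ioc ⌊U⌋₊ ⌊(U ^ 2 - n * q) / k⌋₊,
        if Admissible α p q then (1 : ℝ) else 0) = ∑ p ∈ Ioc ⌊U⌋₊ ⌊(U ^ 2 - n * q) / k⌋₊,
        ∑ j ∈ Ico 0 ⌈(α : ℝ) * q⌉₊,
          if (p : ZMod q) * (j : ZMod q) = ((-1 : (ZMod q)ˣ) : ZMod q) then (1 : ℝ) else 0 := by
      refine sum_congr rfl fun p hp => ?_
      have hpU := (Nat.floor_lt hU0.le).1 (mem_Ioc.1 hp).1
      refine ite_admissible_eq_of_den_le hα1 ?_ hq ?_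
      · have : (1 : ℝ) < p := by linarith
        exact_mod_cast this
      · exact_mod_cast (hw.trans hpU).le
    have e2 : (U ^ 2 - n * q) / k - U = q / k * (M - n) := by
      rw [mul_sub, div_mul_eq_mul_div, mul_comm (q : ℝ) M, hMq]
      field_simp
      ring
    have e3 : max ((U ^ 2 - n * q) / k - U) 0 / q * coprimeCount α q =
        coprimeCount α q / k * (M - n) := by
      rw [e2, max_eq_left (mul_nonneg (by positivity) (by linarith))]
      field_simp
    rw [← e1, e3] at h
    refine h.trans ?_
    gcongr
  have hA := abs_sum_Ioc_floor_sub_sub_le hU hUM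
  set A := ∑ n ∈ Ioc ⌊U⌋₊ ⌊M⌋₊, (M - n) with hAd
  have e4 : U ^ 2 / 2 * ((coprimeCount α q : ℝ) / (q : ℝ) ^ 2 * (1 / k * (U - q - k) ^ 2)) =
      coprimeCount α q / k * ((M - U) ^ 2 / 2) := by
    have : M - U = U * (U - q - k) / q := by
      rw [hM]; field_simp; ring
    rw [this]
    field_simp
  rw [e4]
  have s1 : |(∑ n ∈ Ioc ⌊U⌋₊ ⌊M⌋₊, ∑ p ∈ Ioc ⌊U⌋₊ ⌊(U ^ 2 - n * q) / k⌋₊,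
        if Admissible α p q then (1 : ℝ) else 0) - coprimeCount α q / k * A| ≤ C * U ^ 2 := by
    rw [hAd, mul_sum, ← sum_sub_distrib]
    refine (abs_sum_le_sum_abs _ _).trans ((sum_le_sum hn).trans ?_)
    rw [sum_const, Nat.card_Ioc, nsmul_eq_mul]
    have : ((⌊M⌋₊ - ⌊U⌋₊ : ℕ) : ℝ) ≤ ⌊M⌋₊ := by exact_mod_cast Nat.sub_le _ _
    calc _ ≤ U ^ 2 / q * (C * q) := by
          gcongr
          exact this.trans ((Nat.floor_le (by linarith)).trans hM2)
      _ = _ := by field_simp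
  calc _ = |((∑ n ∈ Ioc ⌊U⌋₊ ⌊M⌋₊, ∑ p ∈ Ioc ⌊U⌋₊ ⌊(U ^ 2 - n * q) / k⌋₊,
        if Admissible α p q then (1 : ℝ) else 0) - coprimeCount α q / k * A) +
        coprimeCount α q / k * (A - (M - U) ^ 2 / 2)| := by congr 1; ring
    _ ≤ C * U ^ 2 + q / 1 * (U ^ 2 / q) := by
        refine (abs_add_le _ _).trans (add_le_add s1 ?_)
        rw [abs_mul, abs_of_nonneg (by positivity)]
        gcongr
        exact hA.trans hM2
    _ = _ := by field_simp

theorem exists_abs_R5_sub_le :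
    ∃ C : ℝ, 0 ≤ C ∧ ∀ (α : ℚ) (U : ℝ), 0 < α → α ≤ 1 → 1 ≤ U → (α.den : ℝ) < U →
      |(R5 α U : ℝ) - ((α : ℝ) * U ^ 4 * Real.log U ^ 2 / (2 * zetaTwo)
        + (α : ℝ) * U ^ 4 * Real.log U / (2 * zetaTwo) *
          (2 * Real.eulerMascheroniConstant - zetaTwoDeriv / zetaTwo + F α - 3))| ≤
      C * U ^ 4 := by
  obtain ⟨C₁, hC₁, h₁⟩ := exists_abs_sum_admissible_triangle_sub_le
  obtain ⟨C₂, hC₂, h₂⟩ := exists_abs_sum_coprimeCount_one_sub_sq_sub_le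
  have hZ := zetaThreeHalves_nonneg
  have hz := zetaTwo_pos
  set z := zetaTwoDeriv / zetaTwo with hzd
  refine ⟨C₁ + 3 + 1 / 2 * (3 * C₂ + 1 / zetaTwo * (2 + |z| + zetaThreeHalves)), by positivity,
    fun α U hα0 hα1 hU hw => ?_⟩
  have h0 : (0 : ℝ) ≤ α := by exact_mod_cast hα0.le
  have h1 : (α : ℝ) ≤ 1 := by exact_mod_cast hα1
  have hU0 : 0 < U := by linarith
  have g1 := Real.eulerMascheroniConstant_lt_two_thirds
  have g2 := Real.one_half_lt_eulerMascheroniConstant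
  set c := Real.eulerMascheroniConstant - 3 / 2 with hc
  set N := ⌊U⌋₊ with hN
  have hNU : (N : ℝ) ≤ U := Nat.floor_le hU0.le
  set G : ℕ → ℝ := fun q => ∑ k ∈ Icc 1 ⌊U - q⌋₊, (1 : ℝ) / k * (U - q - k) ^ 2 with hG
  have s1 : |(R5 α U : ℝ) - U ^ 2 / 2 * ∑ q ∈ Icc 1 N, (coprimeCount α q : ℝ) / (q : ℝ) ^ 2 * G q| ≤
      C₁ * U ^ 4 := by
    rw [R5_eq_sum α hU, mul_sum, ← sum_sub_distrib]
    refine (abs_sum_le_sum_abs _ _).trans ?_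
    calc _ ≤ ∑ q ∈ Icc 1 N, U * (C₁ * U ^ 2) := by
          refine sum_le_sum fun q hq => ?_
          have hq1 : 1 ≤ q := (mem_Icc.1 hq).1
          simp only [hG]
          rw [mul_sum, mul_sum, ← sum_sub_distrib]
          refine (abs_sum_le_sum_abs _ _).trans ?_
          calc _ ≤ ∑ k ∈ Icc 1 ⌊U - q⌋₊, C₁ * U ^ 2 := by
                refine sum_le_sum fun k hk => ?_
                rw [mem_Icc] at hk
                have hkU := (Nat.le_floor_iff' (by omega)).1 hk.2
                exact h₁ α U q k hα0 hα1 hU hw hq1 hk.1 (by linarith)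
            _ ≤ _ := by
                rw [sum_const, Nat.card_Icc, nsmul_eq_mul, Nat.add_sub_cancel]
                gcongr
                have : ⌊U - q⌋₊ ≤ N := Nat.floor_mono (by linarith [Nat.cast_nonneg (α := ℝ) q])
                exact le_trans (by exact_mod_cast this) hNU
      _ ≤ U * (U * (C₁ * U ^ 2)) := by
          rw [sum_const, Nat.card_Icc, nsmul_eq_mul, Nat.add_sub_cancel]
          gcongr
      _ = _ := by ring
  set T := ∑ q ∈ Icc 1 N, (coprimeCount α q : ℝ) / (q : ℝ) ^ 2 * (1 - q / U) ^ 2 with hT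
  have s2 : |(∑ q ∈ Icc 1 N, (coprimeCount α q : ℝ) / (q : ℝ) ^ 2 * G q) -
      U ^ 2 * (Real.log U + c) * T| ≤ 6 * U ^ 2 := by
    rw [hT, mul_sum, ← sum_sub_distrib]
    refine (abs_sum_le_sum_abs _ _).trans ?_
    calc _ ≤ ∑ q ∈ Icc 1 N, 6 * U := by
          refine sum_le_sum fun q hq => ?_
          rw [mem_Icc] at hq
          have hq1 : (1 : ℝ) ≤ q := by exact_mod_cast hq.1
          have hqU : (q : ℝ) ≤ U := (Nat.le_floor_iff' (by omega)).1 hq.2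
          have hcq : (coprimeCount α q : ℝ) ≤ q := by exact_mod_cast coprimeCount_le h1 q
          have hg := abs_sum_one_div_mul_sub_sq_sub_le hU hq.1 hqU
          calc _ = |(coprimeCount α q : ℝ) / (q : ℝ) ^ 2 *
                (G q - (U - q) ^ 2 * (Real.log U + c))| := by
                congr 1
                field_simp
            _ ≤ q / (q : ℝ) ^ 2 * (6 * U * q) := by
                rw [abs_mul, abs_of_nonneg (by positivity)]
                gcongr
            _ = _ := by field_simp
      _ ≤ U * (6 * U) := by
          rw [sum_const, Nat.card_Icc, nsmul_eq_mul, Nat.add_sub_cancel]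
          gcongr
      _ = _ := by ring
  have s3 := h₂ α U h0 h1 hU
  rw [← hN, ← hT] at s3
  have hser := ceilSeries_nonneg (α : ℝ)
  have hser' := ceilSeries_le h0
  rw [ceilSeries_eq α hα0] at s3 hser hser'
  set E := α * (Real.log U + Real.eulerMascheroniConstant - 3 / 2 - zetaTwoDeriv / zetaTwo) +
    α * F α with hE
  have hlog : 0 ≤ Real.log U := Real.log_nonneg hU
  have p2 : 1 ≤ U ^ (1 / 2 : ℝ) := Real.one_le_rpow hU (by norm_num)
  have hl2 := log_le_two_mul_sqrt hU
  have s4 : |(Real.log U + c) * (T - 1 / zetaTwo * E)| ≤ 3 * C₂ := by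
    rw [abs_mul]
    calc _ ≤ (3 * U ^ (1 / 2 : ℝ)) * (C₂ * (U ^ (1 / 2 : ℝ))⁻¹) := by
          gcongr
          rw [abs_le]
          constructor <;> linarith
      _ = _ := by field_simp
  have s5 : |1 / zetaTwo * (c * (α * (c - z) + α * F α))| ≤
      1 / zetaTwo * (2 + |z| + zetaThreeHalves) := by
    rw [abs_mul, abs_of_nonneg (by positivity)]
    gcongr
    have hc1 : |c| ≤ 1 := by rw [abs_le]; constructor <;> linarith
    rw [abs_mul]
    calc _ ≤ 1 * |α * (c - z) + α * F α| := by gcongr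
      _ ≤ 1 * ((1 + |z|) + zetaThreeHalves) := by
          gcongr
          refine (abs_add_le _ _).trans (add_le_add ?_ ?_)
          · rw [abs_mul, abs_of_nonneg h0]
            calc _ ≤ 1 * |c - z| := by gcongr
              _ ≤ 1 * (|c| + |z|) := by gcongr; exact abs_sub _ _
              _ ≤ _ := by linarith
          · rw [abs_of_nonneg hser]; exact hser'
      _ ≤ _ := by linarith
  have hU4 : 0 ≤ U ^ 4 := by positivity
  set Y := ∑ q ∈ Icc 1 N, (coprimeCount α q : ℝ) / (q : ℝ) ^ 2 * G q
  calc _ = |((R5 α U : ℝ) - U ^ 2 / 2 * Y) + U ^ 2 / 2 * (Y - U ^ 2 * (Real.log U + c) * T) +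
        U ^ 4 / 2 * ((Real.log U + c) * (T - 1 / zetaTwo * E) +
          1 / zetaTwo * (c * (α * (c - z) + α * F α)))| := by
        congr 1
        rw [hE, hc, hzd]
        field_simp
        ring
    _ ≤ C₁ * U ^ 4 + U ^ 2 / 2 * (6 * U ^ 2) + U ^ 4 / 2 *
        (3 * C₂ + 1 / zetaTwo * (2 + |z| + zetaThreeHalves)) := by
        refine (abs_add_three _ _ _).trans (add_le_add (add_le_add s1 ?_) ?_)
        · rw [abs_mul, abs_of_nonneg (by positivity)]
          gcongr
        · rw [abs_mul, abs_of_nonneg (by positivity)]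
          gcongr
          exact (abs_add_le _ _).trans (add_le_add s4 s5)
    _ = _ := by ring

end

end GapSystem

theorem mainTheorem4 :
    ∃ C : ℝ, ∀ (α : ℚ) (U : ℝ), 0 < α → α ≤ 1 → 1 ≤ U →
      |(GapSystem.R1 α U : ℝ)
          - (α : ℝ) * Real.log 2 / (2 * GapSystem.zetaTwo) * U ^ 4 * Real.log U|
        ≤ C * U ^ 4 ∧
      |(GapSystem.R2 α U : ℝ)
          - (α : ℝ) * Real.log 2 / (2 * GapSystem.zetaTwo) * U ^ 4 * Real.log U|
        ≤ C * U ^ 4 ∧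
      |(GapSystem.R3 α U : ℝ) / U ^ 4
          - ((α : ℝ) * Real.log U ^ 2 / (4 * GapSystem.zetaTwo)
            + (α : ℝ) * Real.log U / (2 * GapSystem.zetaTwo)
              * (Real.eulerMascheroniConstant - GapSystem.zetaTwoDeriv / GapSystem.zetaTwo
                + GapSystem.F α - Real.log 2))|
        ≤ C * (1 + Real.log (α.den : ℝ) ^ 2) ∧
      |(GapSystem.R4 α U : ℝ)
          - ((α : ℝ) * U ^ 4 * Real.log U ^ 2 / (4 * GapSystem.zetaTwo)
            + (α : ℝ) * U ^ 4 * Real.log U / (2 * GapSystem.zetaTwo)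
              * (Real.eulerMascheroniConstant - Real.log 2))|
        ≤ C * U ^ 4 ∧
      ((α.den : ℝ) < U →
        |(GapSystem.R5 α U : ℝ)
            - ((α : ℝ) * U ^ 4 * Real.log U ^ 2 / (2 * GapSystem.zetaTwo)
              + (α : ℝ) * U ^ 4 * Real.log U / (2 * GapSystem.zetaTwo)
                * (2 * Real.eulerMascheroniConstant - GapSystem.zetaTwoDeriv / GapSystem.zetaTwo
                  + GapSystem.F α - 3))|
          ≤ C * U ^ 4) := by
  obtain ⟨C₁, hC₁, h₁⟩ := GapSystem.exists_abs_R1_sub_le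
  obtain ⟨C₂, hC₂, h₂⟩ := GapSystem.exists_abs_R2_sub_le
  obtain ⟨C₃, hC₃, h₃⟩ := GapSystem.exists_abs_R3_sub_le
  obtain ⟨C₄, hC₄, h₄⟩ := GapSystem.exists_abs_R4_sub_le
  obtain ⟨C₅, hC₅, h₅⟩ := GapSystem.exists_abs_R5_sub_le
  refine ⟨C₁ + C₂ + C₃ + C₄ + C₅, fun α U hα0 hα1 hU => ?_⟩
  have hU4 : 0 ≤ U ^ 4 := by positivity
  refine ⟨(h₁ α U hα0 hα1 hU).trans ?_, (h₂ α U hα0 hα1 hU).trans ?_,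
    (h₃ α U hα0 hα1 hU).trans ?_, (h₄ α U hα0 hα1 hU).trans ?_,
    fun hw => (h₅ α U hα0 hα1 hU hw).trans ?_⟩
  all_goals
    gcongr
    linarith
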